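/- Let $R(q)$ be the Rogers–Ramanujan continued fraction $$R(q)=\cfrac{1}{1+\cfrac{q}{1+\cfrac{q^2}{1+\cfrac{q^3}{1+\cdots}}}},$$ regarded as a formal power series in $q$ (the coefficientwise limit of its convergents; its constant term is $1$). Define sequences $\lambda_1,\dots,\lambda_{10}$ by $$\begin{aligned} \sum_{n\ge0}\lambda_1(n)q^n&=\frac{1}{R^5(q)}, & \sum_{n\ge0}\lambda_2(n)q^n&=\frac{R^5(q)}{R(q^5)}, & \sum_{n\ge0}\lambda_3(n)q^n&=\frac{R(q^2)}{R^2(q)},\\ \sum_{n\ge0}\lambda_4(n)q^n&=\frac{1}{R(q)R^2(q^2)}, & \sum_{n\ge0}\lambda_5(n)q^n&=\frac{1}{R(q)R(q^4)}, & \sum_{n\ge0}\lambda_6(n)q^n&=\frac{1}{R(-q)R(-q^4)},\\ \sum_{n\ge0}\lambda_7(n)q^n&=\frac{R(q^4)}{R^4(q)}, & \sum_{n\ge0}\lambda_8(n)q^n&=\frac{R^2(q)}{R^3(q^4)}, & \sum_{n\ge0}\lambda_9(n)q^n&=\frac{R(q)}{R(q^{16})},\\ \sum_{n\ge0}\lambda_{10}(n)q^n&=\frac{R(q^4)}{R^2(q)R(q^2)},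 \end{aligned}$$ where $R^k(q)$ means $(R(q))^k$, and let $\lambda_i'(n)$ be the coefficient of $q^n$ in the reciprocal series, i.e. $\sum_{n\ge0}\lambda_i'(n)q^n=\bigl(\sum_{n\ge0}\lambda_i(n)q^n\bigr)^{-1}$. Then, for every integer $n\ge0$: 1. $\lambda_1(5n+r)=-\lambda_1'(5n+r-2)$ for $r\in\{3,4\}$; 2. $\lambda_2(5n)=\lambda_2'(5n)$; 3. $\lambda_3(5n+r)=-\lambda_3'(5n+r)$ for $r\in\{1,4\}$; 4. $\lambda_4(5n+r)=-\lambda_4'(5n+r-2)$ for $r\in\{3,4\}$; 5. $\lambda_5(5n+r)=\lambda_5'(5n+r-2)$ for $r\in\{3,4\}$; 6. $\lambda_6(10n+r)=\lambda_6'(10n+r-2)$ for $r\in\{5,7\}$; 7. $\lambda_7(10n+r)=-\lambda_7'(10n+r)$ for $r\in\{1,9\}$; 8. $\lambda_8(10n+r)=-\lambda_8'(10n+r-4)$ for $r\in\{5,9\}$; 9. $\lambda_9(10n+r)=\lambda_9'(10n+r-6)$ for $r\in\{7,9\}$; 10. $\lambda_{10}(2n+r)=(-1)^r\lambda_{10}'(2n+r)$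 for $r\in\{0,1\}$; 11. $\lambda_{10}(5n+r)=\lambda_{10}'(5n+r)$ for $r\in\{2,3\}$. -/

import Mathlib

open scoped PowerSeries

namespace RogersRamanujanCF

open PowerSeries

/-- `denom k d` is the finite continued fraction
`1 + q^(k+1) / (1 + q^(k+2) / (1 + ⋯ + q^(k+d) / 1))` with `d` fraction bars, as a formal power
series in `q` (it has constant term `1`, see `constantCoeff_denom`, hence is invertible). -/
noncomputable def denom : ℕ → ℕ → ℚ⟦X⟧
  | _, 0 => 1
  | k, d + 1 => 1 + X ^ (k + 1) * (denom (k + 1) d)⁻¹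

/-- The `N`-th convergent `1 / (1 + q / (1 + q^2 / (1 + ⋯ + q^N / 1)))` of the Rogers–Ramanujan
continued fraction, as a formal power series in `q`. -/
noncomputable def convergent (N : ℕ) : ℚ⟦X⟧ := (denom 0 N)⁻¹

/-- The Rogers–Ramanujan continued fraction `1 / (1 + q / (1 + q^2 / (1 + q^3 / (1 + ⋯))))` as a
formal power series in `q`: the coefficientwise limit of its convergents. The coefficient of `q^m`
is the same in all convergents from the `m`-th one on, see `coeff_convergent`. -/
noncomputable def series : ℚ⟦X⟧ := PowerSeries.mk fun m => coeff m (convergent m)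

/-- `R u` is the Rogers–Ramanujan continued fraction `R(u)` at a formal power series `u` with
zero constant term: `u` is substituted for the variable. -/
noncomputable def R (u : ℚ⟦X⟧) : ℚ⟦X⟧ := series.subst u

theorem constantCoeff_denom (k d : ℕ) : constantCoeff (denom k d) = 1 := by
  cases d <;> simp [denom]

theorem dvd_inv_sub_inv {a b : ℚ⟦X⟧} (ha : constantCoeff a = 1) (hb : constantCoeff b = 1)
    {m : ℕ} (h : X ^ m ∣ a - b) : X ^ m ∣ a⁻¹ - b⁻¹ := by
  have ha' : a * a⁻¹ = 1 := PowerSeries.mul_inv_cancel a (by simp [ha])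
  have hb' : b * b⁻¹ = 1 := PowerSeries.mul_inv_cancel b (by simp [hb])
  have e : a⁻¹ - b⁻¹ = (a - b) * (-(a⁻¹ * b⁻¹)) := by
    linear_combination b⁻¹ * ha' - a⁻¹ * hb'
  rw [e]
  exact h.mul_right _

theorem dvd_denom_succ_sub (k d : ℕ) : X ^ (d + 1) ∣ denom k (d + 1) - denom k d := by
  induction d generalizing k with
  | zero =>
    have e : denom k (0 + 1) - denom k 0 = X ^ (0 + 1) * (X ^ k * (denom (k + 1) 0)⁻¹) := by
      simp only [denom]; ring
    rw [e]
    exact Dvd.intro _ rfl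
  | succ d ih =>
    have h := dvd_inv_sub_inv (constantCoeff_denom _ _) (constantCoeff_denom _ _) (ih (k + 1))
    have e : denom k (d + 1 + 1) - denom k (d + 1)
        = X * ((denom (k + 1) (d + 1))⁻¹ - (denom (k + 1) d)⁻¹) * X ^ k := by
      have e1 : denom k (d + 1 + 1) = 1 + X ^ (k + 1) * (denom (k + 1) (d + 1))⁻¹ := rfl
      have e2 : denom k (d + 1) = 1 + X ^ (k + 1) * (denom (k + 1) d)⁻¹ := rfl
      rw [e1, e2]; ring
    rw [e, pow_succ' X (d + 1)]
    exact (mul_dvd_mul_left X h).mul_right _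

/-- The convergents converge coefficientwise (that is, `q`-adically) to `series`. -/
theorem coeff_convergent {m N : ℕ} (h : m ≤ N) : coeff m (convergent N) = coeff m series := by
  induction N, h using Nat.le_induction with
  | base => simp [series]
  | succ N hN ih =>
    rw [← ih]
    have h := dvd_inv_sub_inv (constantCoeff_denom _ _) (constantCoeff_denom _ _)
      (dvd_denom_succ_sub 0 N)
    have h' := X_pow_dvd_iff.1 h m (by omega)
    rw [map_sub, sub_eq_zero] at h'
    exact h'

theorem constantCoeff_series : constantCoeff series = 1 := by
  rw [← coeff_zero_eq_constantCoeff_apply, ← coeff_convergent (le_refl 0)]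
  simp [convergent, denom]

/-- `R u` has constant term `1`, so it is invertible and `(R u)⁻¹` is its true reciprocal. -/
theorem constantCoeff_R {u : ℚ⟦X⟧} (hu : constantCoeff u = 0) : constantCoeff (R u) = 1 := by
  have hs : HasSubst u := HasSubst.of_constantCoeff_zero' hu
  obtain ⟨g, hg⟩ : X ∣ series - 1 := X_dvd_iff.2 (by simp [constantCoeff_series])
  have e : series = 1 + X * g := by rw [← hg]; ring
  have h1 : subst u (1 : ℚ⟦X⟧) = 1 := by
    rw [← coe_substAlgHom hs, map_one]
  have : R u = 1 + u * subst u g := by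
    rw [R, e, subst_add hs, subst_mul hs, subst_X hs, h1]
  rw [this]
  simp [hu]

end RogersRamanujanCF

open PowerSeries RogersRamanujanCF

/-! Each assertion says that `g ± q^c g⁻¹`, with `g` the quotient defining `λ_i`, has no exponents
in certain residue classes. Put `t = q R(q)^5`, `k = q R(q) R(q²)²`, `m = R(q)²/R(q²)` and `s = k/(1
- k²)`. Up to a power of `q` these combinations are `t + 1/t`, `m + 1/m`, `k + 1/k`, or expressions
built from them at `q²`, `q⁴`, `q⁸`.

Residues modulo 5 are read off over the field of Laurent series in `q⁵`. The series `v = q R(q⁵)`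
and `w = q² R(q¹⁰)` have exponents congruent to 1 and 2, so a Laurent polynomial in `v` or `w` with
coefficients in that field displays its support. The rewriting rests on `series_modular_five`, which
makes `t` rational in `v` and `k` rational in `v, w`, and on `w⁵ (1 - K) = K² (1 + K)` for `K =
k(q⁵) = v w²` (`wL_pow_five`).

The modular equations start from `series_mul_thetaAlt`: alternating series of Rogers telescope to
the recurrence of the continued fraction, so `R` is a quotient of two theta series. Regrouping
products of two theta series along an index two sublattice gives `series_modular_two`. The degree
five equations need no further theta functions: `R(q)^5` and `R(q) R(q²)²` solve a system whose
solution is unique by `q`-adic contraction (`eq_of_modular_system`), and the expected rational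
functions of `v, w` solve it too.

For the quotients involving `q⁴`, `q¹⁶` or `-q`, the product formula `dilate_four_rL` relates
`R(-q)` to `R(q)`. With `κ = k(q²)` one gets `k (1 + κ) = Y - κ`, where `Y` is odd and `Y² = κ (1 +
κ - κ²)`. Then `Z = Y/(1 - κ²)` satisfies `Z² = s(q²) + s(q²)²`, while `s + s² = K (1 + K - K²) ψ²`
with `ψ` explicit in `w`. Hence `Z = ± Y(q⁵) ψ(q²)` (`exists_zL_eq`), which fixes its parity and its
residues modulo 5 at once. The classes modulo 10 in question are all odd, so only odd parts matter
there, and these are expressed through `Z` and its dilations. -/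

namespace RogersRamanujanCF

open scoped LaurentSeries Pointwise

/-! ### Rogers' alternating series and the continued fraction -/

/-- `pent n = n (5 n - 1) / 2`. -/
def pent : ℕ → ℕ
  | 0 => 0
  | n + 1 => pent n + (5 * n + 2)

theorem le_pent (n : ℕ) : n ≤ pent n := by
  induction n with
  | zero => simp
  | succ n ih => simp only [pent]; omega

theorem two_mul_pent (n : ℕ) : 2 * (pent n : ℤ) = 5 * (n : ℤ) ^ 2 - n := by
  induction n with
  | zero => simp [pent]
  | succ n ih => simp only [pent]; push_cast; linear_combination ih

noncomputable def rogersWeight (k n : ℕ) : ℚ⟦X⟧ :=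
  (-1) ^ n * X ^ (2 * (k + 1) * n + pent n) * ∏ j ∈ Finset.range k, (1 - X ^ (n + j + 1))

/-- The `n`-th term of the alternating series of Rogers for
`(q)_∞ ∑ q ^ (n ^ 2 + k n) / (q)_n`. -/
noncomputable def rogersTerm : ℕ → ℕ → ℚ⟦X⟧
  -- The general shape would carry `1/(1 - q^n)` when `k = 0`; against `1 - q^(2n)` this leaves `1 +
  -- q^n` for positive `n`, and `n = 0` is exceptional.
  | 0, 0 => 1
  | 0, n + 1 => (-1) ^ (n + 1) * X ^ pent (n + 1) * (1 + X ^ (n + 1))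
  | k + 1, n => rogersWeight k n * (1 - X ^ (k + 1 + 2 * n))

noncomputable def rogersSum (k N : ℕ) : ℚ⟦X⟧ := ∑ n ∈ Finset.range N, rogersTerm k n

theorem rogersWeight_succ_left (k n : ℕ) :
    rogersWeight (k + 1) n = rogersWeight k n * (X ^ (2 * n) * (1 - X ^ (n + k + 1))) := by
  simp only [rogersWeight, Finset.prod_range_succ]; ring

theorem rogersWeight_succ_right (k n : ℕ) :
    rogersWeight k (n + 1) * (1 - X ^ (n + 1)) =
      -rogersWeight k n * (X ^ (2 * (k + 1) + 5 * n + 2) * (1 - X ^ (n + k + 1))) := by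
  have h : (∏ j ∈ Finset.range k, (1 - X ^ (n + 1 + j + 1) : ℚ⟦X⟧)) * (1 - X ^ (n + 1)) =
      (∏ j ∈ Finset.range k, (1 - X ^ (n + j + 1))) * (1 - X ^ (n + k + 1)) := by
    rw [← Finset.prod_range_succ, Finset.prod_range_succ']
    congr 1
    exact Finset.prod_congr rfl fun j _ => by rw [show n + 1 + j + 1 = n + (j + 1) + 1 by ring]
  simp only [rogersWeight, pent]
  rw [mul_assoc, h]; ring

/-- An antidifference in `n` for the three-term relation in `k`. The factor `1 - X ^ n` kills the
lower boundary, so a sum up to `N` leaves only the term at `N`. -/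
noncomputable def rogersCert (k n : ℕ) : ℚ⟦X⟧ :=
  -rogersWeight k n * (1 - X ^ n) * (1 + X ^ n - X ^ (k + 1 + 2 * n))

theorem rogersTerm_telescope (k n : ℕ) :
    rogersTerm (k + 1) n - rogersTerm (k + 2) n - X ^ (k + 2) * rogersTerm (k + 3) n =
      rogersCert k (n + 1) - rogersCert k n := by
  have h := rogersWeight_succ_right k n
  have e : rogersCert k (n + 1) =
      -(rogersWeight k (n + 1) * (1 - X ^ (n + 1))) *
        (1 + X ^ (n + 1) - X ^ (k + 1 + 2 * (n + 1))) := by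
    simp only [rogersCert]; ring
  rw [e, h]
  simp only [rogersCert, rogersTerm, rogersWeight_succ_left]
  ring

theorem rogersTerm_zero_telescope (n : ℕ) :
    rogersTerm 0 (n + 1) - rogersTerm 1 (n + 1) - X * rogersTerm 2 (n + 1) =
      -((-1) ^ (n + 2) * X ^ pent (n + 2)) * (1 + X ^ (n + 2) - X ^ (2 * (n + 2))) +
      ((-1) ^ (n + 1) * X ^ pent (n + 1)) * (1 + X ^ (n + 1) - X ^ (2 * (n + 1))) := by
  simp only [rogersTerm, rogersWeight, pent, Finset.prod_range_succ, Finset.prod_range_zero]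
  ring

theorem rogersSum_succ_eq (k N : ℕ) :
    rogersSum (k + 1) N - rogersSum (k + 2) N - X ^ (k + 2) * rogersSum (k + 3) N =
      rogersCert k N := by
  simp only [rogersSum, Finset.mul_sum, ← Finset.sum_sub_distrib, rogersTerm_telescope]
  rw [Finset.sum_range_sub]
  simp [rogersCert]

theorem rogersSum_zero_eq (N : ℕ) :
    rogersSum 0 (N + 1) - rogersSum 1 (N + 1) - X * rogersSum 2 (N + 1) =
      -((-1) ^ (N + 1) * X ^ pent (N + 1)) * (1 + X ^ (N + 1) - X ^ (2 * (N + 1))) := by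
  induction N with
  | zero => simp [rogersSum, rogersTerm, rogersWeight, pent]; ring
  | succ N ih =>
    have h := rogersTerm_zero_telescope N
    simp only [rogersSum] at ih ⊢
    rw [Finset.sum_range_succ (rogersTerm 0), Finset.sum_range_succ (rogersTerm 1),
      Finset.sum_range_succ (rogersTerm 2)]
    linear_combination ih + h

/-- The boundary term left by telescoping contains `X ^ pent N`, and `N ≤ pent N`. In the limit,
`G_k = G_{k+1} + q^(k+1) G_{k+2}`. -/
theorem dvd_rogersSum_recurrence (k N : ℕ) :
    X ^ N ∣ rogersSum k N - rogersSum (k + 1) N - X ^ (k + 1) * rogersSum (k + 2) N := by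
  rcases k with _ | k
  · rcases N with _ | N
    · simp
    rw [zero_add, zero_add, pow_one, rogersSum_zero_eq]
    exact Dvd.dvd.mul_right ((Dvd.dvd.mul_left (pow_dvd_pow _ (le_pent _)) _).neg_right) _
  · rw [rogersSum_succ_eq, rogersCert, rogersWeight]
    have h : (X : ℚ⟦X⟧) ^ N ∣ X ^ (2 * (k + 1) * N + pent N) :=
      pow_dvd_pow _ ((le_pent N).trans (Nat.le_add_left _ _))
    obtain ⟨c, hc⟩ := h
    rw [hc]
    exact ⟨-((-1) ^ N * c * ∏ j ∈ Finset.range k, (1 - X ^ (N + j + 1))) * (1 - X ^ N) *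
      (1 + X ^ N - X ^ (k + 1 + 2 * N)), by ring⟩

/-- Dividing the recurrence by `G_{k+1}` makes `G_k / G_{k+1}` unfold into the same continued
fraction as `denom k`. Every fraction bar gains at least one order in `q`, whence the precision `d +
1`. -/
theorem dvd_denom_mul_rogersSum (N d : ℕ) :
    ∀ k e, e ≤ N → e ≤ d + 1 →
      X ^ e ∣ denom k d * rogersSum (k + 1) N - rogersSum k N := by
  induction d with
  | zero =>
    intro k e he hd
    have h1 := (pow_dvd_pow X he).trans (dvd_rogersSum_recurrence k N)
    have h2 : (X : ℚ⟦X⟧) ^ e ∣ X ^ (k + 1) * rogersSum (k + 2) N :=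
      (pow_dvd_pow X (by omega)).mul_right _
    have h3 := (h1.add h2).neg_right
    convert h3 using 1
    simp only [denom]; ring
  | succ d ih =>
    intro k e he hd
    have h1 := (pow_dvd_pow X he).trans (dvd_rogersSum_recurrence k N)
    have hD : denom (k + 1) d * (denom (k + 1) d)⁻¹ = 1 :=
      PowerSeries.mul_inv_cancel _ (by simp [constantCoeff_denom])
    have h2 : (X : ℚ⟦X⟧) ^ e ∣ X ^ (k + 1) *
        (denom (k + 1) d * rogersSum (k + 2) N - rogersSum (k + 1) N) := by
      -- The factor `X ^ (k + 1)` supplies one order, so the induction hypothesis is needed only to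
      -- order `e - 1`.
      rcases e with _ | e
      · simp
      rw [pow_succ', pow_succ', mul_assoc]
      exact mul_dvd_mul_left X ((ih (k + 1) e (by omega) (by omega)).mul_left _)
    have h3 := (h1.add (h2.mul_right (denom (k + 1) d)⁻¹)).neg_right
    convert h3 using 1
    simp only [denom]
    linear_combination (X ^ (k + 1) * rogersSum (k + 2) N) * hD

theorem dvd_series_mul_rogersSum (N : ℕ) :
    X ^ N ∣ series * rogersSum 0 N - rogersSum 1 N := by
  have h1 := dvd_denom_mul_rogersSum N N 0 N le_rfl (by omega)
  have h2 : X ^ N ∣ series - convergent N := by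
    rw [X_pow_dvd_iff]
    intro m hm
    rw [map_sub, coeff_convergent hm.le, sub_self]
  have hD : denom 0 N * (denom 0 N)⁻¹ = 1 :=
    PowerSeries.mul_inv_cancel _ (by simp [constantCoeff_denom])
  have h3 := (h2.mul_right (rogersSum 0 N)).sub (h1.mul_left (denom 0 N)⁻¹)
  convert h3 using 1
  simp only [convergent]
  linear_combination (rogersSum 1 N) * hD

/-! ### Formal sums indexed by infinite sets -/

/-- The formal sum `∑ i, s i * X ^ e i`, meaningful when every exponent occurs finitely often. -/
noncomputable def expSum {ι : Type*} (e : ι → ℕ) (s : ι → ℚ) : ℚ⟦X⟧ :=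
  PowerSeries.mk fun N => ∑ᶠ i, if e i = N then s i else 0

def FiniteFibers {ι : Type*} (e : ι → ℕ) : Prop := ∀ N, {i | e i = N}.Finite

theorem FiniteFibers.finite_lt {ι : Type*} {e : ι → ℕ} (h : FiniteFibers e) (N : ℕ) :
    {i | e i < N}.Finite := by
  have : {i | e i < N} = ⋃ M ∈ Finset.range N, {i | e i = M} := by
    ext i; simp
  rw [this]
  exact Set.Finite.biUnion (Finset.finite_toSet _) fun M _ => h M

theorem coeff_expSum {ι : Type*} (e : ι → ℕ) (s : ι → ℚ) (N : ℕ) (F : Finset ι)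
    (hF : ∀ i, e i = N → i ∈ F) :
    coeff N (expSum e s) = coeff N (∑ i ∈ F, C (s i) * X ^ e i : ℚ⟦X⟧) := by
  rw [expSum, coeff_mk, finsum_eq_sum_of_support_subset (s := F)]
  · rw [map_sum]
    exact Finset.sum_congr rfl fun i _ => by
      simp [coeff_X_pow, eq_comm]
  · intro i hi
    by_contra hn
    exact hi (if_neg fun h => hn (hF i h))

theorem dvd_expSum_sub {ι : Type*} (e : ι → ℕ) (s : ι → ℚ) (N : ℕ) (F : Finset ι)
    (hF : ∀ i, e i < N → i ∈ F) :
    X ^ N ∣ expSum e s - ∑ i ∈ F, C (s i) * X ^ e i := by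
  rw [X_pow_dvd_iff]
  intro m hm
  rw [map_sub, coeff_expSum e s m F fun i hi => hF i (by omega), sub_self]

theorem eq_of_forall_X_pow_dvd {f g : ℚ⟦X⟧} (h : ∀ N : ℕ, X ^ N ∣ f - g) : f = g := by
  ext n
  have := X_pow_dvd_iff.1 (h (n + 1)) n (by omega)
  rwa [map_sub, sub_eq_zero] at this

theorem FiniteFibers.add {ι κ : Type*} {e : ι → ℕ} {e' : κ → ℕ} (h : FiniteFibers e)
    (h' : FiniteFibers e') : FiniteFibers fun p : ι × κ => e p.1 + e' p.2 := by
  intro N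
  refine ((h.finite_lt (N + 1)).prod (h'.finite_lt (N + 1))).subset ?_
  rintro ⟨i, j⟩ hij
  simp only [Set.mem_ofPred_eq] at hij
  simp only [Set.mem_prod, Set.mem_ofPred_eq]
  omega

theorem expSum_mul {ι κ : Type*} {e : ι → ℕ} {e' : κ → ℕ} (h : FiniteFibers e)
    (h' : FiniteFibers e') (s : ι → ℚ) (t : κ → ℚ) :
    expSum e s * expSum e' t = expSum (fun p : ι × κ => e p.1 + e' p.2) fun p => s p.1 * t p.2 := by
  refine eq_of_forall_X_pow_dvd fun N => ?_
  have h1 := dvd_expSum_sub e s N (h.finite_lt N).toFinset (by simp)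
  have h2 := dvd_expSum_sub e' t N (h'.finite_lt N).toFinset (by simp)
  have h3 := dvd_expSum_sub (fun p : ι × κ => e p.1 + e' p.2) (fun p => s p.1 * t p.2) N
    ((h.finite_lt N).toFinset ×ˢ (h'.finite_lt N).toFinset) (by
      rintro ⟨i, j⟩ hij
      simp only [Finset.mem_product, Set.Finite.mem_toFinset, Set.mem_ofPred_eq]
      dsimp only at hij
      omega)
  have e1 : ∑ p ∈ (h.finite_lt N).toFinset ×ˢ (h'.finite_lt N).toFinset,
      C (s p.1 * t p.2) * (X : ℚ⟦X⟧) ^ (e p.1 + e' p.2) =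
      (∑ i ∈ (h.finite_lt N).toFinset, C (s i) * X ^ e i) *
        ∑ j ∈ (h'.finite_lt N).toFinset, C (t j) * X ^ e' j := by
    rw [Finset.sum_product, Finset.sum_mul_sum]
    refine Finset.sum_congr rfl fun i _ => Finset.sum_congr rfl fun j _ => ?_
    rw [map_mul, pow_add]; ring
  rw [e1] at h3
  have h4 := ((h1.mul_right (expSum e' t)).add
    (h2.mul_left (∑ i ∈ (h.finite_lt N).toFinset, C (s i) * X ^ e i))).sub h3
  convert h4 using 1
  ring

theorem expSum_comp_equiv {ι κ : Type*} (φ : ι ≃ κ) (e : κ → ℕ) (s : κ → ℚ) :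
    expSum (e ∘ φ) (s ∘ φ) = expSum e s := by
  ext N
  simp only [expSum, coeff_mk, Function.comp]
  exact finsum_comp_equiv φ (f := fun i => if e i = N then s i else 0)

theorem FiniteFibers.comp {ι κ : Type*} {e : κ → ℕ} (h : FiniteFibers e) {f : ι → κ}
    (hf : Function.Injective f) : FiniteFibers (e ∘ f) := fun N =>
  (h N).preimage hf.injOn

theorem expSum_sum {ι κ : Type*} {e : ι ⊕ κ → ℕ} (h : FiniteFibers e) (s : ι ⊕ κ → ℚ) :
    expSum e s = expSum (e ∘ Sum.inl) (s ∘ Sum.inl) + expSum (e ∘ Sum.inr) (s ∘ Sum.inr) := by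
  refine eq_of_forall_X_pow_dvd fun N => ?_
  have hl := (h.comp Sum.inl_injective).finite_lt N
  have hr := (h.comp Sum.inr_injective).finite_lt N
  have h1 := dvd_expSum_sub (e ∘ Sum.inl) (s ∘ Sum.inl) N hl.toFinset (by simp)
  have h2 := dvd_expSum_sub (e ∘ Sum.inr) (s ∘ Sum.inr) N hr.toFinset (by simp)
  have h3 := dvd_expSum_sub e s N (hl.toFinset.disjSum hr.toFinset) (by
    rintro (i | i) hi <;> simpa using hi)
  rw [Finset.sum_disjSum] at h3
  convert h3.sub (h1.add h2) using 1
  simp only [Function.comp]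
  ring

theorem X_pow_mul_expSum {ι : Type*} {e : ι → ℕ} (h : FiniteFibers e) (s : ι → ℚ) (c : ℕ) :
    X ^ c * expSum e s = expSum (fun i => e i + c) s := by
  refine eq_of_forall_X_pow_dvd fun N => ?_
  have h1 := dvd_expSum_sub e s N (h.finite_lt N).toFinset (by simp)
  have h2 := dvd_expSum_sub (fun i => e i + c) s N (h.finite_lt N).toFinset (by
    intro i hi
    simp only [Set.Finite.mem_toFinset, Set.mem_ofPred_eq]
    omega)
  have e1 : ∑ i ∈ (h.finite_lt N).toFinset, C (s i) * (X : ℚ⟦X⟧) ^ (e i + c) =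
      X ^ c * ∑ i ∈ (h.finite_lt N).toFinset, C (s i) * X ^ e i := by
    rw [Finset.mul_sum]
    exact Finset.sum_congr rfl fun i _ => by rw [pow_add]; ring
  rw [e1] at h2
  convert (h1.mul_left (X ^ c)).sub h2 using 1
  ring

theorem expSum_neg {ι : Type*} (e : ι → ℕ) (s : ι → ℚ) :
    expSum e (fun i => -s i) = -expSum e s := by
  ext N
  simp only [expSum, coeff_mk, map_neg]
  rw [← finsum_neg_distrib]
  exact finsum_congr fun i => by split_ifs <;> simp

/-! ### Theta series and their products -/

/-- Splitting `ℤ × ℤ` into the pairs `(i + j, i - j)` and the pairs `(-i - j - 1, j - i)`. -/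
def latticeEquiv : (ℤ × ℤ) ⊕ (ℤ × ℤ) ≃ ℤ × ℤ where
  toFun := Sum.elim (fun p => (p.1 + p.2, p.1 - p.2)) fun p => (-p.1 - p.2 - 1, p.2 - p.1)
  invFun p := if (p.1 + p.2) % 2 = 0 then Sum.inl ((p.1 + p.2) / 2, (p.1 - p.2) / 2)
    else Sum.inr ((-p.1 - p.2 - 1) / 2, (p.2 - p.1 - 1) / 2)
  left_inv := by
    rintro (⟨i, j⟩ | ⟨i, j⟩)
    · have h : (i + j + (i - j)) % 2 = 0 := by omega
      simp only [Sum.elim_inl, h, if_true]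
      congr 2 <;> omega
    · have h : ¬ (-i - j - 1 + (j - i)) % 2 = 0 := by omega
      simp only [Sum.elim_inr, h, if_false]
      congr 2 <;> omega
  right_inv := by
    rintro ⟨m, n⟩
    by_cases h : (m + n) % 2 = 0
    · simp only [h, if_true, Sum.elim_inl]
      ext <;> dsimp only <;> omega
    · simp only [h, if_false, Sum.elim_inr]
      ext <;> dsimp only <;> omega

/-- The exponent `(α n ^ 2 + β n) / 2`. -/
def quadExp (α β : ℤ) (n : ℤ) : ℕ := ((α * n ^ 2 + β * n) / 2).toNat

/-- The condition under which `(α n ^ 2 + β n) / 2` is a natural number for all `n`. -/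
def Admissible (α β : ℤ) : Prop := 0 < α ∧ |β| ≤ α ∧ 2 ∣ α + β

theorem Admissible.two_mul_quadExp {α β : ℤ} (h : Admissible α β) (n : ℤ) :
    2 * (quadExp α β n : ℤ) = α * n ^ 2 + β * n := by
  obtain ⟨h0, h1, h2⟩ := h
  have hd : 2 ∣ α * n ^ 2 + β * n := by
    obtain ⟨c, hc⟩ := h2
    obtain ⟨t, ht⟩ := (Int.even_mul_succ_self n).two_dvd
    have : α * n ^ 2 + β * n = 2 * (α * t + (c - α) * n) := by
      linear_combination α * ht + n * hc
    exact ⟨_, this⟩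
  have hn : 0 ≤ α * n ^ 2 + β * n := by
    rcases abs_le.1 h1 with ⟨h3, h4⟩
    rcases le_or_gt n 0 with hn | hn
    · rcases eq_or_lt_of_le hn with rfl | hn
      · simp
      · nlinarith [mul_nonneg (neg_nonneg.2 hn.le) (sub_nonneg.2 h4),
          mul_nonneg (mul_nonneg h0.le (neg_nonneg.2 hn.le)) (by omega : 0 ≤ -n - 1)]
    · nlinarith [mul_nonneg hn.le (by omega : 0 ≤ α + β),
        mul_nonneg (mul_nonneg h0.le hn.le) (by omega : 0 ≤ n - 1)]
  rw [quadExp, Int.toNat_of_nonneg (Int.ediv_nonneg hn (by norm_num)),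
    Int.mul_ediv_cancel' hd]

theorem Admissible.finiteFibers {α β : ℤ} (h : Admissible α β) :
    FiniteFibers (quadExp α β) := by
  intro N
  have h0 := h.1
  refine (Set.finite_Icc (-(2 * (N : ℤ) + |β|)) (2 * N + |β|)).subset ?_
  intro n hn
  simp only [Set.mem_ofPred_eq] at hn
  have h2 := h.two_mul_quadExp n
  rw [hn] at h2
  have hb := abs_nonneg β
  have h3 : α * |n| ^ 2 ≤ 2 * N + |β| * |n| := by
    rw [sq_abs, ← abs_mul]
    nlinarith [neg_abs_le (β * n), le_abs_self (β * n)]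
  have h4 : |n| ≤ 2 * N + |β| := by
    by_contra! h5
    have h6 : 0 < |n| := by omega
    nlinarith [mul_pos h6 (by omega : 0 < |n| - |β| - 2 * N), Nat.cast_nonneg (α := ℤ) N,
      mul_nonneg (sub_nonneg.2 (show (1:ℤ) ≤ α by omega)) (sq_nonneg |n|)]
  exact Set.mem_Icc.2 (abs_le.1 h4)

/-- The theta series `∑ n : ℤ, q ^ ((α n ^ 2 + β n) / 2)`. -/
noncomputable def thetaPos (α β : ℤ) : ℚ⟦X⟧ := expSum (quadExp α β) fun _ => 1

/-- The theta series `∑ n : ℤ, (-1) ^ n * q ^ ((α n ^ 2 + β n) / 2)`. -/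
noncomputable def thetaAlt (α β : ℤ) : ℚ⟦X⟧ := expSum (quadExp α β) fun n => (-1) ^ n

theorem neg_one_zpow_neg (n : ℤ) : (-1 : ℚ) ^ (-n) = (-1) ^ n := by
  rw [zpow_neg]; rcases Int.even_or_odd n with h | h
  · simp [h.neg_one_zpow]
  · simp [h.neg_one_zpow]

/-- The forms share `α`, so the coordinates of `latticeEquiv` separate the total exponent into one
in `i` and one in `j`. The reflected coordinates on the odd coset give the linear coefficients `2α -
β ∓ β'` instead of ones exceeding the admissible range. The sign `ε` of the odd coset is what
distinguishes the two mixed products below. -/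
theorem expSum_mul_lattice {α β β' : ℤ} (h : Admissible α β) (h' : Admissible α β')
    (h₁ : Admissible (2 * α) (β + β')) (h₂ : Admissible (2 * α) (β - β'))
    (h₃ : Admissible (2 * α) (2 * α - β - β')) (h₄ : Admissible (2 * α) (2 * α - β + β'))
    (c : ℕ) (hc : 2 * (c : ℤ) = α - β) (s t : ℤ → ℚ) (ε : ℚ)
    (hst : ∀ i j, s (i + j) * t (i - j) = (-1) ^ i * (-1) ^ j)
    (hst' : ∀ i j, s (-i - j - 1) * t (j - i) = ε * ((-1) ^ i * (-1) ^ j)) :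
    expSum (quadExp α β) s * expSum (quadExp α β') t =
      thetaAlt (2 * α) (β + β') * thetaAlt (2 * α) (β - β') +
      C ε * (X ^ c * (thetaAlt (2 * α) (2 * α - β - β') * thetaAlt (2 * α) (2 * α - β + β'))) := by
  have f := h.finiteFibers.add h'.finiteFibers
  simp only [thetaAlt]
  rw [expSum_mul h.finiteFibers h'.finiteFibers, expSum_mul h₁.finiteFibers h₂.finiteFibers,
    expSum_mul h₃.finiteFibers h₄.finiteFibers,
    X_pow_mul_expSum (h₃.finiteFibers.add h₄.finiteFibers),
    ← expSum_comp_equiv latticeEquiv, expSum_sum (f.comp latticeEquiv.injective)]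
  congr 1
  · congr 1
    · funext ⟨i, j⟩
      have a1 := h.two_mul_quadExp (i + j)
      have a2 := h'.two_mul_quadExp (i - j)
      have a3 := h₁.two_mul_quadExp i
      have a4 := h₂.two_mul_quadExp j
      simp only [Function.comp, latticeEquiv, Equiv.coe_fn_mk, Sum.elim_inl]
      zify
      linarith [show (α * (i + j) ^ 2 + β * (i + j)) + (α * (i - j) ^ 2 + β' * (i - j)) =
        (2 * α * i ^ 2 + (β + β') * i) + (2 * α * j ^ 2 + (β - β') * j) by ring]
    · funext ⟨i, j⟩
      exact hst i j
  · rw [show ∀ f : ℚ⟦X⟧, C ε * f = ε • f from fun f => (smul_eq_C_mul f ε).symm]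
    ext N
    simp only [expSum, coeff_mk, coeff_smul, smul_eq_mul]
    rw [mul_finsum']
    · refine finsum_congr fun ⟨i, j⟩ => ?_
      have a1 := h.two_mul_quadExp (-i - j - 1)
      have a2 := h'.two_mul_quadExp (j - i)
      have a3 := h₃.two_mul_quadExp i
      have a4 := h₄.two_mul_quadExp j
      have e1 : quadExp α β (-i - j - 1) + quadExp α β' (j - i) =
          quadExp (2 * α) (2 * α - β - β') i + quadExp (2 * α) (2 * α - β + β') j + c := by
        zify
        linarith [show (α * (-i - j - 1) ^ 2 + β * (-i - j - 1)) +
          (α * (j - i) ^ 2 + β' * (j - i)) = (2 * α * i ^ 2 + (2 * α - β - β') * i) +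
          (2 * α * j ^ 2 + (2 * α - β + β') * j) + (α - β) by ring]
      simp only [Function.comp, latticeEquiv, Equiv.coe_fn_mk, Sum.elim_inr, e1, hst', mul_ite,
        mul_zero]
    · refine (((h₃.finiteFibers.add h₄.finiteFibers).finite_lt (N + 1))).subset ?_
      intro i hi
      by_contra hn
      refine hi (if_neg fun h => hn ?_)
      simp only [Set.mem_ofPred_eq]
      omega

theorem thetaPos_mul_thetaAlt {α β β' : ℤ} (h : Admissible α β) (h' : Admissible α β')
    (h₁ : Admissible (2 * α) (β + β')) (h₂ : Admissible (2 * α) (β - β'))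
    (h₃ : Admissible (2 * α) (2 * α - β - β')) (h₄ : Admissible (2 * α) (2 * α - β + β'))
    (c : ℕ) (hc : 2 * (c : ℤ) = α - β) :
    thetaPos α β * thetaAlt α β' =
      thetaAlt (2 * α) (β + β') * thetaAlt (2 * α) (β - β') +
      X ^ c * (thetaAlt (2 * α) (2 * α - β - β') * thetaAlt (2 * α) (2 * α - β + β')) := by
  have := expSum_mul_lattice h h' h₁ h₂ h₃ h₄ c hc (fun _ => 1) (fun n => (-1) ^ n) 1
    (fun i j => by
      rw [one_mul, sub_eq_add_neg, zpow_add₀ (by norm_num), neg_one_zpow_neg])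
    (fun i j => by
      rw [one_mul, one_mul, sub_eq_add_neg, zpow_add₀ (by norm_num), neg_one_zpow_neg, mul_comm])
  rw [map_one, one_mul] at this
  exact this

theorem thetaAlt_mul_thetaPos {α β β' : ℤ} (h : Admissible α β) (h' : Admissible α β')
    (h₁ : Admissible (2 * α) (β + β')) (h₂ : Admissible (2 * α) (β - β'))
    (h₃ : Admissible (2 * α) (2 * α - β - β')) (h₄ : Admissible (2 * α) (2 * α - β + β'))
    (c : ℕ) (hc : 2 * (c : ℤ) = α - β) :
    thetaAlt α β * thetaPos α β' =
      thetaAlt (2 * α) (β + β') * thetaAlt (2 * α) (β - β') -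
      X ^ c * (thetaAlt (2 * α) (2 * α - β - β') * thetaAlt (2 * α) (2 * α - β + β')) := by
  have := expSum_mul_lattice h h' h₁ h₂ h₃ h₄ c hc (fun n => (-1) ^ n) (fun _ => 1) (-1)
    (fun i j => by rw [mul_one, zpow_add₀ (by norm_num)])
    (fun i j => by
      rw [mul_one, show -i - j - 1 = -(i + j + 1) by ring, neg_one_zpow_neg,
        zpow_add₀ (by norm_num), zpow_add₀ (by norm_num)]
      simp)
  rw [map_neg, map_one, neg_one_mul, ← sub_eq_add_neg] at this
  exact this

/-- The reflection `n ↦ -1 - n` preserves the exponent and reverses the sign. -/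
theorem thetaAlt_self_eq_zero {α : ℤ} (h : Admissible α α) : thetaAlt α α = 0 := by
  have h1 : thetaAlt α α = -thetaAlt α α := by
    conv_lhs => rw [thetaAlt, ← expSum_comp_equiv (Equiv.subLeft (-1 : ℤ))]
    rw [thetaAlt, ← expSum_neg]
    congr 1
    · funext n
      have a1 := h.two_mul_quadExp (-1 - n)
      have a2 := h.two_mul_quadExp n
      simp only [Function.comp, Equiv.subLeft_apply]
      zify
      linarith [show α * (-1 - n) ^ 2 + α * (-1 - n) = α * n ^ 2 + α * n by ring]
    · funext n
      simp only [Function.comp, Equiv.subLeft_apply]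
      rw [show -1 - n = -(n + 1) by ring, neg_one_zpow_neg, zpow_add₀ (by norm_num)]
      simp
  ext n
  have h2 := congrArg (coeff n) h1
  rw [map_neg] at h2
  rw [map_zero]
  linarith

theorem expand_thetaAlt {α β : ℤ} (h : Admissible α β) (h' : Admissible (2 * α) (2 * β)) :
    expand 2 two_ne_zero (thetaAlt α β) = thetaAlt (2 * α) (2 * β) := by
  have he : ∀ n, quadExp (2 * α) (2 * β) n = 2 * quadExp α β n := fun n => by
    have a1 := h.two_mul_quadExp n
    have a2 := h'.two_mul_quadExp n
    zify
    linarith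
  ext N
  rw [coeff_expand]
  simp only [thetaAlt, expSum, coeff_mk, he]
  split_ifs with hd
  · obtain ⟨M, rfl⟩ := hd
    simp
  · exact ((finsum_congr fun i => if_neg fun hi => hd ⟨_, hi.symm⟩).trans finsum_zero).symm

theorem coe_intEquivNatSumNat_symm_inl (n : ℕ) :
    Equiv.intEquivNatSumNat.symm (Sum.inl n) = (n : ℤ) := rfl

theorem coe_intEquivNatSumNat_symm_inr (n : ℕ) :
    Equiv.intEquivNatSumNat.symm (Sum.inr n) = -((n : ℤ) + 1) := Int.negSucc_eq n

theorem admissible_of_le {α β : ℤ} (h0 : 0 < α) (h1 : -α ≤ β) (h2 : β ≤ α) (h3 : (α + β) % 2 = 0) :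
    Admissible α β := ⟨h0, abs_le.2 ⟨h1, h2⟩, Int.dvd_of_emod_eq_zero h3⟩

theorem dvd_thetaAlt_sub {α β : ℤ} (N A B : ℕ) (hA : N ≤ A) (hB : N ≤ B)
    (h1 : ∀ n : ℕ, n ≤ quadExp α β n) (h2 : ∀ n : ℕ, n ≤ quadExp α β (-((n : ℤ) + 1))) :
    X ^ N ∣ thetaAlt α β - (∑ n ∈ Finset.range A, (-1) ^ n * X ^ quadExp α β n +
      ∑ n ∈ Finset.range B, (-1) ^ (n + 1) * X ^ quadExp α β (-((n : ℤ) + 1))) := by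
  have h3 := dvd_expSum_sub (quadExp α β ∘ Equiv.intEquivNatSumNat.symm)
    ((fun n : ℤ => (-1 : ℚ) ^ n) ∘ Equiv.intEquivNatSumNat.symm) N
    ((Finset.range A).disjSum (Finset.range B)) (by
      rintro (n | n) hn
      · have := h1 n
        simp only [Function.comp, coe_intEquivNatSumNat_symm_inl] at hn
        simp only [Finset.inl_mem_disjSum, Finset.mem_range]
        omega
      · have := h2 n
        simp only [Function.comp, coe_intEquivNatSumNat_symm_inr] at hn
        simp only [Finset.inr_mem_disjSum, Finset.mem_range]
        omega)
  rw [expSum_comp_equiv, Finset.sum_disjSum] at h3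
  rw [thetaAlt]
  convert h3 using 3
  · refine Finset.sum_congr rfl fun n _ => ?_
    simp only [Function.comp, coe_intEquivNatSumNat_symm_inl]
    simp
  · refine Finset.sum_congr rfl fun n _ => ?_
    simp only [Function.comp, coe_intEquivNatSumNat_symm_inr, neg_one_zpow_neg]
    rw [show (n : ℤ) + 1 = ((n + 1 : ℕ) : ℤ) by push_cast; ring, zpow_natCast]
    simp

theorem dvd_thetaAlt_five_three_sub (N : ℕ) : X ^ N ∣ thetaAlt 5 3 - rogersSum 1 N := by
  have h : Admissible 5 3 := admissible_of_le (by norm_num) (by norm_num) (by norm_num) (by norm_num)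
  have e1 : ∀ n : ℕ, quadExp 5 3 n = 2 * n + pent n := fun n => by
    have a1 := h.two_mul_quadExp n
    have a2 := two_mul_pent n
    zify
    linarith
  have e2 : ∀ n : ℕ, quadExp 5 3 (-((n : ℤ) + 1)) = 2 * n + pent n + (1 + 2 * n) := fun n => by
    have a1 := h.two_mul_quadExp (-((n : ℤ) + 1))
    have a2 := two_mul_pent n
    zify
    nlinarith
  have := dvd_thetaAlt_sub N N N le_rfl le_rfl (fun n => by rw [e1]; omega)
    (fun n => by rw [e2]; omega)
  convert this using 2
  rw [rogersSum, ← Finset.sum_add_distrib]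
  refine Finset.sum_congr rfl fun n _ => ?_
  simp only [e1, e2, rogersTerm, rogersWeight, Finset.prod_range_zero]
  ring

/-- Each later Rogers term pairs the indices `n + 1` and `-(n + 1)`, while index 0 stands alone;
this accounts for the extra summand. For `rogersSum 1` the pairs are `n` and `-(n + 1)`. -/
theorem dvd_thetaAlt_five_one_sub (N : ℕ) : X ^ N ∣ thetaAlt 5 1 - rogersSum 0 (N + 1) := by
  have h : Admissible 5 1 := admissible_of_le (by norm_num) (by norm_num) (by norm_num) (by norm_num)
  have e1 : ∀ n : ℕ, quadExp 5 1 n = pent n + n := fun n => by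
    have a1 := h.two_mul_quadExp n
    have a2 := two_mul_pent n
    zify
    linarith
  have e2 : ∀ n : ℕ, quadExp 5 1 (-((n : ℤ) + 1)) = pent (n + 1) := fun n => by
    have a1 := h.two_mul_quadExp (-((n : ℤ) + 1))
    have a2 := two_mul_pent (n + 1)
    push_cast at a2
    zify
    nlinarith
  have := dvd_thetaAlt_sub N (N + 1) N (Nat.le_succ N) le_rfl (fun n => by rw [e1]; omega)
    (fun n => by rw [e2]; have := le_pent (n + 1); omega)
  convert this using 2
  rw [rogersSum, Finset.sum_range_succ', Finset.sum_range_succ', add_right_comm,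
    ← Finset.sum_add_distrib]
  congr 1
  · refine Finset.sum_congr rfl fun n _ => ?_
    simp only [e1, e2, rogersTerm]
    ring
  · rw [e1]
    simp [rogersTerm, pent]

/-- The Rogers–Ramanujan continued fraction as a quotient of theta series. -/
theorem series_mul_thetaAlt : series * thetaAlt 5 1 = thetaAlt 5 3 := by
  refine eq_of_forall_X_pow_dvd fun N => ?_
  have h1 := (dvd_thetaAlt_five_one_sub N).mul_left series
  have h2 := (pow_dvd_pow X (Nat.le_succ N)).trans (dvd_thetaAlt_five_three_sub (N + 1))
  have h3 := (pow_dvd_pow X (Nat.le_succ N)).trans (dvd_series_mul_rogersSum (N + 1))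
  convert (h1.sub h2).add h3 using 1
  ring

theorem ne_zero_of_constantCoeff {f : ℚ⟦X⟧} {c : ℚ} (h : constantCoeff f = c) (hc : c ≠ 0) :
    f ≠ 0 := by
  rintro rfl
  exact hc (by simpa using h.symm)

theorem constantCoeff_thetaAlt {α β : ℤ} (h : Admissible α β) (h' : |β| < α) :
    constantCoeff (thetaAlt α β) = 1 := by
  rw [← coeff_zero_eq_constantCoeff_apply, thetaAlt, coeff_expSum _ _ 0 {0}]
  · have h0 : quadExp α β 0 = 0 := by simp [quadExp]
    simp [h0]
  · intro n hn
    have h1 := h.two_mul_quadExp n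
    rw [hn] at h1
    by_contra hne
    have hne : n ≠ 0 := by simpa using hne
    have h2 : α * n + β = 0 := by
      have : n * (α * n + β) = 0 := by push_cast at h1; linarith
      exact (mul_eq_zero.1 this).resolve_left hne
    have h3 : α * |n| = |β| := by
      rw [← abs_of_pos h.1, ← abs_mul, show α * n = -β by linarith, abs_neg]
    have h4 : 1 ≤ |n| := Int.one_le_abs hne
    nlinarith [h.1]

theorem constantCoeff_thetaPos_five_five : constantCoeff (thetaPos 5 5) = 2 := by
  have h : Admissible 5 5 := admissible_of_le (by norm_num) (by norm_num) (by norm_num) (by norm_num)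
  rw [← coeff_zero_eq_constantCoeff_apply, thetaPos, coeff_expSum _ _ 0 {0, -1}]
  · have h0 : quadExp 5 5 0 = 0 := by simp [quadExp]
    have h1 : quadExp 5 5 (-1) = 0 := by simp [quadExp]
    rw [Finset.sum_pair (by norm_num), h0, h1]
    simp; norm_num
  · intro n hn
    have h1 := h.two_mul_quadExp n
    rw [hn] at h1
    have : n * (n + 1) = 0 := by push_cast at h1; linarith
    rcases mul_eq_zero.1 this with h | h
    · simp [h]
    · simp [show n = -1 by omega]

/-! ### The modular equation of degree two -/

/-- The modular equation of degree two relating `R(q)` and `R(q ^ 2)`. -/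
theorem series_modular_two :
    expand 2 two_ne_zero series - series ^ 2 =
      X * series * expand 2 two_ne_zero series ^ 2 *
        (expand 2 two_ne_zero series + series ^ 2) := by
  have ad : ∀ α β : ℤ, 0 < α → -α ≤ β → β ≤ α → (α + β) % 2 = 0 → Admissible α β :=
    fun _ _ => admissible_of_le
  have a51 := ad 5 1 (by norm_num) (by norm_num) (by norm_num) (by norm_num)
  have a53 := ad 5 3 (by norm_num) (by norm_num) (by norm_num) (by norm_num)
  have a55 := ad 5 5 (by norm_num) (by norm_num) (by norm_num) (by norm_num)
  have a0 := ad 10 0 (by norm_num) (by norm_num) (by norm_num) (by norm_num)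
  have a2 := ad 10 2 (by norm_num) (by norm_num) (by norm_num) (by norm_num)
  have a4 := ad 10 4 (by norm_num) (by norm_num) (by norm_num) (by norm_num)
  have a6 := ad 10 6 (by norm_num) (by norm_num) (by norm_num) (by norm_num)
  have a8 := ad 10 8 (by norm_num) (by norm_num) (by norm_num) (by norm_num)
  have a10 := ad 10 10 (by norm_num) (by norm_num) (by norm_num) (by norm_num)
  have e1 : thetaPos 5 3 * thetaAlt 5 1 =
      thetaAlt 10 4 * thetaAlt 10 2 + X ^ 1 * (thetaAlt 10 6 * thetaAlt 10 8) :=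
    thetaPos_mul_thetaAlt a53 a51 a4 a2 a6 a8 1 (by norm_num)
  have e2 : thetaAlt 5 3 * thetaPos 5 1 =
      thetaAlt 10 4 * thetaAlt 10 2 - X ^ 1 * (thetaAlt 10 6 * thetaAlt 10 8) :=
    thetaAlt_mul_thetaPos a53 a51 a4 a2 a6 a8 1 (by norm_num)
  have e3 : thetaPos 5 3 * thetaAlt 5 3 =
      thetaAlt 10 6 * thetaAlt 10 0 + X ^ 1 * (thetaAlt 10 4 * thetaAlt 10 10) :=
    thetaPos_mul_thetaAlt a53 a53 a6 a0 a4 a10 1 (by norm_num)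
  have e4 : thetaPos 5 1 * thetaAlt 5 1 =
      thetaAlt 10 2 * thetaAlt 10 0 + X ^ 2 * (thetaAlt 10 8 * thetaAlt 10 10) :=
    thetaPos_mul_thetaAlt a51 a51 a2 a0 a8 a10 2 (by norm_num)
  have e5 : thetaPos 5 5 * thetaAlt 5 3 =
      thetaAlt 10 8 * thetaAlt 10 2 + X ^ 0 * (thetaAlt 10 2 * thetaAlt 10 8) :=
    thetaPos_mul_thetaAlt a55 a53 a8 a2 a2 a8 0 (by norm_num)
  have e6 : thetaPos 5 5 * thetaAlt 5 1 =
      thetaAlt 10 6 * thetaAlt 10 4 + X ^ 0 * (thetaAlt 10 4 * thetaAlt 10 6) :=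
    thetaPos_mul_thetaAlt a55 a51 a6 a4 a4 a6 0 (by norm_num)
  have h1 := series_mul_thetaAlt
  have h2 := congrArg (expand 2 two_ne_zero) h1
  rw [map_mul, expand_thetaAlt a51 a2, expand_thetaAlt a53 a6] at h2
  rw [thetaAlt_self_eq_zero a10, mul_zero, mul_zero, add_zero] at e3 e4
  norm_num at h2
  have nb := ne_zero_of_constantCoeff (constantCoeff_thetaAlt a51 (by norm_num)) one_ne_zero
  have n2 := ne_zero_of_constantCoeff (constantCoeff_thetaAlt a2 (by norm_num)) one_ne_zero
  have n4 := ne_zero_of_constantCoeff (constantCoeff_thetaAlt a4 (by norm_num)) one_ne_zero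
  have nP := ne_zero_of_constantCoeff constantCoeff_thetaPos_five_five two_ne_zero
  generalize expand 2 two_ne_zero series = T₂ at *
  generalize series = T at *
  generalize thetaPos 5 3 = A at *
  generalize thetaPos 5 1 = B at *
  generalize thetaPos 5 5 = P at *
  generalize thetaAlt 5 3 = a at *
  generalize thetaAlt 5 1 = b at *
  generalize thetaAlt 10 0 = t0 at *
  generalize thetaAlt 10 2 = t2 at *
  generalize thetaAlt 10 4 = t4 at *
  generalize thetaAlt 10 6 = t6 at *
  generalize thetaAlt 10 8 = t8 at *
  -- In the products with `P` both cosets contribute the same term, so dividing `e5` by `e6`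
  -- expresses `R(q)` through `t2, t4, t6, t8`.
  have f1 : T * T₂ * t4 = t8 := by
    refine mul_left_cancel₀ (mul_ne_zero nP (mul_ne_zero nb n2)) ?_
    linear_combination P * t2 * T₂ * t4 * h1 + t2 * T₂ * t4 * e5 + 2 * t8 * t2 * t4 * h2 - t2 * t8 *
      e6
  -- The odd cosets vanished with `thetaAlt 10 10`; the quotient of `e3` by `e4` is then `t6 / t2`,
  -- which is `R(q²)`.
  have f2 : A * T = T₂ * B := by
    refine mul_left_cancel₀ nb ?_
    linear_combination e3 - T₂ * e4 + A * h1 - t0 * h2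
  refine sub_eq_zero.1 (mul_left_cancel₀ (mul_ne_zero n4 n2) ?_)
  linear_combination T ^ 2 * e1 - T₂ * e2 - T₂ * B * h1 - T * b * f2 -
    (T₂ + T ^ 2) * (X * T₂ * t2 * f1 + X * t8 * h2)

/-! ### The modular equations of degree five -/

theorem X_pow_dvd_of_mul {f g : ℚ⟦X⟧} {n : ℕ} (hg : constantCoeff g ≠ 0) (h : X ^ n ∣ f * g) :
    X ^ n ∣ f := by
  have h1 : g * g⁻¹ = 1 := PowerSeries.mul_inv_cancel g hg
  have h2 := h.mul_right g⁻¹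
  rwa [mul_assoc, h1, mul_one] at h2

theorem X_pow_dvd_expand_two {f : ℚ⟦X⟧} {n : ℕ} (h : X ^ n ∣ f) :
    X ^ (2 * n) ∣ expand 2 two_ne_zero f := by
  obtain ⟨g, rfl⟩ := h
  rw [map_mul, map_pow, expand_X, ← pow_mul]
  exact Dvd.intro _ rfl

/-- The system satisfied by `R(q) ^ 5` and `R(q) R(q ^ 2) ^ 2` has only one solution. -/
theorem eq_of_modular_system {U V κ μ : ℚ⟦X⟧}
    (hκ : constantCoeff κ = 1) (hμ : constantCoeff μ = 1)
    (h1 : κ ^ 2 * (1 + X * κ) = expand 2 two_ne_zero U * (1 - X * κ))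
    (h2 : U * (1 + X * κ) ^ 2 = (1 - X * κ) ^ 2 * κ)
    (h3 : μ ^ 2 * (1 + X * μ) = expand 2 two_ne_zero V * (1 - X * μ))
    (h4 : V * (1 + X * μ) ^ 2 = (1 - X * μ) ^ 2 * μ) : U = V ∧ κ = μ := by
  have hU : constantCoeff U = 1 := by simpa [hκ] using congrArg constantCoeff h2
  have hV : constantCoeff V = 1 := by simpa [hμ] using congrArg constantCoeff h4
  -- Substituting `q²` doubles the precision; the first equation transfers it to `κ`, the second
  -- back to `U`. The cofactor in the first transfer has constant term 2, hence is invertible.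
  have hS : ∀ n, X ^ n ∣ U - V → X ^ (2 * n) ∣ κ - μ ∧ X ^ (2 * n) ∣ U - V := by
    intro n hn
    have hd := X_pow_dvd_expand_two hn
    rw [map_sub] at hd
    have hk : X ^ (2 * n) ∣ κ - μ := by
      refine X_pow_dvd_of_mul (g := κ + μ + X * (κ ^ 2 + κ * μ + μ ^ 2) +
        X * expand 2 two_ne_zero V) ?_ ?_
      · simp [hκ, hμ]
      · convert hd.mul_right (1 - X * κ) using 1
        linear_combination h1 - h3
    refine ⟨hk, X_pow_dvd_of_mul (g := (1 + X * κ) ^ 2) (by simp) ?_⟩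
    convert hk.mul_right (1 - 2 * X * (κ + μ) + X ^ 2 * (κ ^ 2 + κ * μ + μ ^ 2) -
      V * (2 * X + X ^ 2 * (κ + μ))) using 1
    linear_combination h2 - h4
  have hA : ∀ n, X ^ (n + 1) ∣ U - V := by
    intro n
    induction n with
    | zero => simp [X_dvd_iff, hU, hV]
    | succ n ih => exact (pow_dvd_pow X (by omega)).trans (hS _ ih).2
  refine ⟨eq_of_forall_X_pow_dvd fun n => (pow_dvd_pow X n.le_succ).trans (hA n),
    eq_of_forall_X_pow_dvd fun n => (pow_dvd_pow X (by omega)).trans (hS _ (hA n)).1⟩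

theorem constantCoeff_expand_series (n : ℕ) (hn : n ≠ 0) :
    constantCoeff (expand n hn series) = 1 := by
  rw [constantCoeff_expand, constantCoeff_series]

/-- The modular equations of degree five: `R(q) ^ 5` and `R(q) R(q ^ 2) ^ 2` as rational functions
of `v = q R(q ^ 5)` and `w = q ^ 2 R(q ^ 10)`. -/
theorem series_modular_five {v w : ℚ⟦X⟧} (hv : v = X * expand 5 (by norm_num) series)
    (hw : w = X ^ 2 * expand 10 (by norm_num) series) :
    X * series ^ 5 * (1 + 3 * v + 4 * v ^ 2 + 2 * v ^ 3 + v ^ 4) =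
      v * (1 - 2 * v + 4 * v ^ 2 - 3 * v ^ 3 + v ^ 4) ∧
    X * series * expand 2 two_ne_zero series ^ 2 * (1 + w ^ 2 - v - 2 * v * w) =
      v - 2 * w + w ^ 2 + v * w ^ 2 ∧
    w - v ^ 2 = v * w ^ 2 * (w + v ^ 2) := by
  have hm := series_modular_two
  have hm5 := congrArg (expand 5 (by norm_num)) hm
  simp only [map_sub, map_mul, map_add, map_pow, expand_X] at hm5
  rw [← expand_mul 5 (by norm_num) 2 two_ne_zero] at hm5
  norm_num at hm5
  have hvw : expand 2 two_ne_zero v = w := by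
    rw [hv, hw, map_mul, expand_X, ← expand_mul 2 two_ne_zero 5 (by norm_num)]
  have rel : w - v ^ 2 = v * w ^ 2 * (w + v ^ 2) := by
    rw [hv, hw]; linear_combination X ^ 2 * hm5
  have h2x : expand 2 two_ne_zero (expand 5 (by norm_num) series) =
      expand 10 (by norm_num) series := by
    rw [← expand_mul 2 two_ne_zero 5 (by norm_num)]
  have c2 := constantCoeff_expand_series 2 (by norm_num)
  have c5 := constantCoeff_expand_series 5 (by norm_num)
  have c10 := constantCoeff_expand_series 10 (by norm_num)
  have cx := constantCoeff_series
  generalize expand 10 _ series = r at *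
  generalize expand 5 _ series = p at *
  have h2X : expand 2 two_ne_zero (series ^ 5) = expand 2 two_ne_zero series ^ 5 := map_pow _ _ _
  generalize expand 2 two_ne_zero series = a at *
  generalize series = x at *
  have cv : constantCoeff v = 0 := by simp [hv]
  have cw : constantCoeff w = 0 := by simp [hw]
  obtain ⟨A, hA⟩ : ∃ A, A = 1 + 3 * v + 4 * v ^ 2 + 2 * v ^ 3 + v ^ 4 := ⟨_, rfl⟩
  obtain ⟨B, hB⟩ : ∃ B, B = 1 - 2 * v + 4 * v ^ 2 - 3 * v ^ 3 + v ^ 4 := ⟨_, rfl⟩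
  obtain ⟨A', hA'⟩ : ∃ A, A = 1 + 3 * w + 4 * w ^ 2 + 2 * w ^ 3 + w ^ 4 := ⟨_, rfl⟩
  obtain ⟨B', hB'⟩ : ∃ B, B = 1 - 2 * w + 4 * w ^ 2 - 3 * w ^ 3 + w ^ 4 := ⟨_, rfl⟩
  obtain ⟨D, hD⟩ : ∃ D, D = 1 + w ^ 2 - v - 2 * v * w := ⟨_, rfl⟩
  obtain ⟨N, hN⟩ : ∃ N, N = v - 2 * w + w ^ 2 + v * w ^ 2 := ⟨_, rfl⟩
  have nA : A * A⁻¹ = 1 := PowerSeries.mul_inv_cancel _ (by simp [hA, cv])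
  have nD : D * D⁻¹ = 1 := PowerSeries.mul_inv_cancel _ (by simp [hD, cv, cw])
  have zA : A ≠ 0 := left_ne_zero_of_mul_eq_one nA
  have zD : D ≠ 0 := left_ne_zero_of_mul_eq_one nD
  have zA' : A' ≠ 0 := ne_zero_of_constantCoeff (c := 1) (by simp [hA', cw]) one_ne_zero
  have zX : (X : ℚ⟦X⟧) ≠ 0 := X_ne_zero
  -- Candidates for `R(q)^5` and `R(q) R(q²)²`: a factor `X` is already removed from `v B / A` and
  -- from `N / D`, so that both are power series.
  obtain ⟨V, hV⟩ : ∃ V, V = p * B * A⁻¹ := ⟨_, rfl⟩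
  obtain ⟨μ, hμ⟩ : ∃ μ, μ = (p - 2 * X * r + X ^ 3 * r ^ 2 + X ^ 4 * p * r ^ 2) * D⁻¹ := ⟨_, rfl⟩
  have hVA : V * A = p * B := by rw [hV]; linear_combination p * B * nA
  have hμD : X * μ * D = N := by
    rw [hμ, hN]
    linear_combination (X * (p - 2 * X * r + X ^ 3 * r ^ 2 + X ^ 4 * p * r ^ 2)) * nD +
      (-1 - w ^ 2) * hv + (2 - (w + X ^ 2 * r) - X * p * (w + X ^ 2 * r)) * hw
  have hVA' := congrArg (expand 2 two_ne_zero) hVA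
  have hEA : expand 2 two_ne_zero A = A' := by
    rw [hA, hA']; simp only [map_add, map_mul, map_pow, map_one, map_ofNat, hvw]
  have hEB : expand 2 two_ne_zero B = B' := by
    rw [hB, hB']; simp only [map_add, map_sub, map_mul, map_pow, map_one, map_ofNat, hvw]
  rw [map_mul, map_mul, h2x, hEA, hEB] at hVA'
  -- This and `cert2` are the system for the candidates with denominators cleared; both follow from
  -- `rel`, the degree two equation at `q⁵`.
  have cert1 : N ^ 2 * (D + N) * A' = w * B' * (D - N) * D ^ 2 := by
    rw [hN, hD, hA', hB']
    linear_combination (-w ^ 8 - 4 * w ^ 7 - 2 * w ^ 6 + 8 * w ^ 5 + 5 * w ^ 4 - 8 * w ^ 3 - 2 * w ^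
      2 + 4 * w - 1) * rel
  have cert2 : v * B * (D + N) ^ 2 * D = (D - N) ^ 2 * N * A := by
    rw [hN, hD, hA, hB]
    linear_combination (2 * v ^ 5 * w ^ 3 - 7 * v ^ 5 * w ^ 2 + 4 * v ^ 5 * w + 4 * v ^ 5 + 10 * v ^
      4 * w ^ 3 + 5 * v ^ 4 * w ^ 2 + 10 * v ^ 4 * w + 5 * v ^ 4 + 5 * v ^ 3 * w ^ 3 + 25 * v ^ 3 *
      w ^ 2 - 10 * v ^ 3 * w + 5 * v ^ 3 - 5 * v ^ 2 * w ^ 3 - 10 * v ^ 2 * w ^ 2 - 25 * v ^ 2 * w +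
      5 * v ^ 2 + 5 * v * w ^ 3 - 10 * v * w ^ 2 + 5 * v * w - 10 * v - 4 * w ^ 3 + 4 * w ^ 2 + 7 *
      w + 2) * rel
  -- The actual pair solves the system by the degree two equation `hm` alone.
  obtain ⟨e1, e2⟩ := eq_of_modular_system (U := x ^ 5) (V := V) (κ := x * a ^ 2) (μ := μ)
    (by simp [cx, c2])
    (by
      have : constantCoeff D⁻¹ = 1 := by simp [hD, cv, cw]
      rw [hμ, map_mul, this]; simp [c5])
    (by rw [h2X]; linear_combination (-a ^ 4) * hm)
    (by linear_combination (-x * ((1 + X * x * a ^ 2) * x ^ 2 + (1 - X * x * a ^ 2) * a)) * hm)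
    (by
      refine mul_left_cancel₀ (mul_ne_zero (pow_ne_zero 2 zX) (mul_ne_zero (pow_ne_zero 3 zD) zA')) ?_
      rw [← hμD] at cert1
      linear_combination cert1 - X ^ 2 * (1 - X * μ) * D ^ 3 * hVA' + B' * (1 - X * μ) * D ^ 3 * hw)
    (by
      refine mul_left_cancel₀ (mul_ne_zero zX (mul_ne_zero (pow_ne_zero 3 zD) zA)) ?_
      rw [← hμD] at cert2
      linear_combination cert2 + X * (1 + X * μ) ^ 2 * D ^ 3 * hVA - B * (1 + X * μ) ^ 2 * D ^ 3 *
        hv)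
  refine ⟨?_, ?_, rel⟩
  · rw [← hA, ← hB, hv]; linear_combination X * hVA + X * A * e1
  · rw [← hD, ← hN]; linear_combination hμD + X * D * e2

/-! ### Rational identities of level ten -/

section LevelTen

variable {F : Type*} [Field F] {w K k : F}

/-- Here `K = k(q⁵)`, `w = q² R(q¹⁰)`, `k = k(q)`, and `hk` presents `k` as `N / D`. After `N / D`
is inserted and denominators are cleared, the two sides differ by a multiple of `hw`; then `D²`
cancels. The next two lemmas have the same proof. -/
theorem level_ten_add_inv_mobius (hw0 : w ≠ 0) (hD5 : 1 - 4 * K - K ^ 2 ≠ 0)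
    (hp : 1 + k ≠ 0) (hm : 1 - k ≠ 0) (hD : w ^ 2 + w ^ 4 - K - 2 * K * w ≠ 0)
    (hw : w ^ 5 * (1 - K) = K ^ 2 * (1 + K))
    (hk : k * (w ^ 2 + w ^ 4 - K - 2 * K * w) = K - 2 * w ^ 3 + w ^ 4 + K * w ^ 2) :
    (1 - k) / (1 + k) + (1 + k) / (1 - k) =
      (2 * (1 + K ^ 2) + 4 * (1 - 2 * K) * w - 4 * K * (2 + K) / w) / (1 - 4 * K - K ^ 2) := by
  obtain ⟨D, hDd⟩ : ∃ D, D = w ^ 2 + w ^ 4 - K - 2 * K * w := ⟨_, rfl⟩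
  obtain ⟨N, hN⟩ : ∃ N, N = K - 2 * w ^ 3 + w ^ 4 + K * w ^ 2 := ⟨_, rfl⟩
  have cert : 2 * (D ^ 2 + N ^ 2) * (1 - 4 * K - K ^ 2) * w = (D ^ 2 - N ^ 2) *
      (2 * (1 + K ^ 2) * w + 4 * (1 - 2 * K) * w ^ 2 - 4 * K * (2 + K)) := by
    rw [hDd, hN]
    linear_combination (4 * w ^ 4 * K - 12 * w ^ 4 + 16 * w ^ 3 * K - 8 * w ^ 3 + 8 * w ^ 2 * K + 16
      * w ^ 2 - 12 * w * K - 4 * w) * hw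
  rw [← hDd] at hk hD
  rw [← hN] at hk
  rw [← hk] at cert
  have h : 2 * (1 + k ^ 2) * (1 - 4 * K - K ^ 2) * w = (1 - k ^ 2) *
      (2 * (1 + K ^ 2) * w + 4 * (1 - 2 * K) * w ^ 2 - 4 * K * (2 + K)) :=
    mul_left_cancel₀ (pow_ne_zero 2 hD) (by linear_combination cert)
  rw [div_add_div _ _ hp hm, div_eq_div_iff (mul_ne_zero hp hm) hD5]
  refine mul_right_cancel₀ hw0 ?_
  have hc : 4 * K * (2 + K) / w * w = 4 * K * (2 + K) := div_mul_cancel₀ _ hw0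
  linear_combination h + (1 - k ^ 2) * hc

theorem level_ten_add_inv (hw0 : w ≠ 0) (hK0 : K ≠ 0) (hE5 : 1 + K - K ^ 2 ≠ 0)
    (hk0 : k ≠ 0) (hD : w ^ 2 + w ^ 4 - K - 2 * K * w ≠ 0)
    (hw : w ^ 5 * (1 - K) = K ^ 2 * (1 + K))
    (hk : k * (w ^ 2 + w ^ 4 - K - 2 * K * w) = K - 2 * w ^ 3 + w ^ 4 + K * w ^ 2) :
    k + 1 / k =
      ((1 + K ^ 2) + K * (3 - K) * (1 + K) * (1 / w ^ 2) + (1 - K) * (1 + 3 * K) / K * w ^ 2) /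
        (1 + K - K ^ 2) := by
  obtain ⟨D, hDd⟩ : ∃ D, D = w ^ 2 + w ^ 4 - K - 2 * K * w := ⟨_, rfl⟩
  obtain ⟨N, hN⟩ : ∃ N, N = K - 2 * w ^ 3 + w ^ 4 + K * w ^ 2 := ⟨_, rfl⟩
  have cert : (N ^ 2 + D ^ 2) * (1 + K - K ^ 2) * K * w ^ 2 = N * D *
      ((1 + K ^ 2) * K * w ^ 2 + K ^ 2 * (3 - K) * (1 + K) + w ^ 4 * (1 - K) * (1 + 3 * K)) := by
    rw [hDd, hN]
    linear_combination (-3 * w ^ 7 * K - w ^ 7 + 6 * w ^ 6 * K + 2 * w ^ 6 - 3 * w ^ 5 * K - w ^ 5 +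
      6 * w ^ 4 * K + 2 * w ^ 4 + 2 * w ^ 3 * K ^ 3 - 6 * w ^ 3 * K ^ 2 + w ^ 2 * K ^ 3 - 3 * w ^ 2
      * K ^ 2 + 2 * w * K ^ 3 - 6 * w * K ^ 2 + K ^ 3 - 3 * K ^ 2) * hw
  rw [← hDd] at hk hD
  rw [← hN] at hk
  rw [← hk] at cert
  have h : (k ^ 2 + 1) * (1 + K - K ^ 2) * K * w ^ 2 = k *
      ((1 + K ^ 2) * K * w ^ 2 + K ^ 2 * (3 - K) * (1 + K) + w ^ 4 * (1 - K) * (1 + 3 * K)) :=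
    mul_left_cancel₀ (pow_ne_zero 2 hD) (by linear_combination cert)
  rw [eq_div_iff hE5]
  field_simp
  linear_combination h

theorem level_ten_eta (hw0 : w ≠ 0) (hK0 : K ≠ 0) (hD5 : 1 - 4 * K - K ^ 2 ≠ 0)
    (hk1 : 1 - k ^ 2 ≠ 0) (hD : w ^ 2 + w ^ 4 - K - 2 * K * w ≠ 0)
    (ha : 1 / w - 1 - w ≠ 0)
    (hw : w ^ 5 * (1 - K) = K ^ 2 * (1 + K))
    (hk : k * (w ^ 2 + w ^ 4 - K - 2 * K * w) = K - 2 * w ^ 3 + w ^ 4 + K * w ^ 2) :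
    k / (1 - k ^ 2) = (1 + K - K ^ 2) * (w ^ 2 / K - 1 - K / w ^ 2) /
      ((1 - 4 * K - K ^ 2) * (1 / w - 1 - w)) := by
  obtain ⟨D, hDd⟩ : ∃ D, D = w ^ 2 + w ^ 4 - K - 2 * K * w := ⟨_, rfl⟩
  obtain ⟨N, hN⟩ : ∃ N, N = K - 2 * w ^ 3 + w ^ 4 + K * w ^ 2 := ⟨_, rfl⟩
  have cert : N * D * (1 - 4 * K - K ^ 2) * (1 - w - w ^ 2) * K * w =
      (D ^ 2 - N ^ 2) * (1 + K - K ^ 2) * (w ^ 4 - K * w ^ 2 - K ^ 2) := by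
    rw [hDd, hN]
    linear_combination (-w ^ 6 * K ^ 2 - 9 * w ^ 6 * K - 4 * w ^ 6 + 3 * w ^ 5 * K ^ 2 + 7 * w ^ 5 *
      K + 2 * w ^ 5 - w ^ 4 * K ^ 3 + w ^ 4 * K ^ 2 + 6 * w ^ 4 * K + 6 * w ^ 3 * K ^ 2 - w ^ 3 * K
      - w ^ 3 + 2 * w ^ 2 * K ^ 3 - 7 * w ^ 2 * K ^ 2 + 3 * w ^ 2 * K + 4 * w * K ^ 3 - 9 * w * K ^
      2 + w * K) * hw
  rw [← hDd] at hk hD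
  rw [← hN] at hk
  rw [← hk] at cert
  have h : k * (1 - 4 * K - K ^ 2) * (1 - w - w ^ 2) * K * w =
      (1 - k ^ 2) * (1 + K - K ^ 2) * (w ^ 4 - K * w ^ 2 - K ^ 2) :=
    mul_left_cancel₀ (pow_ne_zero 2 hD) (by linear_combination cert)
  rw [div_eq_div_iff hk1 (mul_ne_zero hD5 ha)]
  field_simp
  linear_combination h

/-- The factor outside the square is the cubic `K (1 + K - K²)`, the one that also gives `Y²` in
`tower_Y_sq`. This coincidence lets a square root be extracted in `exists_zL_eq`. -/
theorem level_ten_eta_sq {s : F} (hw0 : w ≠ 0) (hK0 : K ≠ 0) (hD5 : 1 - 4 * K - K ^ 2 ≠ 0)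
    (ha : 1 / w - 1 - w ≠ 0) (hw : w ^ 5 * (1 - K) = K ^ 2 * (1 + K))
    (hs : s = (1 + K - K ^ 2) * (w ^ 2 / K - 1 - K / w ^ 2) /
      ((1 - 4 * K - K ^ 2) * (1 / w - 1 - w))) :
    s + s ^ 2 = K * (1 + K - K ^ 2) * ((1 / w - 1 - w) / (1 - 4 * K - K ^ 2)) ^ 2 := by
  have e1 : (1 / w - 1 - w) * w = 1 - w - w ^ 2 := by field_simp
  have e2 : (w ^ 2 / K - 1 - K / w ^ 2) * (K * w ^ 2) = w ^ 4 - K * w ^ 2 - K ^ 2 := by field_simp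
  have h : (w ^ 2 / K - 1 - K / w ^ 2) * ((1 - 4 * K - K ^ 2) * (1 / w - 1 - w) +
      (1 + K - K ^ 2) * (w ^ 2 / K - 1 - K / w ^ 2)) = K * (1 / w - 1 - w) ^ 4 := by
    refine mul_left_cancel₀ (mul_ne_zero (pow_ne_zero 2 hK0) (pow_ne_zero 4 hw0)) ?_
    rw [show K ^ 2 * w ^ 4 * (K * (1 / w - 1 - w) ^ 4) = K ^ 3 * ((1 / w - 1 - w) * w) ^ 4 by ring,
      show K ^ 2 * w ^ 4 * ((w ^ 2 / K - 1 - K / w ^ 2) * ((1 - 4 * K - K ^ 2) * (1 / w - 1 - w) +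
      (1 + K - K ^ 2) * (w ^ 2 / K - 1 - K / w ^ 2))) = ((w ^ 2 / K - 1 - K / w ^ 2) * (K * w ^ 2)) *
        ((1 - 4 * K - K ^ 2) * ((1 / w - 1 - w) * w) * K * w +
      (1 + K - K ^ 2) * ((w ^ 2 / K - 1 - K / w ^ 2) * (K * w ^ 2))) by ring, e1, e2]
    linear_combination (w ^ 3 * K ^ 2 + 2 * w ^ 3 * K + w ^ 3 + 3 * w ^ 2 * K ^ 2 - w ^ 2 * K - w *
      K ^ 2 - 3 * w * K + K ^ 3 - 2 * K ^ 2 + K) * hw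
  rw [hs]
  generalize w ^ 2 / K - 1 - K / w ^ 2 = a at *
  generalize 1 / w - 1 - w = b at *
  generalize 1 - 4 * K - K ^ 2 = D at *
  field_simp
  linear_combination (1 + K - K ^ 2) * h

/-- With `a = 1/v - 1 - v` and `v = K / w²`, this divides `a(q²)²` by `a(q)`; `level_ten_sq'`
divides `a(q)²` by `a(q²)`. Both quotients become short Laurent polynomials in `w`. -/
theorem level_ten_sq (hw0 : w ≠ 0) (hK0 : K ≠ 0) (hw : w ^ 5 * (1 - K) = K ^ 2 * (1 + K)) :
    (1 / w - 1 - w) ^ 2 = (w ^ 2 / K - 1 - K / w ^ 2) *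
      (1 + (1 - K) / K * w + (1 + K) * (1 / w)) := by
  field_simp
  linear_combination (-w - K) * hw

theorem level_ten_sq' (hw0 : w ≠ 0) (hK0 : K ≠ 0) (hm : 1 - K ≠ 0) (hp : 1 + K ≠ 0)
    (hw : w ^ 5 * (1 - K) = K ^ 2 * (1 + K)) :
    (w ^ 2 / K - 1 - K / w ^ 2) ^ 2 = (1 / w - 1 - w) *
      (1 + 2 / (1 + K) * w ^ 2 - 2 * K / (1 - K) * (1 / w ^ 2)) := by
  field_simp
  linear_combination (w ^ 3 * K + w ^ 3 + 2 * w ^ 2 * K ^ 2 - 2 * w * K + K ^ 3 - K ^ 2) * hw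

end LevelTen

/-! ### Dilation and supports of Laurent series -/

theorem nsmul_strictMono (n : ℕ) [NeZero n] : StrictMono (nsmulAddMonoidHom n : ℤ →+ ℤ) := by
  intro a b h
  have hn : (0 : ℤ) < n := Nat.cast_pos.2 (Nat.pos_of_ne_zero (NeZero.ne n))
  simpa [nsmul_eq_mul] using mul_lt_mul_of_pos_left h hn

/-- The substitution `q ↦ q ^ n` on Laurent series. -/
noncomputable def dilate (n : ℕ) [NeZero n] : ℚ⸨X⸩ →+* ℚ⸨X⸩ :=
  HahnSeries.embDomainRingHom (nsmulAddMonoidHom n : ℤ →+ ℤ)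
    (nsmul_strictMono n).injective fun _ _ => (nsmul_strictMono n).le_iff_le

theorem coeff_dilate_mul (n : ℕ) [NeZero n] (f : ℚ⸨X⸩) (a : ℤ) :
    (dilate n f).coeff (n * a) = f.coeff a := by
  have := HahnSeries.embDomain_coeff (f := OrderEmbedding.ofStrictMono _ (nsmul_strictMono n))
    (x := f) (a := a)
  rw [← this]
  simp [dilate, HahnSeries.embDomainRingHom]
  rfl

theorem coeff_dilate_of_not_dvd (n : ℕ) [NeZero n] (f : ℚ⸨X⸩) {a : ℤ} (h : ¬ (n : ℤ) ∣ a) :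
    (dilate n f).coeff a = 0 := by
  refine HahnSeries.embDomain_of_notMem_range
    (f := OrderEmbedding.ofStrictMono _ (nsmul_strictMono n)) fun ⟨b, hb⟩ => h ⟨b, ?_⟩
  simpa [nsmul_eq_mul] using hb.symm

theorem dilate_dilate (m n : ℕ) [NeZero m] [NeZero n] [NeZero (m * n)] (f : ℚ⸨X⸩) :
    dilate m (dilate n f) = dilate (m * n) f := by
  have hm : (m : ℤ) ≠ 0 := Nat.cast_ne_zero.2 (NeZero.ne m)
  ext a
  by_cases h : ((m * n : ℕ) : ℤ) ∣ a
  · obtain ⟨b, rfl⟩ := h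
    rw [coeff_dilate_mul, Nat.cast_mul, mul_assoc, coeff_dilate_mul, coeff_dilate_mul]
  · rw [coeff_dilate_of_not_dvd _ _ h]
    by_cases h1 : (m : ℤ) ∣ a
    · obtain ⟨b, rfl⟩ := h1
      rw [coeff_dilate_mul, coeff_dilate_of_not_dvd]
      intro h2
      exact h (by rw [Nat.cast_mul]; exact mul_dvd_mul_left _ h2)
    · exact coeff_dilate_of_not_dvd _ _ h1

theorem dilate_coe (n : ℕ) [NeZero n] (f : ℚ⟦X⟧) :
    dilate n (f : ℚ⸨X⸩) = (expand n (NeZero.ne n) f : ℚ⟦X⟧) := by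
  have hn : (0 : ℤ) < n := Nat.cast_pos.2 (Nat.pos_of_ne_zero (NeZero.ne n))
  ext a
  by_cases h : (n : ℤ) ∣ a
  · obtain ⟨b, rfl⟩ := h
    rw [coeff_dilate_mul, PowerSeries.coeff_coe, PowerSeries.coeff_coe]
    by_cases hb : b < 0
    · rw [if_pos hb, if_pos (mul_neg_of_pos_of_neg hn hb)]
    · obtain ⟨c, rfl⟩ := Int.eq_ofNat_of_zero_le (not_lt.1 hb)
      rw [if_neg hb, if_neg (not_lt.2 (by positivity)), ← Nat.cast_mul, Int.natAbs_natCast,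
        Int.natAbs_natCast, coeff_expand_mul]
  · rw [coeff_dilate_of_not_dvd _ _ h, PowerSeries.coeff_coe]
    split_ifs with ha
    · rfl
    · rw [coeff_expand_of_not_dvd]
      rwa [← Int.natCast_dvd]

/-- All exponents of `f` lie in residue classes belonging to `S`. -/
def SuppIn (M : ℕ) (S : Set (ZMod M)) (f : ℚ⸨X⸩) : Prop :=
  ∀ n : ℤ, f.coeff n ≠ 0 → (n : ZMod M) ∈ S

namespace SuppIn

variable {M : ℕ} {S T : Set (ZMod M)} {f g : ℚ⸨X⸩}

theorem mono (hf : SuppIn M S f) (h : S ⊆ T) : SuppIn M T f := fun n hn => h (hf n hn)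

theorem add (hf : SuppIn M S f) (hg : SuppIn M S g) : SuppIn M S (f + g) := by
  intro n hn
  by_cases h : f.coeff n = 0
  · refine hg n fun h' => hn ?_
    rw [HahnSeries.coeff_add, h, h', add_zero]
  · exact hf n h

theorem neg (hf : SuppIn M S f) : SuppIn M S (-f) := by
  intro n hn
  rw [HahnSeries.coeff_neg, neg_ne_zero] at hn
  exact hf n hn

theorem sub (hf : SuppIn M S f) (hg : SuppIn M S g) : SuppIn M S (f - g) := by
  rw [sub_eq_add_neg]; exact hf.add hg.neg

theorem mul (hf : SuppIn M S f) (hg : SuppIn M T g) : SuppIn M (S + T) (f * g) := by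
  intro n hn
  rw [HahnSeries.coeff_mul] at hn
  obtain ⟨⟨i, j⟩, hij, h⟩ := Finset.exists_ne_zero_of_sum_ne_zero hn
  rw [Finset.mem_antidiagonal] at hij
  rw [← hij.2.2, Int.cast_add]
  exact Set.add_mem_add (hf _ (left_ne_zero_of_mul h)) (hg _ (right_ne_zero_of_mul h))

theorem dilate {m n : ℕ} [NeZero n] {S : Set (ZMod m)} (hf : SuppIn m S f)
    (h : ∀ k : ℤ, (k : ZMod m) ∈ S → ((n * k : ℤ) : ZMod M) ∈ T) :
    SuppIn M T (dilate n f) := by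
  intro a ha
  by_cases hd : (n : ℤ) ∣ a
  · obtain ⟨b, rfl⟩ := hd
    rw [coeff_dilate_mul] at ha
    exact h b (hf b ha)
  · exact absurd (coeff_dilate_of_not_dvd n f hd) ha

theorem dilate_zero (n : ℕ) [NeZero n] (h : M ∣ n) (f : ℚ⸨X⸩) :
    SuppIn M {0} (RogersRamanujanCF.dilate n f) :=
  dilate (m := 1) (S := Set.univ) (fun _ _ => trivial) fun k _ => by
    have : ((n : ℕ) : ZMod M) = 0 := (ZMod.natCast_eq_zero_iff n M).2 h
    simp [this]

theorem zero_mul (hf : SuppIn M {0} f) (hg : SuppIn M S g) : SuppIn M S (f * g) := by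
  have := hf.mul hg
  rwa [Set.singleton_add, show (fun x : ZMod M => 0 + x) = id from funext zero_add,
    Set.image_id] at this

theorem single (n : ℤ) (r : ℚ) : SuppIn M {(n : ZMod M)} (HahnSeries.single n r) := by
  intro a ha
  by_cases h : a = n
  · rw [h]; rfl
  · exact absurd (HahnSeries.coeff_single_of_ne h) ha

end SuppIn

theorem coe_ne_zero_of_constantCoeff {f : ℚ⟦X⟧} (h : constantCoeff f ≠ 0) : (f : ℚ⸨X⸩) ≠ 0 := by
  intro h0
  refine h ?_
  rw [← coeff_zero_eq_constantCoeff_apply, ← LaurentSeries.coeff_coe_powerSeries, h0]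
  simp

/-! ### The parameters as Laurent series -/

/-- The variable `q` as a Laurent series. -/
noncomputable def qL : ℚ⸨X⸩ := ((X : ℚ⟦X⟧) : ℚ⸨X⸩)

/-- The Rogers–Ramanujan continued fraction as a Laurent series. -/
noncomputable def rL : ℚ⸨X⸩ := (series : ℚ⸨X⸩)

theorem qL_ne_zero : qL ≠ 0 := by
  rw [qL, PowerSeries.coe_X]
  exact HahnSeries.single_ne_zero one_ne_zero

theorem rL_ne_zero : rL ≠ 0 :=
  coe_ne_zero_of_constantCoeff (by rw [constantCoeff_series]; exact one_ne_zero)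

theorem dilate_qL (n : ℕ) [NeZero n] : dilate n qL = qL ^ n := by
  rw [qL, dilate_coe, expand_X, PowerSeries.coe_pow]

theorem suppIn_qL_zpow (M : ℕ) (i : ℤ) : SuppIn M {(i : ZMod M)} (qL ^ i) := by
  rw [qL, PowerSeries.coe_X, ← RatFunc.single_zpow]
  exact SuppIn.single i 1

/-- The parameter `k = q R(q) R(q ^ 2) ^ 2`. -/
noncomputable def kL : ℚ⸨X⸩ := qL * rL * dilate 2 rL ^ 2

/-- The quotient `R(q) ^ 2 / R(q ^ 2)`. -/
noncomputable def mL : ℚ⸨X⸩ := rL ^ 2 / dilate 2 rL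

/-- The quantity `s = k / (1 - k ^ 2)`, one quarter of `1 / m - m`. -/
noncomputable def sL : ℚ⸨X⸩ := kL / (1 - kL ^ 2)

/-- `v = q R(q ^ 5)`. -/
noncomputable def vL : ℚ⸨X⸩ := qL * dilate 5 rL

/-- `w = q ^ 2 R(q ^ 10)`. -/
noncomputable def wL : ℚ⸨X⸩ := dilate 2 vL

theorem dilate_rL_ne_zero (n : ℕ) [NeZero n] : dilate n rL ≠ 0 :=
  (map_ne_zero _).2 rL_ne_zero

theorem kL_ne_zero : kL ≠ 0 :=
  mul_ne_zero (mul_ne_zero qL_ne_zero rL_ne_zero) (pow_ne_zero 2 (dilate_rL_ne_zero 2))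

theorem vL_ne_zero : vL ≠ 0 := mul_ne_zero qL_ne_zero (dilate_rL_ne_zero 5)

theorem wL_ne_zero : wL ≠ 0 := (map_ne_zero _).2 vL_ne_zero

theorem mL_ne_zero : mL ≠ 0 := div_ne_zero (pow_ne_zero 2 rL_ne_zero) (dilate_rL_ne_zero 2)

theorem kL_eq_coe :
    kL = ((X * series * expand 2 two_ne_zero series ^ 2 : ℚ⟦X⟧) : ℚ⸨X⸩) := by
  rw [kL, qL, rL, dilate_coe]
  simp only [PowerSeries.coe_mul, PowerSeries.coe_pow]

theorem vL_eq_coe : vL = ((X * expand 5 (by norm_num) series : ℚ⟦X⟧) : ℚ⸨X⸩) := by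
  rw [vL, qL, rL, dilate_coe, PowerSeries.coe_mul]

theorem wL_eq_coe : wL = ((X ^ 2 * expand 10 (by norm_num) series : ℚ⟦X⟧) : ℚ⸨X⸩) := by
  rw [wL, vL_eq_coe, dilate_coe, map_mul, expand_X, ← expand_mul 2 two_ne_zero 5 (by norm_num)]

/-- A series with invertible constant term obtained from series without constant term. -/
theorem one_add_coe_ne_zero {f : ℚ⸨X⸩} {g : ℚ⟦X⟧} (h : f = 1 + (g : ℚ⸨X⸩))
    (hg : constantCoeff g = 0) : f ≠ 0 := by
  rw [h, ← PowerSeries.coe_one, ← PowerSeries.coe_add]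
  exact coe_ne_zero_of_constantCoeff (by simp [hg])

theorem exists_kL : ∃ g : ℚ⟦X⟧, kL = g ∧ constantCoeff g = 0 := ⟨_, kL_eq_coe, by simp⟩

theorem exists_vL : ∃ g : ℚ⟦X⟧, vL = g ∧ constantCoeff g = 0 := ⟨_, vL_eq_coe, by simp⟩

theorem exists_wL : ∃ g : ℚ⟦X⟧, wL = g ∧ constantCoeff g = 0 := ⟨_, wL_eq_coe, by simp⟩

theorem one_add_kL_ne_zero : 1 + kL ≠ 0 := by
  obtain ⟨g, hg, h0⟩ := exists_kL
  exact one_add_coe_ne_zero (g := g) (by rw [hg]) h0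

theorem one_sub_kL_ne_zero : 1 - kL ≠ 0 := by
  obtain ⟨g, hg, h0⟩ := exists_kL
  exact one_add_coe_ne_zero (g := -g) (by rw [hg, PowerSeries.coe_neg]; ring) (by simp [h0])

theorem one_sub_kL_sq_ne_zero : 1 - kL ^ 2 ≠ 0 := by
  rw [show 1 - kL ^ 2 = (1 - kL) * (1 + kL) by ring]
  exact mul_ne_zero one_sub_kL_ne_zero one_add_kL_ne_zero

theorem sL_ne_zero : sL ≠ 0 := div_ne_zero kL_ne_zero one_sub_kL_sq_ne_zero

/-- Values of integral polynomials at power series without constant term. -/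
theorem eval_kL_ne_zero (a b : ℤ) : 1 + a * kL + b * kL ^ 2 ≠ 0 := by
  obtain ⟨g, hg, h0⟩ := exists_kL
  refine one_add_coe_ne_zero (g := a * g + b * g ^ 2) ?_ (by simp [h0])
  rw [hg, PowerSeries.coe_add, PowerSeries.coe_mul, PowerSeries.coe_mul, PowerSeries.coe_pow,
    map_intCast, map_intCast, add_assoc]

theorem one_sub_four_kL_ne_zero : 1 - 4 * kL - kL ^ 2 ≠ 0 := by
  have := eval_kL_ne_zero (-4) (-1)
  rwa [show 1 + ((-4 : ℤ) : ℚ⸨X⸩) * kL + ((-1 : ℤ) : ℚ⸨X⸩) * kL ^ 2 = 1 - 4 * kL - kL ^ 2 by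
    push_cast; ring] at this

theorem one_add_kL_sub_sq_ne_zero : 1 + kL - kL ^ 2 ≠ 0 := by
  have := eval_kL_ne_zero 1 (-1)
  rwa [show 1 + ((1 : ℤ) : ℚ⸨X⸩) * kL + ((-1 : ℤ) : ℚ⸨X⸩) * kL ^ 2 = 1 + kL - kL ^ 2 by
    push_cast; ring] at this

theorem one_sub_vL_ne_zero : 1 - vL - vL ^ 2 ≠ 0 := by
  obtain ⟨g, hg, h0⟩ := exists_vL
  refine one_add_coe_ne_zero (g := -g - g ^ 2) ?_ (by simp [h0])
  rw [hg, PowerSeries.coe_sub, PowerSeries.coe_neg, PowerSeries.coe_pow]; ring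

theorem level_ten_denominator_ne_zero : 1 + wL ^ 2 - vL - 2 * vL * wL ≠ 0 := by
  obtain ⟨g, hg, h0⟩ := exists_vL
  obtain ⟨h, hh, h1⟩ := exists_wL
  refine one_add_coe_ne_zero (g := h ^ 2 - g - 2 * g * h) ?_ (by simp [h0, h1])
  rw [hg, hh]
  simp only [PowerSeries.coe_sub, PowerSeries.coe_mul, PowerSeries.coe_pow, map_ofNat]
  ring

theorem dilate_five_kL : dilate 5 kL = vL * wL ^ 2 := by
  rw [kL, wL, vL]
  simp only [map_mul, map_pow, dilate_qL, dilate_dilate]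
  ring

/-- `R(q) ^ 2 / R(q ^ 2) = (1 - k) / (1 + k)`. -/
theorem mL_eq : mL = (1 - kL) / (1 + kL) := by
  have h := congrArg (fun f : ℚ⟦X⟧ => (f : ℚ⸨X⸩)) series_modular_two
  simp only [PowerSeries.coe_sub, PowerSeries.coe_mul, PowerSeries.coe_pow,
    PowerSeries.coe_add] at h
  rw [← dilate_coe 2] at h
  change dilate 2 rL - rL ^ 2 = qL * rL * dilate 2 rL ^ 2 * (dilate 2 rL + rL ^ 2) at h
  rw [mL, div_eq_div_iff (dilate_rL_ne_zero 2) one_add_kL_ne_zero, kL]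
  linear_combination -h

theorem level_ten_relations :
    qL * rL ^ 5 * (1 + 3 * vL + 4 * vL ^ 2 + 2 * vL ^ 3 + vL ^ 4) =
      vL * (1 - 2 * vL + 4 * vL ^ 2 - 3 * vL ^ 3 + vL ^ 4) ∧
    kL * (1 + wL ^ 2 - vL - 2 * vL * wL) = vL - 2 * wL + wL ^ 2 + vL * wL ^ 2 ∧
    wL - vL ^ 2 = vL * wL ^ 2 * (wL + vL ^ 2) := by
  obtain ⟨h1, h2, h3⟩ := series_modular_five rfl rfl
  replace h1 := congrArg (fun f : ℚ⟦X⟧ => (f : ℚ⸨X⸩)) h1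
  replace h2 := congrArg (fun f : ℚ⟦X⟧ => (f : ℚ⸨X⸩)) h2
  replace h3 := congrArg (fun f : ℚ⟦X⟧ => (f : ℚ⸨X⸩)) h3
  rw [kL_eq_coe, vL_eq_coe, wL_eq_coe, qL, rL]
  refine ⟨?_, ?_, ?_⟩
  · simpa only [PowerSeries.coe_sub, PowerSeries.coe_mul, PowerSeries.coe_pow,
      PowerSeries.coe_add, map_ofNat, PowerSeries.coe_one] using h1
  · simpa only [PowerSeries.coe_sub, PowerSeries.coe_mul, PowerSeries.coe_pow,
      PowerSeries.coe_add, map_ofNat, PowerSeries.coe_one] using h2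
  · simpa only [PowerSeries.coe_sub, PowerSeries.coe_mul, PowerSeries.coe_pow,
      PowerSeries.coe_add, map_ofNat, PowerSeries.coe_one] using h3

/-- The degree two equation between `v` and `w`, with `v` eliminated through `K = v w²`. -/
theorem wL_pow_five :
    wL ^ 5 * (1 - dilate 5 kL) = dilate 5 kL ^ 2 * (1 + dilate 5 kL) := by
  rw [dilate_five_kL]
  linear_combination wL ^ 4 * level_ten_relations.2.2

theorem kL_mul :
    kL * (wL ^ 2 + wL ^ 4 - dilate 5 kL - 2 * dilate 5 kL * wL) =
      dilate 5 kL - 2 * wL ^ 3 + wL ^ 4 + dilate 5 kL * wL ^ 2 := by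
  rw [dilate_five_kL]
  linear_combination wL ^ 2 * level_ten_relations.2.1

/-! ### Supports modulo 5 in level ten -/

theorem suppIn_of_mem_range {f : ℚ⸨X⸩} (h : f ∈ (dilate 5).fieldRange) : SuppIn 5 {0} f := by
  obtain ⟨g, rfl⟩ := h
  exact SuppIn.dilate_zero 5 dvd_rfl g

theorem suppIn_vL_zpow (i : ℤ) : SuppIn 5 {(i : ZMod 5)} (vL ^ i) := by
  rw [vL, mul_zpow, mul_comm, ← map_zpow₀]
  exact (SuppIn.dilate_zero 5 dvd_rfl _).zero_mul (suppIn_qL_zpow 5 i)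

theorem suppIn_mul_wL_zpow {f : ℚ⸨X⸩} (h : f ∈ (dilate 5).fieldRange) (i : ℤ) :
    SuppIn 5 {((2 * i : ℤ) : ZMod 5)} (f * wL ^ i) := by
  refine (suppIn_of_mem_range h).zero_mul ?_
  rw [wL, ← map_zpow₀]
  exact (suppIn_vL_zpow i).dilate fun k hk => by
    rw [Set.mem_singleton_iff] at hk ⊢
    push_cast
    rw [hk]

theorem two_ne_zero_laurent : (2 : ℚ⸨X⸩) ≠ 0 := by
  have := (map_ne_zero (HahnSeries.C : ℚ →+* ℚ⸨X⸩)).2 (two_ne_zero (α := ℚ))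
  rwa [map_ofNat] at this

/-- The quantity `1 / v - 1 - v`, whose exponents are `0, 1, 4` modulo `5`. -/
noncomputable def aL : ℚ⸨X⸩ := 1 / vL - 1 - vL

/-- The cofactor, up to level five, of the square root of `s + s ^ 2`, see `sL_add_sq`. -/
noncomputable def psiL : ℚ⸨X⸩ := (1 / wL - 1 - wL) / (1 - 4 * dilate 5 kL - dilate 5 kL ^ 2)

theorem aL_eq : aL = wL ^ 2 / dilate 5 kL - 1 - dilate 5 kL / wL ^ 2 := by
  have := vL_ne_zero
  have := wL_ne_zero
  rw [aL, dilate_five_kL]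
  field_simp

theorem aL_ne_zero : aL ≠ 0 := by
  have h : aL = (1 - vL - vL ^ 2) / vL := by
    have := vL_ne_zero
    rw [aL]; field_simp
  rw [h]
  exact div_ne_zero one_sub_vL_ne_zero vL_ne_zero

theorem dilate_two_aL : dilate 2 aL = 1 / wL - 1 - wL := by
  simp only [aL, map_sub, map_div₀, map_one, wL]

theorem dilate_five_one_sub_four_kL_ne_zero : 1 - 4 * dilate 5 kL - dilate 5 kL ^ 2 ≠ 0 := by
  have := (map_ne_zero (dilate 5)).2 one_sub_four_kL_ne_zero
  simpa only [map_sub, map_mul, map_pow, map_one, map_ofNat] using this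

theorem dilate_five_one_add_kL_sub_sq_ne_zero : 1 + dilate 5 kL - dilate 5 kL ^ 2 ≠ 0 := by
  have := (map_ne_zero (dilate 5)).2 one_add_kL_sub_sq_ne_zero
  simpa only [map_sub, map_add, map_pow, map_one] using this

theorem dilate_five_one_add_kL_ne_zero : 1 + dilate 5 kL ≠ 0 := by
  have := (map_ne_zero (dilate 5)).2 one_add_kL_ne_zero
  simpa only [map_add, map_one] using this

theorem dilate_five_one_sub_kL_ne_zero : 1 - dilate 5 kL ≠ 0 := by
  have := (map_ne_zero (dilate 5)).2 one_sub_kL_ne_zero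
  simpa only [map_sub, map_one] using this

theorem dilate_five_kL_ne_zero : dilate 5 kL ≠ 0 := (map_ne_zero _).2 kL_ne_zero

theorem dilate_two_aL_ne_zero : 1 / wL - 1 - wL ≠ 0 := by
  rw [← dilate_two_aL]
  exact (map_ne_zero _).2 aL_ne_zero

theorem level_ten_denominator_ne_zero' :
    wL ^ 2 + wL ^ 4 - dilate 5 kL - 2 * dilate 5 kL * wL ≠ 0 := by
  rw [dilate_five_kL, show wL ^ 2 + wL ^ 4 - vL * wL ^ 2 - 2 * (vL * wL ^ 2) * wL =
    wL ^ 2 * (1 + wL ^ 2 - vL - 2 * vL * wL) by ring]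
  exact mul_ne_zero (pow_ne_zero 2 wL_ne_zero) level_ten_denominator_ne_zero

theorem one_div_mL : 1 / mL = (1 + kL) / (1 - kL) := by
  rw [mL_eq, one_div_div]

theorem mL_add_inv : mL + 1 / mL =
    (2 * (1 + dilate 5 kL ^ 2) + 4 * (1 - 2 * dilate 5 kL) * wL -
      4 * dilate 5 kL * (2 + dilate 5 kL) / wL) /
      (1 - 4 * dilate 5 kL - dilate 5 kL ^ 2) := by
  rw [one_div_mL, mL_eq]
  exact level_ten_add_inv_mobius wL_ne_zero dilate_five_one_sub_four_kL_ne_zero one_add_kL_ne_zero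
    one_sub_kL_ne_zero level_ten_denominator_ne_zero' wL_pow_five kL_mul

theorem mL_add_inv_eq_sL : mL + 1 / mL = 2 * sL * (kL + 1 / kL) := by
  have h1 := one_add_kL_ne_zero
  have h2 := one_sub_kL_ne_zero
  have h3 := kL_ne_zero
  have h4 := one_sub_kL_sq_ne_zero
  rw [one_div_mL, mL_eq, sL, show 1 - kL ^ 2 = (1 - kL) * (1 + kL) by ring]
  field_simp
  ring

theorem inv_sub_mL : 1 / mL - mL = 4 * sL := by
  have h1 := one_add_kL_ne_zero
  have h2 := one_sub_kL_ne_zero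
  rw [one_div_mL, mL_eq, sL, show 1 - kL ^ 2 = (1 - kL) * (1 + kL) by ring]
  field_simp
  ring

theorem sL_eq : sL = (1 + dilate 5 kL - dilate 5 kL ^ 2) * aL /
    ((1 - 4 * dilate 5 kL - dilate 5 kL ^ 2) * (1 / wL - 1 - wL)) := by
  rw [aL_eq]
  exact level_ten_eta wL_ne_zero dilate_five_kL_ne_zero dilate_five_one_sub_four_kL_ne_zero
    one_sub_kL_sq_ne_zero level_ten_denominator_ne_zero' dilate_two_aL_ne_zero wL_pow_five kL_mul

theorem sL_add_sq : sL + sL ^ 2 =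
    dilate 5 kL * (1 + dilate 5 kL - dilate 5 kL ^ 2) * psiL ^ 2 := by
  have h := sL_eq
  rw [aL_eq] at h
  exact level_ten_eta_sq wL_ne_zero dilate_five_kL_ne_zero dilate_five_one_sub_four_kL_ne_zero
    dilate_two_aL_ne_zero wL_pow_five h

theorem SuppIn.mono_mem {M : ℕ} {a : ZMod M} {T : Set (ZMod M)} {f : ℚ⸨X⸩} (hf : SuppIn M {a} f)
    (h : a ∈ T) : SuppIn M T f := hf.mono (Set.singleton_subset_iff.2 h)

theorem suppIn_wL_terms (T : Set (ZMod 5)) (c : ℚ⸨X⸩) (i : ℤ) (h : ((2 * i : ℤ) : ZMod 5) ∈ T)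
    {f : ℚ⸨X⸩} (hf : f = dilate 5 c * wL ^ i) : SuppIn 5 T f := by
  rw [hf]
  exact (suppIn_mul_wL_zpow ⟨c, rfl⟩ i).mono_mem h

theorem suppIn_mL_add_inv : SuppIn 5 {0, 2, 3} (mL + 1 / mL) := by
  have h : mL + 1 / mL =
      dilate 5 (2 * (1 + kL ^ 2) / (1 - 4 * kL - kL ^ 2)) * wL ^ (0 : ℤ) +
      dilate 5 (4 * (1 - 2 * kL) / (1 - 4 * kL - kL ^ 2)) * wL ^ (1 : ℤ) +
      dilate 5 (-4 * kL * (2 + kL) / (1 - 4 * kL - kL ^ 2)) * wL ^ (-1 : ℤ) := by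
    rw [mL_add_inv]
    simp only [map_div₀, map_mul, map_add, map_sub, map_one, map_ofNat, map_pow, map_neg, zpow_zero,
      zpow_one, zpow_neg]
    ring
  rw [h]
  exact ((suppIn_wL_terms _ _ 0 (by decide) rfl).add (suppIn_wL_terms _ _ 1 (by decide) rfl)).add
    (suppIn_wL_terms _ _ (-1) (by decide) rfl)

theorem suppIn_kL_add_inv : SuppIn 5 {0, 1, 4} (kL + 1 / kL) := by
  have h : kL + 1 / kL =
      dilate 5 ((1 + kL ^ 2) / (1 + kL - kL ^ 2)) * wL ^ (0 : ℤ) +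
      dilate 5 ((1 - kL) * (1 + 3 * kL) / kL / (1 + kL - kL ^ 2)) * wL ^ (2 : ℤ) +
      dilate 5 (kL * (3 - kL) * (1 + kL) / (1 + kL - kL ^ 2)) * wL ^ (-2 : ℤ) := by
    rw [level_ten_add_inv wL_ne_zero dilate_five_kL_ne_zero dilate_five_one_add_kL_sub_sq_ne_zero
      kL_ne_zero level_ten_denominator_ne_zero' wL_pow_five kL_mul]
    simp only [map_div₀, map_mul, map_add, map_sub, map_one, map_ofNat, map_pow,
      zpow_neg, zpow_ofNat]
    ring
  rw [h]
  exact ((suppIn_wL_terms _ _ 0 (by decide) rfl).add (suppIn_wL_terms _ _ 2 (by decide) rfl)).add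
    (suppIn_wL_terms _ _ (-2) (by decide) rfl)

theorem suppIn_psiL : SuppIn 5 {0, 2, 3} psiL := by
  have h : psiL = dilate 5 (-1 / (1 - 4 * kL - kL ^ 2)) * wL ^ (0 : ℤ) +
      dilate 5 (-1 / (1 - 4 * kL - kL ^ 2)) * wL ^ (1 : ℤ) +
      dilate 5 (1 / (1 - 4 * kL - kL ^ 2)) * wL ^ (-1 : ℤ) := by
    rw [psiL]
    simp only [map_div₀, map_mul, map_sub, map_one, map_ofNat, map_pow, map_neg, zpow_zero,
      zpow_one, zpow_neg]
    ring
  rw [h]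
  exact ((suppIn_wL_terms _ _ 0 (by decide) rfl).add (suppIn_wL_terms _ _ 1 (by decide) rfl)).add
    (suppIn_wL_terms _ _ (-1) (by decide) rfl)

theorem suppIn_aL : SuppIn 5 {0, 1, 4} aL := by
  have h : aL = vL ^ (-1 : ℤ) - vL ^ (0 : ℤ) - vL ^ (1 : ℤ) := by
    simp only [aL, zpow_neg, zpow_one, zpow_zero]
    ring
  rw [h]
  exact (((suppIn_vL_zpow (-1)).mono_mem (by decide)).sub
    ((suppIn_vL_zpow 0).mono_mem (by decide))).sub ((suppIn_vL_zpow 1).mono_mem (by decide))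

/-- By `sL_eq` the quotient is `a(q²)² / a(q)` up to a series in `q⁵`, and `level_ten_sq` cancels
the denominator. -/
theorem suppIn_psiL_div_sL : SuppIn 5 {0, 2, 3} (psiL / sL) := by
  have h0 := dilate_five_one_add_kL_sub_sq_ne_zero
  have h1 := dilate_five_one_sub_four_kL_ne_zero
  have h : psiL / sL = dilate 5 (1 / (1 + kL - kL ^ 2)) * wL ^ (0 : ℤ) +
      dilate 5 ((1 - kL) / kL / (1 + kL - kL ^ 2)) * wL ^ (1 : ℤ) +
      dilate 5 ((1 + kL) / (1 + kL - kL ^ 2)) * wL ^ (-1 : ℤ) := by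
    have e : psiL / sL = (1 / wL - 1 - wL) ^ 2 / ((1 + dilate 5 kL - dilate 5 kL ^ 2) * aL) := by
      have h2 := aL_ne_zero
      have h3 := dilate_two_aL_ne_zero
      rw [psiL, sL_eq]
      generalize 1 / wL - 1 - wL = b at *
      field_simp
    rw [e, level_ten_sq wL_ne_zero dilate_five_kL_ne_zero wL_pow_five, ← aL_eq, mul_comm aL,
      mul_div_mul_right _ _ aL_ne_zero]
    simp only [map_div₀, map_add, map_sub, map_one, map_pow, zpow_zero,
      zpow_one, zpow_neg]
    ring
  rw [h]
  exact ((suppIn_wL_terms _ _ 0 (by decide) rfl).add (suppIn_wL_terms _ _ 1 (by decide) rfl)).add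
    (suppIn_wL_terms _ _ (-1) (by decide) rfl)

theorem suppIn_aL_mul_sL : SuppIn 5 {0, 1, 4} (aL * sL) := by
  have h : aL * sL =
      dilate 5 ((1 + kL - kL ^ 2) / (1 - 4 * kL - kL ^ 2)) * wL ^ (0 : ℤ) +
      dilate 5 ((1 + kL - kL ^ 2) / (1 - 4 * kL - kL ^ 2) * (2 / (1 + kL))) * wL ^ (2 : ℤ) +
      dilate 5 ((1 + kL - kL ^ 2) / (1 - 4 * kL - kL ^ 2) * (-2 * kL / (1 - kL))) *
        wL ^ (-2 : ℤ) := by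
    have e : aL * sL = (1 + dilate 5 kL - dilate 5 kL ^ 2) * aL ^ 2 /
        ((1 - 4 * dilate 5 kL - dilate 5 kL ^ 2) * (1 / wL - 1 - wL)) := by
      rw [sL_eq]; ring
    rw [e, aL_eq, level_ten_sq' wL_ne_zero dilate_five_kL_ne_zero dilate_five_one_sub_kL_ne_zero
      dilate_five_one_add_kL_ne_zero wL_pow_five, mul_left_comm,
      mul_comm (1 - 4 * dilate 5 kL - dilate 5 kL ^ 2),
      mul_div_mul_left _ _ dilate_two_aL_ne_zero]
    simp only [map_div₀, map_add, map_sub, map_mul, map_neg, map_ofNat, map_one, map_pow,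
      zpow_ofNat, zpow_neg]
    ring
  rw [h]
  exact ((suppIn_wL_terms _ _ 0 (by decide) rfl).add (suppIn_wL_terms _ _ 2 (by decide) rfl)).add
    (suppIn_wL_terms _ _ (-2) (by decide) rfl)

/-- The numerator of `psiL` is exactly the `w`-dependent denominator of `sL`. -/
theorem psiL_mul_sL : psiL * sL =
    dilate 5 ((1 + kL - kL ^ 2) / (1 - 4 * kL - kL ^ 2) ^ 2) * aL := by
  have h1 := dilate_five_one_sub_four_kL_ne_zero
  have h3 := dilate_two_aL_ne_zero
  simp only [map_div₀, map_add, map_sub, map_mul, map_ofNat, map_one, map_pow]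
  rw [psiL, sL_eq]
  generalize 1 / wL - 1 - wL = b at *
  field_simp

theorem suppIn_psiL_mul_sL : SuppIn 5 {0, 1, 4} (psiL * sL) := by
  rw [psiL_mul_sL]
  exact (SuppIn.dilate_zero 5 dvd_rfl _).zero_mul suppIn_aL

theorem suppIn_psiL_mul_sL_sq : SuppIn 5 {0, 1, 4} (psiL * sL ^ 2) := by
  rw [pow_two, ← mul_assoc, psiL_mul_sL, mul_assoc]
  exact (SuppIn.dilate_zero 5 dvd_rfl _).zero_mul suppIn_aL_mul_sL

/-- In the expansion the coefficients of `w` and `1/w` cancel. What remains has exponents `0, ±2,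
±3` in `w`, hence residues `0, 1, 4`. -/
theorem suppIn_sq_mul_mL_add_inv :
    SuppIn 5 {0, 1, 4} ((1 / wL - 1 - wL) ^ 2 * (mL + 1 / mL)) := by
  have hw := wL_ne_zero
  have h : (1 / wL - 1 - wL) ^ 2 * (mL + 1 / mL) =
      dilate 5 ((-10 - 10 * kL ^ 2) / (1 - 4 * kL - kL ^ 2)) * wL ^ (0 : ℤ) +
      dilate 5 ((2 * kL ^ 2 - 16 * kL + 10) / (1 - 4 * kL - kL ^ 2)) * wL ^ (2 : ℤ) +
      dilate 5 ((10 * kL ^ 2 + 16 * kL + 2) / (1 - 4 * kL - kL ^ 2)) * wL ^ (-2 : ℤ) +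
      dilate 5 ((4 - 8 * kL) / (1 - 4 * kL - kL ^ 2)) * wL ^ (3 : ℤ) +
      dilate 5 ((-4 * kL ^ 2 - 8 * kL) / (1 - 4 * kL - kL ^ 2)) * wL ^ (-3 : ℤ) := by
    rw [mL_add_inv]
    simp only [map_div₀, map_add, map_sub, map_mul, map_neg, map_ofNat, map_one, map_pow,
      zpow_ofNat, zpow_neg]
    field_simp
    ring
  rw [h]
  exact ((((suppIn_wL_terms _ _ 0 (by decide) rfl).add
    (suppIn_wL_terms _ _ 2 (by decide) rfl)).add
    (suppIn_wL_terms _ _ (-2) (by decide) rfl)).add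
    (suppIn_wL_terms _ _ 3 (by decide) rfl)).add
    (suppIn_wL_terms _ _ (-3) (by decide) rfl)

theorem suppIn_sL_add_sq_mul : SuppIn 5 {0, 1, 4} ((sL + sL ^ 2) * (mL + 1 / mL)) := by
  have h : (sL + sL ^ 2) * (mL + 1 / mL) =
      dilate 5 (kL * (1 + kL - kL ^ 2) / (1 - 4 * kL - kL ^ 2) ^ 2) *
        ((1 / wL - 1 - wL) ^ 2 * (mL + 1 / mL)) := by
    rw [sL_add_sq, psiL]
    simp only [map_div₀, map_add, map_sub, map_mul, map_ofNat, map_one, map_pow]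
    generalize 1 / wL - 1 - wL = b
    generalize mL + 1 / mL = c
    generalize 1 - 4 * dilate 5 kL - dilate 5 kL ^ 2 = d
    ring
  rw [h]
  exact (SuppIn.dilate_zero 5 dvd_rfl _).zero_mul suppIn_sq_mul_mL_add_inv

theorem suppIn_aL_mul_psiL_mul : SuppIn 5 {0, 1, 4} (aL * psiL * (kL + 1 / kL)) := by
  have h : aL * psiL * (kL + 1 / kL) =
      dilate 5 (1 / (2 * (1 + kL - kL ^ 2))) * ((1 / wL - 1 - wL) ^ 2 * (mL + 1 / mL)) := by
    have h1 := dilate_five_one_sub_four_kL_ne_zero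
    have h3 := dilate_two_aL_ne_zero
    have h4 := dilate_five_one_add_kL_sub_sq_ne_zero
    rw [mL_add_inv_eq_sL, psiL, sL_eq]
    simp only [map_div₀, map_add, map_sub, map_mul, map_ofNat, map_one, map_pow]
    generalize kL + 1 / kL = c at *
    generalize 1 / wL - 1 - wL = b at *
    have h2 := two_ne_zero_laurent
    field_simp
  rw [h]
  exact (SuppIn.dilate_zero 5 dvd_rfl _).zero_mul suppIn_sq_mul_mL_add_inv

/-- Removes `1/w - 1 - w` from the denominator, using the quintic for `w`, so that products with
`sL` can be expanded in powers of `w`. -/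
theorem sL_eq_poly : sL = (dilate 5 kL + dilate 5 kL * (1 + dilate 5 kL) / wL ^ 2 - wL -
    dilate 5 kL ^ 2 / wL - (1 - dilate 5 kL) * wL ^ 2) /
      (1 - 4 * dilate 5 kL - dilate 5 kL ^ 2) := by
  have hw := wL_ne_zero
  have hK := dilate_five_kL_ne_zero
  have h0 := dilate_five_one_sub_four_kL_ne_zero
  have h1 := dilate_two_aL_ne_zero
  have h5 := wL_pow_five
  rw [sL_eq, div_eq_div_iff (mul_ne_zero h0 h1) h0, aL_eq]
  generalize dilate 5 kL = K at *
  generalize wL = w at *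
  refine mul_left_cancel₀ (mul_ne_zero hK (pow_ne_zero 3 hw)) ?_
  have e1 : K * w ^ 3 * ((1 + K - K ^ 2) * (w ^ 2 / K - 1 - K / w ^ 2) * (1 - 4 * K - K ^ 2)) =
      (1 - 4 * K - K ^ 2) * ((1 + K - K ^ 2) * (w ^ 4 - K * w ^ 2 - K ^ 2) * w) := by
    field_simp
  have e2 : K * w ^ 3 * ((K + K * (1 + K) / w ^ 2 - w - K ^ 2 / w - (1 - K) * w ^ 2) *
      ((1 - 4 * K - K ^ 2) * (1 / w - 1 - w))) = (1 - 4 * K - K ^ 2) * (K * (1 - w - w ^ 2) *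
        (K * w ^ 2 + K * (1 + K) - w ^ 3 - K ^ 2 * w - (1 - K) * w ^ 4)) := by
    field_simp
  rw [e1, e2]
  linear_combination (1 - 4 * K - K ^ 2) * (1 - w * K) * h5

/-- Again the terms in `w` and `1/w` cancel, although each factor has such terms. -/
theorem suppIn_mL_add_inv_mul : SuppIn 5 {0, 1, 4} ((mL + 1 / mL) * (1 + 2 * sL)) := by
  have h0 := dilate_five_one_sub_four_kL_ne_zero
  have hw := wL_ne_zero
  have h : (mL + 1 / mL) * (1 + 2 * sL) =
      dilate 5 ((-2 * kL ^ 4 + 12 * kL ^ 3 + 12 * kL + 2) / (1 - 4 * kL - kL ^ 2) ^ 2) *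
        wL ^ (0 : ℤ) +
      dilate 5 ((4 * kL ^ 3 - 4 * kL ^ 2 + 20 * kL - 12) / (1 - 4 * kL - kL ^ 2) ^ 2) *
        wL ^ (2 : ℤ) +
      dilate 5 ((12 * kL ^ 4 + 20 * kL ^ 3 + 4 * kL ^ 2 + 4 * kL) /
        (1 - 4 * kL - kL ^ 2) ^ 2) * wL ^ (-2 : ℤ) +
      dilate 5 ((-16 * kL ^ 2 + 24 * kL - 8) / (1 - 4 * kL - kL ^ 2) ^ 2) * wL ^ (3 : ℤ) +
      dilate 5 ((-8 * kL ^ 4 - 24 * kL ^ 3 - 16 * kL ^ 2) / (1 - 4 * kL - kL ^ 2) ^ 2) *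
        wL ^ (-3 : ℤ) := by
    have e : 1 + 2 * sL = ((1 - 4 * dilate 5 kL - dilate 5 kL ^ 2) + 2 * (dilate 5 kL +
        dilate 5 kL * (1 + dilate 5 kL) / wL ^ 2 - wL -
        dilate 5 kL ^ 2 / wL - (1 - dilate 5 kL) * wL ^ 2)) /
        (1 - 4 * dilate 5 kL - dilate 5 kL ^ 2) := by
      rw [sL_eq_poly, eq_div_iff h0, add_mul, mul_assoc, div_mul_cancel₀ _ h0, one_mul]
    rw [mL_add_inv, e, div_mul_div_comm, ← pow_two]
    simp only [map_div₀, map_add, map_sub, map_mul, map_neg, map_ofNat, map_one, map_pow,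
      zpow_ofNat, zpow_neg]
    have h2 : (1 - 4 * dilate 5 kL - dilate 5 kL ^ 2) ^ 2 ≠ 0 := pow_ne_zero 2 h0
    generalize hd : (1 - 4 * dilate 5 kL - dilate 5 kL ^ 2) ^ 2 = d at *
    rw [div_eq_iff h2]
    field_simp
    ring
  rw [h]
  exact ((((suppIn_wL_terms _ _ 0 (by decide) rfl).add
    (suppIn_wL_terms _ _ 2 (by decide) rfl)).add
    (suppIn_wL_terms _ _ (-2) (by decide) rfl)).add
    (suppIn_wL_terms _ _ 3 (by decide) rfl)).add
    (suppIn_wL_terms _ _ (-3) (by decide) rfl)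

/-! ### Supports modulo 5 in level five -/

/-- The parameter `q R(q) ^ 5` of level five. -/
noncomputable def tL : ℚ⸨X⸩ := qL * rL ^ 5

section LevelFive

theorem vL_pow_five : vL ^ 5 = dilate 5 tL := by
  rw [vL, tL, mul_pow, map_mul, map_pow, dilate_qL]

theorem suppIn_vL_pow_add (T : Set (ZMod 5)) (c : ℚ⸨X⸩) (i : ℕ) (h : (i : ZMod 5) ∈ T) :
    SuppIn 5 T (dilate 5 c * vL ^ i) := by
  have := suppIn_vL_zpow i
  rw [zpow_natCast, Int.cast_natCast] at this
  exact ((SuppIn.dilate_zero 5 dvd_rfl c).zero_mul this).mono_mem h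

theorem tL_ne_zero : tL ≠ 0 := mul_ne_zero qL_ne_zero (pow_ne_zero 5 rL_ne_zero)

theorem one_sub_eleven_tL_ne_zero : 1 - 11 * tL - tL ^ 2 ≠ 0 := by
  refine one_add_coe_ne_zero
    (g := -11 * (X * series ^ 5) - (X * series ^ 5) ^ 2) ?_ (by simp)
  rw [tL, qL, rL]
  simp only [PowerSeries.coe_sub, PowerSeries.coe_mul, PowerSeries.coe_pow, PowerSeries.coe_neg,
    map_ofNat]
  ring

/-- The two quartics are denominator and numerator in the formula for `t`. Their product divides a
polynomial in `v⁵`, so clearing denominators costs only a factor in `q⁵`, which does not move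
residues. -/
theorem level_five_product :
    (1 + 3 * vL + 4 * vL ^ 2 + 2 * vL ^ 3 + vL ^ 4) *
      (1 - 2 * vL + 4 * vL ^ 2 - 3 * vL ^ 3 + vL ^ 4) * (1 - vL - vL ^ 2) =
      1 - 11 * dilate 5 tL - dilate 5 tL ^ 2 := by
  rw [← vL_pow_five]; ring

theorem dilate_five_one_sub_eleven_tL_ne_zero :
    1 - 11 * dilate 5 tL - dilate 5 tL ^ 2 ≠ 0 := by
  have := (map_ne_zero (dilate 5)).2 one_sub_eleven_tL_ne_zero
  simpa only [map_sub, map_mul, map_pow, map_one, map_ofNat] using this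

theorem suppIn_of_mul_one_sub_eleven {T : Set (ZMod 5)} {f : ℚ⸨X⸩}
    (h : SuppIn 5 T ((1 - 11 * dilate 5 tL - dilate 5 tL ^ 2) * f)) : SuppIn 5 T f := by
  have h1 := (SuppIn.dilate_zero 5 dvd_rfl (1 - 11 * tL - tL ^ 2)⁻¹).zero_mul h
  rw [map_inv₀] at h1
  simp only [map_sub, map_mul, map_pow, map_one, map_ofNat] at h1
  rwa [inv_mul_cancel_left₀ dilate_five_one_sub_eleven_tL_ne_zero] at h1

theorem suppIn_tL_add_inv : SuppIn 5 {0, 1, 4} (1 / tL + tL) := by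
  have hAB := level_five_product
  have hD := dilate_five_one_sub_eleven_tL_ne_zero
  have ht := level_ten_relations.1
  change tL * _ = _ at ht
  have hv := vL_ne_zero
  have ht0 := tL_ne_zero
  have h : vL * ((1 - 11 * dilate 5 tL - dilate 5 tL ^ 2) * (1 / tL + tL)) =
      1 + 5 * vL + 11 * vL ^ 2 - 66 * vL ^ 5 - 66 * vL ^ 7 - 11 * vL ^ 10 + 5 * vL ^ 11 -
        vL ^ 12 := by
    rw [← hAB] at hD ⊢
    obtain ⟨A, hA⟩ : ∃ A, A = 1 + 3 * vL + 4 * vL ^ 2 + 2 * vL ^ 3 + vL ^ 4 := ⟨_, rfl⟩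
    obtain ⟨B, hB⟩ : ∃ B, B = 1 - 2 * vL + 4 * vL ^ 2 - 3 * vL ^ 3 + vL ^ 4 := ⟨_, rfl⟩
    have h1 : vL * (A * B * (1 - vL - vL ^ 2) * (1 / tL + tL)) =
        (A ^ 2 + vL ^ 2 * B ^ 2) * (1 - vL - vL ^ 2) := by
      rw [← hA, ← hB] at ht
      field_simp
      linear_combination (-A + tL * vL * B) * (1 - vL - vL ^ 2) * ht
    rw [← hA, ← hB, h1, hA, hB]
    ring
  -- The term `1/v` becomes `v⁴ / t(q⁵)`, so that only natural powers of `v` occur.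
  have h2 : (1 - 11 * dilate 5 tL - dilate 5 tL ^ 2) * (1 / tL + tL) =
      dilate 5 (1 / tL) * vL ^ 4 + dilate 5 5 * vL ^ 0 + dilate 5 11 * vL ^ 1 +
      dilate 5 (-66) * vL ^ 4 + dilate 5 (-66) * vL ^ 6 + dilate 5 (-11) * vL ^ 9 +
      dilate 5 5 * vL ^ 10 + dilate 5 (-1) * vL ^ 11 := by
    refine mul_left_cancel₀ hv ?_
    rw [h]
    simp only [map_div₀, map_one, map_neg, map_ofNat, ← vL_pow_five]
    field_simp
    ring
  refine suppIn_of_mul_one_sub_eleven ?_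
  rw [h2]
  refine (((((((suppIn_vL_pow_add _ _ 4 (by decide)).add (suppIn_vL_pow_add _ _ 0 (by decide))).add
    (suppIn_vL_pow_add _ _ 1 (by decide))).add (suppIn_vL_pow_add _ _ 4 (by decide))).add
    (suppIn_vL_pow_add _ _ 6 (by decide))).add (suppIn_vL_pow_add _ _ 9 (by decide))).add
    (suppIn_vL_pow_add _ _ 10 (by decide))).add (suppIn_vL_pow_add _ _ 11 (by decide))

theorem suppIn_tL_div_vL_sub_inv : SuppIn 5 {1, 2, 3, 4} (tL / vL - vL / tL) := by
  have hAB := level_five_product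
  have hD := dilate_five_one_sub_eleven_tL_ne_zero
  have ht := level_ten_relations.1
  change tL * _ = _ at ht
  have hv := vL_ne_zero
  have ht0 := tL_ne_zero
  have h : (1 - 11 * dilate 5 tL - dilate 5 tL ^ 2) * (tL / vL - vL / tL) =
      dilate 5 (-10) * vL ^ 1 + dilate 5 5 * vL ^ 2 + dilate 5 (-35) * vL ^ 3 +
      dilate 5 55 * vL ^ 4 + dilate 5 55 * vL ^ 6 + dilate 5 35 * vL ^ 7 +
      dilate 5 5 * vL ^ 8 + dilate 5 10 * vL ^ 9 := by
    rw [← hAB] at hD ⊢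
    obtain ⟨A, hA⟩ : ∃ A, A = 1 + 3 * vL + 4 * vL ^ 2 + 2 * vL ^ 3 + vL ^ 4 := ⟨_, rfl⟩
    obtain ⟨B, hB⟩ : ∃ B, B = 1 - 2 * vL + 4 * vL ^ 2 - 3 * vL ^ 3 + vL ^ 4 := ⟨_, rfl⟩
    have h1 : A * B * (1 - vL - vL ^ 2) * (tL / vL - vL / tL) =
        (B ^ 2 - A ^ 2) * (1 - vL - vL ^ 2) := by
      rw [← hA, ← hB] at ht
      field_simp
      linear_combination (tL * B + A * vL) * (1 - vL - vL ^ 2) * ht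
    rw [← hA, ← hB, h1, hA, hB]
    simp only [map_neg, map_ofNat]
    ring
  refine suppIn_of_mul_one_sub_eleven ?_
  rw [h]
  refine (((((((suppIn_vL_pow_add _ _ 1 (by decide)).add (suppIn_vL_pow_add _ _ 2 (by decide))).add
    (suppIn_vL_pow_add _ _ 3 (by decide))).add (suppIn_vL_pow_add _ _ 4 (by decide))).add
    (suppIn_vL_pow_add _ _ 6 (by decide))).add (suppIn_vL_pow_add _ _ 7 (by decide))).add
    (suppIn_vL_pow_add _ _ 8 (by decide))).add (suppIn_vL_pow_add _ _ 9 (by decide))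

end LevelFive

/-! ### Relating q, -q, q² and q⁴ -/

section Tower

variable {F : Type*} [Field F] {q x y a b : F}

/-- `R(q ^ 4) = R(q) R(-q) R(q ^ 2)`, from the modular equation of degree two at `q`, `-q` and
`q ^ 2`. -/
theorem tower_mul (ha0 : a ≠ 0) (hxy : x + y ≠ 0)
    (h1 : 1 + q * b * x ≠ 0) (h2 : 1 - q * b * y ≠ 0)
    (hx : a - x ^ 2 = q * x * a ^ 2 * (a + x ^ 2))
    (hy : a - y ^ 2 = -q * y * a ^ 2 * (a + y ^ 2))
    (hb : b - a ^ 2 = q ^ 2 * a * b ^ 2 * (b + a ^ 2)) : b = x * y * a := by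
  have e1 : y - x = q * a ^ 2 * (a + x ^ 2 - x * y + y ^ 2) :=
    mul_left_cancel₀ hxy (by linear_combination hx - hy)
  obtain ⟨c, hc⟩ : ∃ c, c = 1 - q * a ^ 2 * (y - x) := ⟨_, rfl⟩
  have e2 : x * y * c = a := by rw [hc]; linear_combination -hx + x * e1
  have e3 : (1 + q * b * x) * (1 - q * b * y) * (b * c - a ^ 2) = 0 := by
    rw [hc] at e2 ⊢
    linear_combination hb - q * b ^ 2 * e1 - q ^ 2 * b ^ 3 * e2
  have e4 : b * c = a ^ 2 :=
    sub_eq_zero.1 ((mul_eq_zero.1 e3).resolve_left (mul_ne_zero h1 h2))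
  refine mul_left_cancel₀ ha0 ?_
  linear_combination -b * e2 + x * y * e4

variable {κ Y : F}

/-- With `x = R(q)`, `y = R(-q)`, `a = R(q²)`, `b = R(q⁴)`, this is a closed form for the odd part
of `R`. The equations at `q` and `-q` are subtracted, divided by `x + y`, and simplified with `b = x
y a`. -/
theorem tower_sub (ha0 : a ≠ 0) (hq0 : q ≠ 0) (hb0 : b ≠ 0) (hxy : x + y ≠ 0)
    (hκ : κ = q ^ 2 * a * b ^ 2)
    (hx : a - x ^ 2 = q * x * a ^ 2 * (a + x ^ 2))
    (hy : a - y ^ 2 = -q * y * a ^ 2 * (a + y ^ 2))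
    (hb : b - a ^ 2 = κ * (b + a ^ 2)) (hm : b = x * y * a) :
    (x - y) * (a * (1 + κ)) = -2 * q * b ^ 2 := by
  have e1 : y - x = q * a ^ 2 * (a + x ^ 2 - x * y + y ^ 2) :=
    mul_left_cancel₀ hxy (by linear_combination hx - hy)
  have e2 : q * (x - y) * a ^ 2 * b = a ^ 2 - b := by
    have e2' : x * y * (1 - q * a ^ 2 * (y - x)) = a := by linear_combination -hx + x * e1
    refine mul_left_cancel₀ ha0 ?_
    linear_combination (1 + q * a ^ 2 * (x - y)) * a * hm + a ^ 2 * e2'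
  refine mul_left_cancel₀ (mul_ne_zero (mul_ne_zero hq0 ha0) hb0) ?_
  linear_combination (1 + κ) * e2 + (-1) * hb * (1 + κ) + κ * hb - 2 * b * hκ

/-- The consequences of the modular equations that are rational in `κ = k(q ^ 2)` and
`Y = k(q) (1 + κ) + κ`. -/
theorem tower_k (h2 : (2 : F) ≠ 0)
    (hκ : κ = q ^ 2 * a * b ^ 2) (hb : b - a ^ 2 = κ * (b + a ^ 2))
    (hD : (x - y) * (a * (1 + κ)) = -2 * q * b ^ 2) (hY : Y = q * b * (x + y) * (1 - κ) / 2) :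
    q * x * a ^ 2 * (1 + κ) = Y - κ ∧ q * y * a ^ 2 * (1 + κ) = Y + κ := by
  have e : q * a ^ 2 * (1 + κ) = q * b * (1 - κ) := by linear_combination -q * hb
  have e2 : 2 * Y = q * b * (x + y) * (1 - κ) := by rw [hY]; field_simp
  constructor
  · refine mul_left_cancel₀ h2 ?_
    linear_combination q * a * hD - e2 + (x + y) * e + 2 * hκ
  · refine mul_left_cancel₀ h2 ?_
    linear_combination -q * a * hD - e2 + (x + y) * e - 2 * hκ

/-- Multiply the two relations for `Y - κ` and `Y + κ`; in the product `x y` is replaced by `b / a`.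
-/
theorem tower_Y_sq (hκ : κ = q ^ 2 * a * b ^ 2) (hb : b - a ^ 2 = κ * (b + a ^ 2))
    (hm : b = x * y * a)
    (h1 : q * x * a ^ 2 * (1 + κ) = Y - κ) (h2 : q * y * a ^ 2 * (1 + κ) = Y + κ) :
    Y ^ 2 = κ * (1 + κ - κ ^ 2) := by
  linear_combination -(Y + κ) * h1 - q * x * a ^ 2 * (1 + κ) * h2
    - q ^ 2 * a ^ 3 * (1 + κ) ^ 2 * hm - q ^ 2 * a * b * (1 + κ) * hb - (1 - κ ^ 2) * hκ

end Tower

section RationalIdentities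

variable {F : Type*} [Field F] {κ Y k m μ σ Z s : F}

/-- Passage from level four to level two: `κ = k(q ^ 2)`, `μ = m(q ^ 2)`, `σ = s(q ^ 2)`. -/
theorem tower_identities (h20 : (2 : F) ≠ 0) (hY : Y ^ 2 = κ * (1 + κ - κ ^ 2)) (h0 : κ ≠ 0)
    (h1 : 1 + κ ≠ 0) (h2 : 1 - κ ≠ 0) (hk : k = (Y - κ) / (1 + κ)) (h3 : 1 + k ≠ 0)
    (h4 : 1 - k ≠ 0) (hm : m = (1 - k) / (1 + k))
    (hμ : μ = (1 - κ) / (1 + κ)) (hσ : σ = κ / (1 - κ ^ 2)) (hZ : Z = Y / (1 - κ ^ 2))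
    (hs : s = k / (1 - k ^ 2)) :
    (1 / (m * μ) = 1 + 2 * σ + 2 * Z ∧ m * μ = 1 + 2 * σ - 2 * Z) ∧
    (1 / (1 + k) = (σ / κ - Z) / μ ∧ k / (1 - k) = μ * (Z - κ * σ)) ∧
    μ / k - k / μ = (μ + 1 / μ) / 2 + Z / σ - 2 * Z ∧
    s = Z * (μ + 1 / μ) / 2 - σ * (1 + 2 * σ) ∧
    m * μ / k - k / (m * μ) = -(1 + 2 * σ) + Z * (κ + 1 / κ) ∧
    Z ^ 2 = σ + σ ^ 2 ∧ (μ + 1 / μ) ^ 2 = 16 * σ ^ 2 + 4 := by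
  have e1 : 1 + k = (1 + Y) / (1 + κ) := by rw [hk]; field_simp; ring
  have e2 : 1 - k = (1 + 2 * κ - Y) / (1 + κ) := by rw [hk]; field_simp; ring
  have h3' : 1 + Y ≠ 0 := fun h => h3 (by rw [e1, h, zero_div])
  have h4' : 1 + 2 * κ - Y ≠ 0 := fun h => h4 (by rw [e2, h, zero_div])
  have hm' : m = (1 + 2 * κ - Y) / (1 + Y) := by rw [hm, e1, e2]; field_simp
  have h5 : 1 - κ ^ 2 = (1 - κ) * (1 + κ) := by ring
  rw [h5] at hσ hZ
  have hk0 : (Y - κ) * (Y + κ) = κ * (1 - κ) * (1 + κ) := by linear_combination hY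
  have h6 : (Y - κ) * (Y + κ) ≠ 0 := hk0 ▸ mul_ne_zero (mul_ne_zero h0 h2) h1
  have h7 := left_ne_zero_of_mul h6
  have hki : 1 / k = (Y + κ) / (κ * (1 - κ)) := by
    rw [hk, one_div_div, div_eq_div_iff h7 (mul_ne_zero h0 h2)]
    linear_combination -hk0
  have hμi : 1 / μ = (1 + κ) / (1 - κ) := by rw [hμ, one_div_div]
  have i1 : 1 / (m * μ) = 1 + 2 * σ + 2 * Z := by
    rw [hm', hμ, hσ, hZ]
    field_simp
    linear_combination 2 * hY
  have i2 : m * μ = 1 + 2 * σ - 2 * Z := by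
    rw [hm', hμ, hσ, hZ]
    field_simp
    linear_combination 2 * hY
  have i3 : 1 / (1 + k) = (σ / κ - Z) / μ := by
    rw [e1, hμ, hσ, hZ]
    field_simp
    linear_combination hY
  have i4 : k / (1 - k) = μ * (Z - κ * σ) := by
    rw [div_eq_iff h4, hk, hμ, hσ, hZ]
    field_simp
    linear_combination hY
  refine ⟨⟨i1, i2⟩, ⟨i3, i4⟩, ?_, ?_, ?_, ?_, ?_⟩
  · rw [div_eq_mul_one_div μ, div_eq_mul_one_div k, hki, hμi, hk, hμ, hσ, hZ]
    field_simp
    ring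
  · have : s = 1 / (1 + k) * (k / (1 - k)) := by
      rw [hs, show 1 - k ^ 2 = (1 + k) * (1 - k) by ring]; field_simp
    rw [this, i3, i4, hμi, hμ, hσ, hZ]
    field_simp
    linear_combination -2 * hY
  · rw [div_eq_mul_one_div (m * μ), div_eq_mul_one_div k, i1, i2, hki, hk, hσ, hZ]
    field_simp
    linear_combination (-2 - 4 * κ + 2 * κ ^ 2) * hY
  · rw [hZ, hσ, div_pow, hY]
    field_simp
    ring
  · rw [hμi, hμ, hσ]
    field_simp
    ring

end RationalIdentities

/-! ### R(-q), the odd series Z and parity -/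

theorem rescale_neg_one_expand_two (f : ℚ⟦X⟧) :
    rescale (-1 : ℚ) (expand 2 two_ne_zero f) = expand 2 two_ne_zero f := by
  ext n
  rw [coeff_rescale]
  by_cases h : 2 ∣ n
  · rw [((even_iff_two_dvd).2 h).neg_one_pow, one_mul]
  · rw [coeff_expand_of_not_dvd _ _ _ h, mul_zero]

theorem add_rescale_neg_one (f : ℚ⟦X⟧) :
    f + rescale (-1 : ℚ) f = expand 2 two_ne_zero (mk fun n => 2 * coeff (2 * n) f) := by
  ext n
  rw [map_add, coeff_rescale]
  by_cases h : 2 ∣ n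
  · obtain ⟨k, rfl⟩ := h
    rw [coeff_expand_mul, coeff_mk, pow_mul]
    simp [two_mul]
  · rw [coeff_expand_of_not_dvd _ _ _ h,
      (Nat.not_even_iff_odd.1 fun h' => h (even_iff_two_dvd.1 h')).neg_one_pow]
    ring

/-- `R(-q)` as a Laurent series. -/
noncomputable def yL : ℚ⸨X⸩ := ((rescale (-1 : ℚ) series : ℚ⟦X⟧) : ℚ⸨X⸩)

theorem constantCoeff_rescale_series : constantCoeff (rescale (-1 : ℚ) series) = 1 := by
  rw [← coeff_zero_eq_constantCoeff_apply, coeff_rescale, coeff_zero_eq_constantCoeff_apply,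
    constantCoeff_series, pow_zero, one_mul]

theorem yL_ne_zero : yL ≠ 0 :=
  coe_ne_zero_of_constantCoeff (by rw [constantCoeff_rescale_series]; exact one_ne_zero)

theorem rL_add_yL_ne_zero : rL + yL ≠ 0 := by
  rw [rL, yL, ← PowerSeries.coe_add]
  exact coe_ne_zero_of_constantCoeff
    (by rw [map_add, constantCoeff_series, constantCoeff_rescale_series]; norm_num)

theorem rL_add_yL_mem : rL + yL ∈ (dilate 2).fieldRange :=
  ⟨((mk fun n => 2 * coeff (2 * n) series : ℚ⟦X⟧) : ℚ⸨X⸩), by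
    rw [dilate_coe, ← add_rescale_neg_one, PowerSeries.coe_add]; rfl⟩

theorem modular_two_rL : dilate 2 rL - rL ^ 2 =
    qL * rL * dilate 2 rL ^ 2 * (dilate 2 rL + rL ^ 2) := by
  have h := congrArg (fun f : ℚ⟦X⟧ => (f : ℚ⸨X⸩)) series_modular_two
  simp only [PowerSeries.coe_sub, PowerSeries.coe_mul, PowerSeries.coe_pow,
    PowerSeries.coe_add] at h
  rw [← dilate_coe 2] at h
  exact h

theorem modular_two_yL : dilate 2 rL - yL ^ 2 =
    -qL * yL * dilate 2 rL ^ 2 * (dilate 2 rL + yL ^ 2) := by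
  have h := congrArg (fun f : ℚ⟦X⟧ => (rescale (-1 : ℚ) f : ℚ⸨X⸩)) series_modular_two
  simp only [map_sub, map_mul, map_pow, map_add, rescale_neg_one_expand_two, rescale_X,
    map_neg, map_one] at h
  rw [← dilate_coe 2] at h
  change dilate 2 rL - yL ^ 2 = -1 * qL * yL * dilate 2 rL ^ 2 * (dilate 2 rL + yL ^ 2) at h
  linear_combination h

theorem dilate_two_kL : dilate 2 kL = qL ^ 2 * dilate 2 rL * dilate 4 rL ^ 2 := by
  rw [kL]
  simp only [map_mul, map_pow, dilate_qL, dilate_dilate]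

theorem dilate_two_mL : dilate 2 mL = dilate 2 rL ^ 2 / dilate 4 rL := by
  rw [mL]
  simp only [map_div₀, map_pow, dilate_dilate]

theorem modular_two_dilate_rL : dilate 4 rL - dilate 2 rL ^ 2 =
    dilate 2 kL * (dilate 4 rL + dilate 2 rL ^ 2) := by
  have h := congrArg (dilate 2) modular_two_rL
  simp only [map_sub, map_mul, map_pow, map_add, dilate_dilate, dilate_qL] at h
  rw [dilate_two_kL]
  exact h

/-- `R(q ^ 4) = R(q) R(-q) R(q ^ 2)`. -/
theorem dilate_four_rL : dilate 4 rL = rL * yL * dilate 2 rL := by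
  refine tower_mul (q := qL) (dilate_rL_ne_zero 2) rL_add_yL_ne_zero ?_ ?_ modular_two_rL
    modular_two_yL ?_
  · refine one_add_coe_ne_zero (g := X * expand 4 (by norm_num) series * series) ?_ (by simp)
    rw [rL, qL, dilate_coe, PowerSeries.coe_mul, PowerSeries.coe_mul]
  · refine one_add_coe_ne_zero
      (g := -(X * expand 4 (by norm_num) series * rescale (-1 : ℚ) series)) ?_ (by simp)
    rw [rL, yL, qL, dilate_coe, PowerSeries.coe_neg, PowerSeries.coe_mul, PowerSeries.coe_mul]
    ring
  · rw [modular_two_dilate_rL, dilate_two_kL]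

theorem rL_sub_yL :
    (rL - yL) * (dilate 2 rL * (1 + dilate 2 kL)) = -2 * qL * dilate 4 rL ^ 2 :=
  tower_sub (dilate_rL_ne_zero 2) qL_ne_zero (dilate_rL_ne_zero 4) rL_add_yL_ne_zero
    dilate_two_kL modular_two_rL modular_two_yL modular_two_dilate_rL dilate_four_rL

/-- The odd part of `k(q) (1 + k(q ^ 2))`. -/
noncomputable def oddL : ℚ⸨X⸩ := qL * dilate 4 rL * (rL + yL) * (1 - dilate 2 kL) / 2

/-- One half of the odd part of `R(-q) / R(q)`. -/
noncomputable def zL : ℚ⸨X⸩ := oddL / (1 - dilate 2 kL ^ 2)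

theorem kL_mul_eq : kL * (1 + dilate 2 kL) = oddL - dilate 2 kL :=
  (tower_k two_ne_zero_laurent dilate_two_kL modular_two_dilate_rL rL_sub_yL rfl).1

theorem oddL_sq : oddL ^ 2 = dilate 2 kL * (1 + dilate 2 kL - dilate 2 kL ^ 2) := by
  obtain ⟨h1, h2⟩ := tower_k two_ne_zero_laurent dilate_two_kL modular_two_dilate_rL rL_sub_yL
    (Y := oddL) rfl
  exact tower_Y_sq dilate_two_kL modular_two_dilate_rL dilate_four_rL h1 h2

theorem one_add_dilate_kL_ne_zero (n : ℕ) [NeZero n] : 1 + dilate n kL ≠ 0 := by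
  have := (map_ne_zero (dilate n)).2 one_add_kL_ne_zero
  rwa [map_add, map_one] at this

theorem one_sub_dilate_kL_ne_zero (n : ℕ) [NeZero n] : 1 - dilate n kL ≠ 0 := by
  have := (map_ne_zero (dilate n)).2 one_sub_kL_ne_zero
  rwa [map_sub, map_one] at this

theorem level_two_identities :
    (1 / (mL * dilate 2 mL) = 1 + 2 * dilate 2 sL + 2 * zL ∧
      mL * dilate 2 mL = 1 + 2 * dilate 2 sL - 2 * zL) ∧
    (1 / (1 + kL) = (dilate 2 sL / dilate 2 kL - zL) / dilate 2 mL ∧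
      kL / (1 - kL) = dilate 2 mL * (zL - dilate 2 kL * dilate 2 sL)) ∧
    dilate 2 mL / kL - kL / dilate 2 mL =
      (dilate 2 mL + 1 / dilate 2 mL) / 2 + zL / dilate 2 sL - 2 * zL ∧
    sL = zL * (dilate 2 mL + 1 / dilate 2 mL) / 2 - dilate 2 sL * (1 + 2 * dilate 2 sL) ∧
    mL * dilate 2 mL / kL - kL / (mL * dilate 2 mL) =
      -(1 + 2 * dilate 2 sL) + zL * (dilate 2 kL + 1 / dilate 2 kL) ∧
    zL ^ 2 = dilate 2 sL + dilate 2 sL ^ 2 ∧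
    (dilate 2 mL + 1 / dilate 2 mL) ^ 2 = 16 * dilate 2 sL ^ 2 + 4 := by
  refine tower_identities two_ne_zero_laurent oddL_sq ((map_ne_zero _).2 kL_ne_zero)
    (one_add_dilate_kL_ne_zero 2) (one_sub_dilate_kL_ne_zero 2)
    (eq_div_of_mul_eq (one_add_dilate_kL_ne_zero 2) kL_mul_eq) one_add_kL_ne_zero
    one_sub_kL_ne_zero mL_eq ?_ ?_ rfl rfl
  · rw [mL_eq, map_div₀, map_add, map_sub, map_one]
  · rw [sL, map_div₀, map_sub, map_one, map_pow]

/-- Since `M` divides `n m`, the class of `n k` modulo `M` depends only on `k` modulo `m`, which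
reduces the condition to a finite check. -/
theorem SuppIn.dilate_of_natCast {M m n : ℕ} [NeZero n] [NeZero m] {S : Set (ZMod m)}
    {T : Set (ZMod M)} {f : ℚ⸨X⸩} (hf : SuppIn m S f) (hM : M ∣ n * m)
    (h : ∀ a ∈ S, ((n * a.val : ℕ) : ZMod M) ∈ T) :
    SuppIn M T (RogersRamanujanCF.dilate n f) := by
  refine hf.dilate fun k hk => ?_
  have := h _ hk
  convert this using 1
  have h1 : ((k : ZMod m).val : ℤ) = k % m := ZMod.val_intCast k
  have h2 : (n : ℤ) * k = n * (k % m) + (n * m : ℕ) * (k / m) := by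
    push_cast
    rw [mul_assoc, ← mul_add, Int.emod_add_mul_ediv]
  rw [h2, ← h1, Int.cast_add, Int.cast_mul ((n * m : ℕ) : ℤ), Int.cast_natCast (n * m),
    (ZMod.natCast_eq_zero_iff _ _).2 hM, MulZeroClass.zero_mul, add_zero]
  push_cast
  rfl

theorem suppIn_of_mem {f : ℚ⸨X⸩} (h : f ∈ (dilate 2).fieldRange) : SuppIn 2 {0} f := by
  obtain ⟨g, rfl⟩ := h
  exact SuppIn.dilate_zero 2 dvd_rfl g

theorem suppIn_ten_of_mem {f : ℚ⸨X⸩} (h : f ∈ (dilate 2).fieldRange) {T : Set (ZMod 10)}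
    (hT : ∀ a : ZMod 5, ((2 * a.val : ℕ) : ZMod 10) ∈ T) : SuppIn 10 T f := by
  obtain ⟨g, rfl⟩ := h
  exact SuppIn.dilate_of_natCast (m := 5) (S := Set.univ) (fun _ _ => trivial) dvd_rfl
    fun a _ => hT a

theorem dilate_two_mem (f : ℚ⸨X⸩) : dilate 2 f ∈ (dilate 2).fieldRange := ⟨f, rfl⟩

theorem dilate_four_mem (f : ℚ⸨X⸩) : dilate 4 f ∈ (dilate 2).fieldRange :=
  ⟨dilate 2 f, dilate_dilate 2 2 f⟩

theorem qL_sq_mem : qL ^ 2 ∈ (dilate 2).fieldRange := ⟨qL, dilate_qL 2⟩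

theorem suppIn_oddL : SuppIn 2 {1} oddL := by
  have h : dilate 4 rL * (rL + yL) * (1 - dilate 2 kL) / 2 ∈ (dilate 2).fieldRange :=
    div_mem (mul_mem (mul_mem (dilate_four_mem _) rL_add_yL_mem)
      (sub_mem (one_mem _) (dilate_two_mem _))) (ofNat_mem _ 2)
  have := (suppIn_of_mem h).zero_mul (suppIn_qL_zpow 2 1)
  rw [zpow_one, Int.cast_one] at this
  convert this using 1
  rw [oddL]; ring

/-- Both sides have the same square. The sign of the root is left open, because only the support of
`c` is used. -/
theorem exists_zL_eq : ∃ c, SuppIn 2 {1} c ∧ zL = dilate 5 c * dilate 2 psiL := by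
  have h : zL ^ 2 = (dilate 5 oddL * dilate 2 psiL) ^ 2 := by
    rw [level_two_identities.2.2.2.2.2.1, mul_pow, ← map_pow (dilate 5), oddL_sq]
    have h1 := congrArg (dilate 2) sL_add_sq
    simp only [map_add, map_mul, map_pow, map_sub, map_one, dilate_dilate] at h1 ⊢
    exact h1
  rcases sq_eq_sq_iff_eq_or_eq_neg.1 h with h | h
  · exact ⟨oddL, suppIn_oddL, h⟩
  · exact ⟨-oddL, suppIn_oddL.neg, by rw [h, map_neg, neg_mul]⟩

theorem SuppIn.qL_pow_mul {M : ℕ} {S T : Set (ZMod M)} {f : ℚ⸨X⸩} (hf : SuppIn M S f) (i : ℕ)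
    (h : ∀ a ∈ S, (i : ZMod M) + a ∈ T) : SuppIn M T (qL ^ i * f) := by
  have h1 := suppIn_qL_zpow M i
  rw [zpow_natCast, Int.cast_natCast] at h1
  refine (h1.mul hf).mono ?_
  rintro _ ⟨_, rfl, a, ha, rfl⟩
  exact h a ha

theorem SuppIn.qL_mul {M : ℕ} {S T : Set (ZMod M)} {f : ℚ⸨X⸩} (hf : SuppIn M S f)
    (h : ∀ a ∈ S, 1 + a ∈ T) : SuppIn M T (qL * f) := by
  have := hf.qL_pow_mul 1 (T := T) (by rwa [Nat.cast_one])
  rwa [pow_one] at this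

theorem SuppIn.mul_subset {M : ℕ} {S T U : Set (ZMod M)} {f g : ℚ⸨X⸩} (hf : SuppIn M S f)
    (hg : SuppIn M T g) (h : ∀ a ∈ S, ∀ b ∈ T, a + b ∈ U) : SuppIn M U (f * g) :=
  (hf.mul hg).mono (by rintro _ ⟨a, ha, b, hb, rfl⟩; exact h a ha b hb)

theorem SuppIn.fixed_mul {M : ℕ} [NeZero M] {S : Set (ZMod M)} {f : ℚ⸨X⸩} (hf : SuppIn M S f)
    (c : ℚ⸨X⸩) (h : RogersRamanujanCF.dilate M c = c) : SuppIn M S (c * f) := by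
  have := SuppIn.dilate_zero M dvd_rfl c
  rw [h] at this
  exact this.zero_mul hf

theorem mL_mul_dilate_two_mL : mL * dilate 2 mL = rL / yL := by
  have := rL_ne_zero
  have := yL_ne_zero
  have := dilate_rL_ne_zero 2
  rw [dilate_two_mL, dilate_four_rL, mL]
  field_simp

theorem kL_div_dilate_two_mL : kL / dilate 2 mL = qL * rL * dilate 4 rL := by
  have := dilate_rL_ne_zero 2
  have := dilate_rL_ne_zero 4
  rw [dilate_two_mL, kL]
  field_simp

theorem rL_sq_eq : rL ^ 2 = dilate 4 rL / dilate 2 rL * (1 + 2 * dilate 2 sL - 2 * zL) := by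
  have := rL_ne_zero
  have := yL_ne_zero
  have := dilate_rL_ne_zero 2
  rw [← level_two_identities.1.2, mL_mul_dilate_two_mL, dilate_four_rL]
  field_simp

theorem inv_rL_sq_eq :
    (rL ^ 2)⁻¹ = dilate 2 rL / dilate 4 rL * (1 + 2 * dilate 2 sL + 2 * zL) := by
  have := rL_ne_zero
  have := yL_ne_zero
  have := dilate_rL_ne_zero 2
  rw [← level_two_identities.1.1, mL_mul_dilate_two_mL, dilate_four_rL]
  field_simp

theorem dilate_kL_ne_zero (n : ℕ) [NeZero n] : dilate n kL ≠ 0 := (map_ne_zero _).2 kL_ne_zero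

theorem dilate_mL_ne_zero (n : ℕ) [NeZero n] : dilate n mL ≠ 0 := (map_ne_zero _).2 mL_ne_zero

theorem dilate_sL_ne_zero (n : ℕ) [NeZero n] : dilate n sL ≠ 0 := (map_ne_zero _).2 sL_ne_zero

theorem inv_kL_sub : 1 / kL - kL = 1 / sL := by
  have := kL_ne_zero
  have := one_sub_kL_sq_ne_zero
  rw [sL]
  field_simp

/-! ### Supports for all quotients except the sixth and ninth -/

theorem suppIn_lambda_one :
    SuppIn 5 {0, 1, 2} ((rL ^ 5)⁻¹ + qL ^ 2 * ((rL ^ 5)⁻¹)⁻¹) := by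
  have e : (rL ^ 5)⁻¹ + qL ^ 2 * ((rL ^ 5)⁻¹)⁻¹ = qL * (1 / tL + tL) := by
    have := qL_ne_zero
    have := rL_ne_zero
    rw [tL]; field_simp
  rw [e]
  exact suppIn_tL_add_inv.qL_mul (by decide)

theorem suppIn_lambda_two : SuppIn 5 {1, 2, 3, 4}
    (rL ^ 5 * (dilate 5 rL)⁻¹ - qL ^ 0 * (rL ^ 5 * (dilate 5 rL)⁻¹)⁻¹) := by
  have e : rL ^ 5 * (dilate 5 rL)⁻¹ - qL ^ 0 * (rL ^ 5 * (dilate 5 rL)⁻¹)⁻¹ =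
      tL / vL - vL / tL := by
    have := qL_ne_zero
    have := rL_ne_zero
    have := dilate_rL_ne_zero 5
    rw [tL, vL]; field_simp
  rw [e]
  exact suppIn_tL_div_vL_sub_inv

theorem suppIn_lambda_three : SuppIn 5 {0, 2, 3}
    (dilate 2 rL * (rL ^ 2)⁻¹ + qL ^ 0 * (dilate 2 rL * (rL ^ 2)⁻¹)⁻¹) := by
  have e : dilate 2 rL * (rL ^ 2)⁻¹ + qL ^ 0 * (dilate 2 rL * (rL ^ 2)⁻¹)⁻¹ = mL + 1 / mL := by
    have := rL_ne_zero
    have := dilate_rL_ne_zero 2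
    rw [mL]; field_simp; ring
  rw [e]
  exact suppIn_mL_add_inv

theorem suppIn_lambda_four : SuppIn 5 {0, 1, 2}
    ((rL * dilate 2 rL ^ 2)⁻¹ + qL ^ 2 * ((rL * dilate 2 rL ^ 2)⁻¹)⁻¹) := by
  have e : (rL * dilate 2 rL ^ 2)⁻¹ + qL ^ 2 * ((rL * dilate 2 rL ^ 2)⁻¹)⁻¹ =
      qL * (kL + 1 / kL) := by
    have := qL_ne_zero
    have := rL_ne_zero
    have := dilate_rL_ne_zero 2
    rw [kL]; field_simp; ring
  rw [e]
  exact suppIn_kL_add_inv.qL_mul (by decide)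

/-- With `μ = m(q²)` and `σ = s(q²)`, the combination is `q (μ/k - k/μ)`, which is linear in `μ +
1/μ`, `Z/σ` and `Z`. Doubling sends the residues `0, 2, 3` to `0, 4, 1`. -/
theorem suppIn_lambda_five : SuppIn 5 {0, 1, 2}
    ((rL * dilate 4 rL)⁻¹ - qL ^ 2 * ((rL * dilate 4 rL)⁻¹)⁻¹) := by
  obtain ⟨c, -, hz⟩ := exists_zL_eq
  have e : (rL * dilate 4 rL)⁻¹ - qL ^ 2 * ((rL * dilate 4 rL)⁻¹)⁻¹ =
      qL * (2⁻¹ * dilate 2 (mL + 1 / mL) + dilate 5 c * dilate 2 (psiL / sL) -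
        2 * (dilate 5 c * dilate 2 psiL)) := by
    have e1 : qL * (dilate 2 mL / kL - kL / dilate 2 mL) =
        (rL * dilate 4 rL)⁻¹ - qL ^ 2 * ((rL * dilate 4 rL)⁻¹)⁻¹ := by
      have := qL_ne_zero
      have := rL_ne_zero
      have := dilate_rL_ne_zero 4
      rw [← inv_div kL, kL_div_dilate_two_mL]; field_simp
    rw [← e1, level_two_identities.2.2.1, hz]
    simp only [map_add, map_div₀, map_one]
    ring
  have h5 : SuppIn 5 {0} (dilate 5 c) := SuppIn.dilate_zero 5 dvd_rfl c
  rw [e]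
  refine SuppIn.qL_mul (S := {0, 1, 4}) ?_ (by decide)
  refine (SuppIn.add ?_ ?_).sub ?_
  · exact (suppIn_mL_add_inv.dilate_of_natCast (M := 5) (T := {0, 1, 4}) (by decide)
      (by decide)).fixed_mul _ (by rw [map_inv₀, map_ofNat])
  · exact h5.zero_mul (suppIn_psiL_div_sL.dilate_of_natCast (by decide) (by decide))
  · exact (h5.zero_mul (suppIn_psiL.dilate_of_natCast (by decide)
      (by decide))).fixed_mul _ (map_ofNat _ _)

theorem SuppIn.dilate_five_ten {c : ℚ⸨X⸩} (hc : SuppIn 2 {1} c) :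
    SuppIn 10 {5} (RogersRamanujanCF.dilate 5 c) :=
  hc.dilate_of_natCast (by decide) (by decide)

/-- The even part puts no constraint on odd classes. The odd part is a multiple of `Z σ (1 + 2σ)`:
the factor `Y(q⁵)` contributes residue 5, the rest `0, 2, 8`, so `1` and `9` are missed. -/
theorem suppIn_lambda_seven : SuppIn 10 {0, 2, 3, 4, 5, 6, 7, 8}
    (dilate 4 rL * (rL ^ 4)⁻¹ + qL ^ 0 * (dilate 4 rL * (rL ^ 4)⁻¹)⁻¹) := by
  obtain ⟨c, hc, hz⟩ := exists_zL_eq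
  have e : dilate 4 rL * (rL ^ 4)⁻¹ + qL ^ 0 * (dilate 4 rL * (rL ^ 4)⁻¹)⁻¹ =
      dilate 2 ((mL + 1 / mL) * ((1 + 2 * sL) ^ 2 + 4 * (sL + sL ^ 2))) -
        16 * (dilate 5 c * dilate 2 (psiL * sL + 2 * (psiL * sL ^ 2))) := by
    have h1 := congrArg (dilate 2) inv_sub_mL
    simp only [map_sub, map_div₀, map_one, map_mul, map_ofNat] at h1
    have hz2 := level_two_identities.2.2.2.2.2.1
    have e1 : dilate 4 rL * (rL ^ 4)⁻¹ + qL ^ 0 * (dilate 4 rL * (rL ^ 4)⁻¹)⁻¹ =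
        dilate 4 rL * ((rL ^ 2)⁻¹) ^ 2 + (rL ^ 2) ^ 2 / dilate 4 rL := by
      have := rL_ne_zero
      have := dilate_rL_ne_zero 4
      field_simp
    have e2 : dilate 4 rL * ((rL ^ 2)⁻¹) ^ 2 + (rL ^ 2) ^ 2 / dilate 4 rL =
        dilate 2 mL * (1 + 2 * dilate 2 sL + 2 * zL) ^ 2 +
        1 / dilate 2 mL * (1 + 2 * dilate 2 sL - 2 * zL) ^ 2 := by
      have := dilate_rL_ne_zero 2
      have := dilate_rL_ne_zero 4
      rw [inv_rL_sq_eq, rL_sq_eq, dilate_two_mL]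
      field_simp
    rw [e1, e2]
    have e3 : 16 * (dilate 5 c * dilate 2 (psiL * sL + 2 * (psiL * sL ^ 2))) =
        16 * zL * (dilate 2 sL * (1 + 2 * dilate 2 sL)) := by
      rw [hz]; simp only [map_add, map_mul, map_pow, map_ofNat]; ring
    rw [e3]
    simp only [map_add, map_mul, map_pow, map_ofNat, map_div₀, map_one]
    linear_combination 4 * (dilate 2 mL + 1 / dilate 2 mL) * hz2 -
      4 * zL * (1 + 2 * dilate 2 sL) * h1
  rw [e]
  refine (suppIn_ten_of_mem (dilate_two_mem _) (by decide)).sub ?_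
  refine SuppIn.fixed_mul ?_ _ (map_ofNat _ _)
  refine hc.dilate_five_ten.mul_subset (T := {0, 2, 8}) ?_ (by decide)
  exact SuppIn.dilate_of_natCast (suppIn_psiL_mul_sL.add
    (suppIn_psiL_mul_sL_sq.fixed_mul 2 (map_ofNat _ _))) (by decide) (by decide)

/-- The odd part collapses to a multiple of `q² Z / σ` because `1/κ - κ = 1/σ`; its residues are `7,
1, 3`. -/
theorem suppIn_lambda_eight : SuppIn 10 {0, 1, 2, 3, 4, 6, 7, 8}
    (rL ^ 2 * (dilate 4 rL ^ 3)⁻¹ + qL ^ 4 * (rL ^ 2 * (dilate 4 rL ^ 3)⁻¹)⁻¹) := by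
  obtain ⟨c, hc, hz⟩ := exists_zL_eq
  have e : rL ^ 2 * (dilate 4 rL ^ 3)⁻¹ + qL ^ 4 * (rL ^ 2 * (dilate 4 rL ^ 3)⁻¹)⁻¹ =
      dilate 2 (qL * (1 + 2 * sL) * (1 / kL + kL)) -
        2 * (qL ^ 2 * (dilate 5 c * dilate 2 (psiL / sL))) := by
    have h1 := congrArg (dilate 2) inv_kL_sub
    simp only [map_sub, map_div₀, map_one] at h1
    have e2 : rL ^ 2 * (dilate 4 rL ^ 3)⁻¹ + qL ^ 4 * (rL ^ 2 * (dilate 4 rL ^ 3)⁻¹)⁻¹ =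
        qL ^ 2 * (1 / dilate 2 kL * (1 + 2 * dilate 2 sL - 2 * zL) +
          dilate 2 kL * (1 + 2 * dilate 2 sL + 2 * zL)) := by
      have := dilate_rL_ne_zero 2
      have := dilate_rL_ne_zero 4
      have := qL_ne_zero
      rw [mul_inv, inv_inv, inv_rL_sq_eq, rL_sq_eq, dilate_two_kL]
      field_simp
    have e3 : dilate 5 c * dilate 2 (psiL / sL) = zL * (1 / dilate 2 sL) := by
      rw [hz, map_div₀]; ring
    rw [e2, e3, ← h1]
    simp only [map_add, map_mul, map_ofNat, map_div₀, map_one, dilate_qL]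
    ring
  rw [e]
  refine (suppIn_ten_of_mem (dilate_two_mem _) (by decide)).sub ?_
  refine SuppIn.fixed_mul ?_ _ (map_ofNat _ _)
  refine SuppIn.qL_pow_mul (S := {1, 5, 9}) ?_ 2 (by decide)
  refine hc.dilate_five_ten.mul_subset (T := {0, 4, 6}) ?_ (by decide)
  exact suppIn_psiL_div_sL.dilate_of_natCast (by decide) (by decide)

theorem series_ten_eq :
    dilate 4 rL * (rL ^ 2 * dilate 2 rL)⁻¹ = 1 + 2 * dilate 2 sL + 2 * zL ∧
    (dilate 4 rL * (rL ^ 2 * dilate 2 rL)⁻¹)⁻¹ = 1 + 2 * dilate 2 sL - 2 * zL := by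
  have := rL_ne_zero
  have := dilate_rL_ne_zero 2
  have := dilate_rL_ne_zero 4
  rw [← level_two_identities.1.2, ← level_two_identities.1.1, dilate_two_mL, mL]
  constructor <;> field_simp

theorem suppIn_zL : SuppIn 2 {1} zL := by
  have h : (1 - dilate 2 kL ^ 2)⁻¹ ∈ (dilate 2).fieldRange :=
    inv_mem (sub_mem (one_mem _) (pow_mem (dilate_two_mem _) 2))
  have := (suppIn_of_mem h).zero_mul suppIn_oddL
  convert this using 1
  rw [zL]; ring

theorem suppIn_lambda_ten_odd : SuppIn 2 {1} (dilate 4 rL * (rL ^ 2 * dilate 2 rL)⁻¹ -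
    qL ^ 0 * (dilate 4 rL * (rL ^ 2 * dilate 2 rL)⁻¹)⁻¹) := by
  rw [series_ten_eq.2, series_ten_eq.1]
  have : 1 + 2 * dilate 2 sL + 2 * zL - qL ^ 0 * (1 + 2 * dilate 2 sL - 2 * zL) = 4 * zL := by ring
  rw [this]
  exact suppIn_zL.fixed_mul 4 (map_ofNat _ _)

theorem suppIn_lambda_ten_even : SuppIn 2 {0} (dilate 4 rL * (rL ^ 2 * dilate 2 rL)⁻¹ +
    qL ^ 0 * (dilate 4 rL * (rL ^ 2 * dilate 2 rL)⁻¹)⁻¹) := by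
  rw [series_ten_eq.2, series_ten_eq.1]
  have : 1 + 2 * dilate 2 sL + 2 * zL + qL ^ 0 * (1 + 2 * dilate 2 sL - 2 * zL) =
    dilate 2 (2 + 4 * sL) := by simp only [map_add, map_mul, map_ofNat]; ring
  rw [this]
  exact suppIn_of_mem (dilate_two_mem _)

theorem suppIn_lambda_ten_mod_five : SuppIn 5 {0, 1, 4} (dilate 4 rL * (rL ^ 2 * dilate 2 rL)⁻¹ -
    qL ^ 0 * (dilate 4 rL * (rL ^ 2 * dilate 2 rL)⁻¹)⁻¹) := by
  obtain ⟨c, -, hz⟩ := exists_zL_eq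
  rw [series_ten_eq.2, series_ten_eq.1]
  have : 1 + 2 * dilate 2 sL + 2 * zL - qL ^ 0 * (1 + 2 * dilate 2 sL - 2 * zL) = 4 * zL := by ring
  rw [this, hz]
  exact ((SuppIn.dilate_zero 5 dvd_rfl c).zero_mul
    (suppIn_psiL.dilate_of_natCast (by decide) (by decide))).fixed_mul 4 (map_ofNat _ _)

/-! ### Odd parts of the sixth and ninth quotients -/

instance : CharZero ℚ⸨X⸩ := algebraRat.charZero _

/-- The combination of `R` at `q ^ (1 / 2)`, `q` and further arguments occurring in the odd parts
of the quotients with argument `q ^ 4` and `q ^ 16`. -/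
noncomputable def gL (θ : ℚ⸨X⸩) : ℚ⸨X⸩ := θ / (1 + kL) + kL / (1 - kL) / θ

/-- The descent step: `1/(1 + k)` and `k/(1 - k)` are both linear in `Z` over series in `q²`, with
factors `1/μ` and `μ` that the argument `ρ μ` absorbs. -/
theorem gL_mul_dilate_two_mL (ρ : ℚ⸨X⸩) : gL (ρ * dilate 2 mL) =
    dilate 2 sL * (ρ / dilate 2 kL - dilate 2 kL / ρ) + zL * (1 / ρ - ρ) := by
  have := dilate_mL_ne_zero 2
  have := dilate_kL_ne_zero 2
  rw [gL, div_eq_mul_one_div (ρ * _), level_two_identities.2.1.1, level_two_identities.2.1.2]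
  field_simp
  ring

theorem sL_mul_sub : sL * (dilate 2 mL / kL - kL / dilate 2 mL) =
    dilate 2 ((mL + 1 / mL) * (1 + 2 * sL) / 2 - 2 * ((sL + sL ^ 2) * (mL + 1 / mL))) +
      8 * zL * dilate 2 (sL ^ 2) := by
  obtain ⟨-, -, h1, h2, -, h3, h4⟩ := level_two_identities
  rw [h1]
  simp only [map_sub, map_add, map_mul, map_div₀, map_pow, map_one, map_ofNat]
  obtain ⟨σ, hσ⟩ : ∃ σ, σ = dilate 2 sL := ⟨_, rfl⟩
  obtain ⟨M, hM⟩ : ∃ M, M = dilate 2 mL + 1 / dilate 2 mL := ⟨_, rfl⟩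
  have hσ0 : σ ≠ 0 := hσ ▸ dilate_sL_ne_zero 2
  rw [← hσ, ← hM] at h2 h4
  rw [← hσ] at h3
  have h5 : zL ^ 2 / σ = 1 + σ := by rw [h3]; field_simp
  have h6 : σ * (zL / σ) = zL := mul_div_cancel₀ _ hσ0
  rw [← hM, ← hσ, h2]
  linear_combination zL / 4 * h4 - M * h3 + M / 2 * h5 - (1 + 2 * σ) * h6

theorem sL_mul_zL : sL * zL = dilate 2 ((sL + sL ^ 2) * (mL + 1 / mL)) / 2 -
      zL * dilate 2 (sL * (1 + 2 * sL)) := by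
  obtain ⟨-, -, -, h2, -, h3, -⟩ := level_two_identities
  simp only [map_add, map_mul, map_div₀, map_pow, map_one, map_ofNat]
  linear_combination zL * h2 + (dilate 2 mL + 1 / dilate 2 mL) / 2 * h3

/-- Repeated descent leaves only series in `q⁸` and the factors `Z(q²)`, `Z(q⁴)`. Each product is
then covered by one of the supports modulo 5. -/
theorem dilate_two_gL_six : dilate 2 (gL (dilate 2 (mL * dilate 2 mL))) =
    dilate 8 ((mL + 1 / mL) * (1 + 2 * sL) / 2 - 2 * ((sL + sL ^ 2) * (mL + 1 / mL))) +
      8 * (dilate 4 zL * dilate 8 (sL ^ 2)) + 4 * (dilate 2 zL * dilate 8 sL) := by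
  have e : gL (dilate 2 (mL * dilate 2 mL)) =
      dilate 2 (sL * (dilate 2 mL / kL - kL / dilate 2 mL)) +
        zL * dilate 4 (1 / mL - mL) := by
    rw [map_mul, mul_comm, gL_mul_dilate_two_mL]
    simp only [map_mul, map_sub, map_div₀, map_one, dilate_dilate]
  rw [e, sL_mul_sub, inv_sub_mL]
  simp only [map_add, map_mul, map_ofNat, dilate_dilate]
  norm_num
  ring

theorem dilate_two_gL_nine : dilate 2 (gL (dilate 2 (kL / dilate 2 mL))) =
    dilate 8 (2 * ((sL + sL ^ 2) * (mL + 1 / mL))) -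
      4 * (dilate 4 zL * dilate 8 (sL * (1 + 2 * sL))) -
      dilate 2 zL * dilate 8 (1 + 2 * sL) +
      dilate 2 zL * (dilate 4 zL * dilate 8 (kL + 1 / kL)) := by
  have e : gL (dilate 2 (kL / dilate 2 mL)) =
      dilate 2 (sL * (1 / (mL * dilate 2 mL) - mL * dilate 2 mL)) +
        zL * dilate 2 (mL * dilate 2 mL / kL - kL / (mL * dilate 2 mL)) := by
    have h1 : dilate 2 (kL / dilate 2 mL) =
        dilate 2 (kL / (mL * dilate 2 mL)) * dilate 2 mL := by
      rw [← map_mul]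
      congr 1
      have := mL_ne_zero
      have := dilate_mL_ne_zero 2
      field_simp
    have := dilate_mL_ne_zero 2
    have := dilate_mL_ne_zero 4
    have := dilate_kL_ne_zero 2
    rw [h1, gL_mul_dilate_two_mL]
    simp only [map_mul, map_sub, map_div₀, map_one, dilate_dilate]
    field_simp
  have e2 : sL * (1 / (mL * dilate 2 mL) - mL * dilate 2 mL) =
      dilate 2 (2 * ((sL + sL ^ 2) * (mL + 1 / mL))) -
        4 * (zL * dilate 2 (sL * (1 + 2 * sL))) := by
    rw [level_two_identities.1.1, level_two_identities.1.2, map_mul (dilate 2) 2, map_ofNat]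
    linear_combination 4 * sL_mul_zL
  have e3 : mL * dilate 2 mL / kL - kL / (mL * dilate 2 mL) =
      -dilate 2 (1 + 2 * sL) + zL * dilate 2 (kL + 1 / kL) := by
    rw [level_two_identities.2.2.2.2.1]
    simp only [map_add, map_mul, map_ofNat, map_one, map_div₀]
  rw [e, e2, e3]
  simp only [map_add, map_sub, map_neg, map_mul, map_ofNat, map_one, map_div₀, dilate_dilate]
  norm_num
  ring

/-- `Z(q²)` carries `ψ(q⁴)`; since `ψ` is `a(q²)` up to a series in `q⁵`, it can be read as a series
in `q⁸` like the other factors. -/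
theorem dilate_four_psiL : dilate 4 psiL =
    dilate 20 (1 - 4 * kL - kL ^ 2)⁻¹ * dilate 8 aL := by
  have h : psiL = dilate 5 (1 - 4 * kL - kL ^ 2)⁻¹ * dilate 2 aL := by
    rw [psiL, dilate_two_aL]
    simp only [map_inv₀, map_sub, map_mul, map_pow, map_one, map_ofNat]
    ring
  rw [h, map_mul, dilate_dilate, dilate_dilate]

theorem exists_dilate_two_zL : ∃ c, SuppIn 10 {0} c ∧ dilate 2 zL = c * dilate 8 aL := by
  obtain ⟨c, -, hz⟩ := exists_zL_eq
  refine ⟨dilate 10 c * dilate 20 (1 - 4 * kL - kL ^ 2)⁻¹,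
    (SuppIn.dilate_zero 10 dvd_rfl _).zero_mul (SuppIn.dilate_zero 20 (by decide) _), ?_⟩
  rw [hz, map_mul, dilate_dilate, dilate_dilate, mul_assoc, ← dilate_four_psiL]

theorem exists_dilate_four_zL : ∃ c, SuppIn 10 {0} c ∧ dilate 4 zL = c * dilate 8 psiL := by
  obtain ⟨c, -, hz⟩ := exists_zL_eq
  refine ⟨dilate 20 c, SuppIn.dilate_zero 20 (by decide) _, ?_⟩
  rw [hz, map_mul, dilate_dilate, dilate_dilate]

theorem suppIn_dilate_eight {f : ℚ⸨X⸩} (hf : SuppIn 5 {0, 1, 4} f) :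
    SuppIn 10 {0, 2, 8} (dilate 8 f) :=
  hf.dilate_of_natCast (by decide) (by decide)

theorem suppIn_dilate_two_zL_mul {f : ℚ⸨X⸩} (hf : SuppIn 5 {0, 1, 4} (aL * f)) :
    SuppIn 10 {0, 2, 8} (dilate 2 zL * dilate 8 f) := by
  obtain ⟨c, hc, hz⟩ := exists_dilate_two_zL
  rw [hz, mul_assoc, ← map_mul]
  exact hc.zero_mul (suppIn_dilate_eight hf)

theorem suppIn_dilate_four_zL_mul {f : ℚ⸨X⸩} (hf : SuppIn 5 {0, 1, 4} (psiL * f)) :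
    SuppIn 10 {0, 2, 8} (dilate 4 zL * dilate 8 f) := by
  obtain ⟨c, hc, hz⟩ := exists_dilate_four_zL
  rw [hz, mul_assoc, ← map_mul]
  exact hc.zero_mul (suppIn_dilate_eight hf)

theorem suppIn_gL_six : SuppIn 10 {0, 2, 8} (dilate 2 (gL (dilate 2 (mL * dilate 2 mL)))) := by
  rw [dilate_two_gL_six]
  refine ((suppIn_dilate_eight ?_).add ?_).add ?_
  · refine SuppIn.sub ?_ (suppIn_sL_add_sq_mul.fixed_mul _ (map_ofNat _ _))
    rw [div_eq_inv_mul]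
    exact suppIn_mL_add_inv_mul.fixed_mul _ (by rw [map_inv₀, map_ofNat])
  · exact (suppIn_dilate_four_zL_mul suppIn_psiL_mul_sL_sq).fixed_mul _ (map_ofNat _ _)
  · exact (suppIn_dilate_two_zL_mul suppIn_aL_mul_sL).fixed_mul _ (map_ofNat _ _)

theorem suppIn_gL_nine : SuppIn 10 {0, 2, 8} (dilate 2 (gL (dilate 2 (kL / dilate 2 mL)))) := by
  rw [dilate_two_gL_nine]
  refine (((suppIn_dilate_eight ?_).sub ?_).sub ?_).add ?_
  · exact suppIn_sL_add_sq_mul.fixed_mul _ (map_ofNat _ _)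
  · refine (suppIn_dilate_four_zL_mul ?_).fixed_mul _ (map_ofNat _ _)
    rw [show psiL * (sL * (1 + 2 * sL)) = psiL * sL + 2 * (psiL * sL ^ 2) by ring]
    exact suppIn_psiL_mul_sL.add (suppIn_psiL_mul_sL_sq.fixed_mul _ (map_ofNat _ _))
  · refine suppIn_dilate_two_zL_mul ?_
    rw [show aL * (1 + 2 * sL) = aL + 2 * (aL * sL) by ring]
    exact suppIn_aL.add (suppIn_aL_mul_sL.fixed_mul _ (map_ofNat _ _))
  · obtain ⟨c, hc, hz⟩ := exists_dilate_four_zL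
    rw [hz, mul_assoc c, ← map_mul, mul_left_comm]
    refine hc.zero_mul (suppIn_dilate_two_zL_mul ?_)
    rw [← mul_assoc]
    exact suppIn_aL_mul_psiL_mul

theorem dilate_two_gL (θ : ℚ⸨X⸩) : dilate 2 (gL θ) =
    dilate 2 θ / (1 + dilate 2 kL) + dilate 2 kL / (1 - dilate 2 kL) / dilate 2 θ := by
  simp only [gL, map_add, map_sub, map_div₀, map_one]

theorem rL_sub_yL_eq :
    rL - yL = -2 * qL * dilate 4 rL ^ 2 / (dilate 2 rL * (1 + dilate 2 kL)) :=
  eq_div_of_mul_eq (mul_ne_zero (dilate_rL_ne_zero 2) (one_add_dilate_kL_ne_zero 2)) rL_sub_yL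

/-- `q² R(q⁴)³ / R(q²) = k(q²) (1 + k(q²)) / (1 - k(q²))`. -/
theorem dilate_two_kL_div :
    dilate 2 kL / (1 - dilate 2 kL) =
      qL ^ 2 * dilate 4 rL ^ 3 / (dilate 2 rL * (1 + dilate 2 kL)) := by
  have h := modular_two_dilate_rL
  rw [div_eq_div_iff (one_sub_dilate_kL_ne_zero 2)
    (mul_ne_zero (dilate_rL_ne_zero 2) (one_add_dilate_kL_ne_zero 2))]
  linear_combination (dilate 2 rL * (1 + dilate 2 kL)) * dilate_two_kL -
    qL ^ 2 * dilate 4 rL ^ 2 * h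

/-- Replacing `1/R(-q)` by `R(q) R(q²)/R(q⁴)` makes the combination linear in `R(q)` and `R(-q)`
over even series. The part with `R(q) + R(-q)` is even; the part with `R(q) - R(-q)` is `-q` times a
value of `gL` at `q²`, with residues `1, 3, 9`. The ninth quotient is split likewise, with `q³` in
place of `q`. -/
theorem suppIn_lambda_six : SuppIn 10 {0, 1, 2, 3, 4, 6, 8, 9}
    ((yL * dilate 4 yL)⁻¹ - qL ^ 2 * ((yL * dilate 4 yL)⁻¹)⁻¹) := by
  have hy4 : dilate 4 yL ≠ 0 := (map_ne_zero _).2 yL_ne_zero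
  have e : (yL * dilate 4 yL)⁻¹ - qL ^ 2 * ((yL * dilate 4 yL)⁻¹)⁻¹ =
      (rL + yL) * (dilate 2 rL / (dilate 4 rL * dilate 4 yL) - qL ^ 2 * dilate 4 yL) / 2 -
        qL * dilate 2 (gL (dilate 2 (mL * dilate 2 mL))) := by
    have h1 : (yL * dilate 4 yL)⁻¹ - qL ^ 2 * ((yL * dilate 4 yL)⁻¹)⁻¹ =
        (rL + yL) * (dilate 2 rL / (dilate 4 rL * dilate 4 yL) - qL ^ 2 * dilate 4 yL) / 2 +
        (rL - yL) * (dilate 2 rL / (dilate 4 rL * dilate 4 yL) + qL ^ 2 * dilate 4 yL) / 2 := by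
      have := rL_ne_zero
      have := yL_ne_zero
      have := dilate_rL_ne_zero 2
      have := two_ne_zero_laurent
      rw [dilate_four_rL]
      field_simp
      ring
    have h2 : dilate 2 (dilate 2 (mL * dilate 2 mL)) = dilate 4 rL / dilate 4 yL := by
      rw [mL_mul_dilate_two_mL, dilate_dilate, map_div₀]
    have := dilate_rL_ne_zero 2
    have := dilate_rL_ne_zero 4
    have := one_add_dilate_kL_ne_zero 2
    have := two_ne_zero_laurent
    rw [h1, dilate_two_gL, h2, dilate_two_kL_div, rL_sub_yL_eq, sub_eq_add_neg _ (qL * _)]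
    congr 1
    field_simp
  rw [e]
  refine (suppIn_ten_of_mem ?_ (by decide)).sub ?_
  · exact div_mem (mul_mem rL_add_yL_mem (sub_mem (div_mem (dilate_two_mem _)
      (mul_mem (dilate_four_mem _) (dilate_four_mem _)))
      (mul_mem qL_sq_mem (dilate_four_mem _)))) (ofNat_mem _ 2)
  · exact suppIn_gL_six.qL_mul (by decide)

theorem dilate_sixteen_mem (f : ℚ⸨X⸩) : dilate 16 f ∈ (dilate 2).fieldRange :=
  ⟨dilate 8 f, dilate_dilate 2 8 f⟩

theorem suppIn_lambda_nine : SuppIn 10 {0, 1, 2, 3, 4, 5, 6, 8}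
    (rL * (dilate 16 rL)⁻¹ - qL ^ 6 * (rL * (dilate 16 rL)⁻¹)⁻¹) := by
  have e : rL * (dilate 16 rL)⁻¹ - qL ^ 6 * (rL * (dilate 16 rL)⁻¹)⁻¹ =
      (rL + yL) * (1 / dilate 16 rL -
        (qL ^ 2) ^ 3 * dilate 16 rL * dilate 2 rL / dilate 4 rL) / 2 -
        qL ^ 3 * dilate 2 (gL (dilate 2 (kL / dilate 2 mL))) := by
    have h1 : rL * (dilate 16 rL)⁻¹ - qL ^ 6 * (rL * (dilate 16 rL)⁻¹)⁻¹ =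
        (rL + yL) * (1 / dilate 16 rL -
          (qL ^ 2) ^ 3 * dilate 16 rL * dilate 2 rL / dilate 4 rL) / 2 +
        (rL - yL) * (1 / dilate 16 rL +
          (qL ^ 2) ^ 3 * dilate 16 rL * dilate 2 rL / dilate 4 rL) / 2 := by
      have := rL_ne_zero
      have := yL_ne_zero
      have := dilate_rL_ne_zero 2
      have := dilate_rL_ne_zero 16
      have := two_ne_zero_laurent
      rw [dilate_four_rL]
      field_simp
      ring
    have h2 : dilate 2 (dilate 2 (kL / dilate 2 mL)) = qL ^ 4 * dilate 4 rL * dilate 16 rL := by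
      rw [kL_div_dilate_two_mL, dilate_dilate, map_mul, map_mul, dilate_qL, dilate_dilate]
    have := dilate_rL_ne_zero 2
    have := dilate_rL_ne_zero 4
    have := dilate_rL_ne_zero 16
    have := qL_ne_zero
    have := one_add_dilate_kL_ne_zero 2
    have := two_ne_zero_laurent
    rw [h1, dilate_two_gL, h2, dilate_two_kL_div, rL_sub_yL_eq, sub_eq_add_neg _ (qL ^ 3 * _)]
    congr 1
    field_simp
    ring
  rw [e]
  refine (suppIn_ten_of_mem ?_ (by decide)).sub ?_
  · exact div_mem (mul_mem rL_add_yL_mem (sub_mem (div_mem (one_mem _) (dilate_sixteen_mem _))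
      (div_mem (mul_mem (mul_mem (pow_mem qL_sq_mem 3) (dilate_sixteen_mem _))
      (dilate_two_mem _)) (dilate_four_mem _)))) (ofNat_mem _ 2)
  · exact suppIn_gL_nine.qL_pow_mul 3 (by decide)

/-! ### From supports to coefficients -/

theorem R_X_pow (n : ℕ) (hn : n ≠ 0) : R (X ^ n) = expand n hn series := by
  rw [R, expand_apply]

@[simp]
theorem coe_R_X : ((R X : ℚ⟦X⟧) : ℚ⸨X⸩) = rL := by
  have := R_X_pow 1 one_ne_zero
  rw [pow_one] at this
  rw [this, expand_one, rL]
  rfl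

@[simp]
theorem coe_R_X_pow (n : ℕ) [NeZero n] : ((R (X ^ n) : ℚ⟦X⟧) : ℚ⸨X⸩) = dilate n rL := by
  rw [R_X_pow n (NeZero.ne n), rL, dilate_coe]

theorem R_neg_X : R (-X) = rescale (-1 : ℚ) series := by
  rw [R, rescale_eq_subst, neg_one_smul]

@[simp]
theorem coe_R_neg_X : ((R (-X) : ℚ⟦X⟧) : ℚ⸨X⸩) = yL := by
  rw [R_neg_X, yL]

@[simp]
theorem coe_R_neg_X_pow (n : ℕ) [NeZero n] :
    ((R (-(X ^ n)) : ℚ⟦X⟧) : ℚ⸨X⸩) = dilate n yL := by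
  have hX : HasSubst (-X : ℚ⟦X⟧) := HasSubst.of_constantCoeff_zero' (by simp)
  have hn : HasSubst (X ^ n : ℚ⟦X⟧) :=
    HasSubst.of_constantCoeff_zero' (by simp [NeZero.ne n])
  have h : R (-(X ^ n)) = expand n (NeZero.ne n) (R (-X)) := by
    rw [expand_apply, R, R, subst_comp_subst_apply hX hn]
    congr 1
    rw [← coe_substAlgHom hn, map_neg, coe_substAlgHom hn, subst_X hn]
  rw [h, ← dilate_coe, coe_R_neg_X]

@[simp]
theorem coe_inv_of_constantCoeff {f : ℚ⟦X⟧} (h : constantCoeff f ≠ 0) :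
    ((f⁻¹ : ℚ⟦X⟧) : ℚ⸨X⸩) = (f : ℚ⸨X⸩)⁻¹ := by
  refine eq_inv_of_mul_eq_one_left ?_
  rw [← PowerSeries.coe_mul, PowerSeries.inv_mul_cancel _ h, PowerSeries.coe_one]

theorem coeff_qL_pow_mul {f : ℚ⟦X⟧} {c n : ℕ} (h : c ≤ n) :
    (qL ^ c * (f : ℚ⸨X⸩)).coeff n = coeff (n - c) f := by
  rw [qL, ← PowerSeries.coe_pow, ← PowerSeries.coe_mul, LaurentSeries.coeff_coe_powerSeries,
    coeff_X_pow_mul', if_pos h]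

section Extraction

variable {l l' : ℕ → ℚ} {f : ℚ⟦X⟧} {g : ℚ⸨X⸩} {M : ℕ} {T : Set (ZMod M)} {c n : ℕ}

/-- The factor `qL ^ c` realises the index shift; `c ≤ n` ensures that `n - c` is not truncated. -/
theorem coeff_mk_inv (hl : mk l = f) (hl' : mk l' = (mk l)⁻¹) (hf : constantCoeff f ≠ 0)
    (hg : (f : ℚ⸨X⸩) = g) (h : c ≤ n) :
    g.coeff n = l n ∧ (qL ^ c * g⁻¹).coeff n = l' (n - c) := by
  constructor
  · rw [← hg, ← hl, LaurentSeries.coeff_coe_powerSeries, coeff_mk]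
  · rw [← hg, ← coe_inv_of_constantCoeff hf, ← hl, ← hl', coeff_qL_pow_mul h, coeff_mk]

theorem eq_neg_of_suppIn (hl : mk l = f) (hl' : mk l' = (mk l)⁻¹) (hf : constantCoeff f ≠ 0)
    (hg : (f : ℚ⸨X⸩) = g) (hT : SuppIn M T (g + qL ^ c * g⁻¹)) (h : c ≤ n)
    (hn : (n : ZMod M) ∉ T) : l n = -l' (n - c) := by
  obtain ⟨h1, h2⟩ := coeff_mk_inv hl hl' hf hg h
  by_contra h0
  have h3 := hT n fun h3 => h0 (by
    rw [HahnSeries.coeff_add, h1, h2] at h3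
    linarith)
  exact hn (by rwa [Int.cast_natCast] at h3)

theorem eq_of_suppIn (hl : mk l = f) (hl' : mk l' = (mk l)⁻¹) (hf : constantCoeff f ≠ 0)
    (hg : (f : ℚ⸨X⸩) = g) (hT : SuppIn M T (g - qL ^ c * g⁻¹)) (h : c ≤ n)
    (hn : (n : ZMod M) ∉ T) : l n = l' (n - c) := by
  obtain ⟨h1, h2⟩ := coeff_mk_inv hl hl' hf hg h
  by_contra h0
  have h3 := hT n fun h3 => h0 (by
    rw [HahnSeries.coeff_sub, h1, h2] at h3
    linarith)
  exact hn (by rwa [Int.cast_natCast] at h3)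

end Extraction

theorem natCast_mul_add_notMem {M : ℕ} {T : Set (ZMod M)} {r : ℕ} (n : ℕ)
    (h : (r : ZMod M) ∉ T) : ((M * n + r : ℕ) : ZMod M) ∉ T := by
  rwa [Nat.cast_add, Nat.cast_mul, ZMod.natCast_self, zero_mul, zero_add]

@[simp]
theorem constantCoeff_R_X : constantCoeff (R X) = 1 :=
  constantCoeff_R PowerSeries.constantCoeff_X

@[simp]
theorem constantCoeff_R_X_pow (n : ℕ) (hn : n ≠ 0) : constantCoeff (R (X ^ n)) = 1 :=
  constantCoeff_R (by simp [hn])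

@[simp]
theorem constantCoeff_R_neg_X : constantCoeff (R (-X)) = 1 :=
  constantCoeff_R (by simp)

@[simp]
theorem constantCoeff_R_neg_X_pow (n : ℕ) (hn : n ≠ 0) : constantCoeff (R (-(X ^ n))) = 1 :=
  constantCoeff_R (by simp [hn])

end RogersRamanujanCF

theorem theorem1p4
    -- `lk` is the sequence `λ_k`, and `lk'` is the sequence `λ_k′`
    (l1 l2 l3 l4 l5 l6 l7 l8 l9 l10 : ℕ → ℚ)
    (l1' l2' l3' l4' l5' l6' l7' l8' l9' l10' : ℕ → ℚ)
    (h1 : PowerSeries.mk l1 = (R X ^ 5)⁻¹)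
    (h2 : PowerSeries.mk l2 = R X ^ 5 * (R (X ^ 5))⁻¹)
    (h3 : PowerSeries.mk l3 = R (X ^ 2) * (R X ^ 2)⁻¹)
    (h4 : PowerSeries.mk l4 = (R X * R (X ^ 2) ^ 2)⁻¹)
    (h5 : PowerSeries.mk l5 = (R X * R (X ^ 4))⁻¹)
    (h6 : PowerSeries.mk l6 = (R (-X) * R (-(X ^ 4)))⁻¹)
    (h7 : PowerSeries.mk l7 = R (X ^ 4) * (R X ^ 4)⁻¹)
    (h8 : PowerSeries.mk l8 = R X ^ 2 * (R (X ^ 4) ^ 3)⁻¹)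
    (h9 : PowerSeries.mk l9 = R X * (R (X ^ 16))⁻¹)
    (h10 : PowerSeries.mk l10 = R (X ^ 4) * (R X ^ 2 * R (X ^ 2))⁻¹)
    (h1' : PowerSeries.mk l1' = (PowerSeries.mk l1)⁻¹)
    (h2' : PowerSeries.mk l2' = (PowerSeries.mk l2)⁻¹)
    (h3' : PowerSeries.mk l3' = (PowerSeries.mk l3)⁻¹)
    (h4' : PowerSeries.mk l4' = (PowerSeries.mk l4)⁻¹)
    (h5' : PowerSeries.mk l5' = (PowerSeries.mk l5)⁻¹)
    (h6' : PowerSeries.mk l6' = (PowerSeries.mk l6)⁻¹)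
    (h7' : PowerSeries.mk l7' = (PowerSeries.mk l7)⁻¹)
    (h8' : PowerSeries.mk l8' = (PowerSeries.mk l8)⁻¹)
    (h9' : PowerSeries.mk l9' = (PowerSeries.mk l9)⁻¹)
    (h10' : PowerSeries.mk l10' = (PowerSeries.mk l10)⁻¹) :
    ∀ n : ℕ,
      (∀ r ∈ ({3, 4} : Set ℕ), l1 (5 * n + r) = -l1' (5 * n + r - 2)) ∧
      l2 (5 * n) = l2' (5 * n) ∧
      (∀ r ∈ ({1, 4} : Set ℕ), l3 (5 * n + r) = -l3' (5 * n + r)) ∧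
      (∀ r ∈ ({3, 4} : Set ℕ), l4 (5 * n + r) = -l4' (5 * n + r - 2)) ∧
      (∀ r ∈ ({3, 4} : Set ℕ), l5 (5 * n + r) = l5' (5 * n + r - 2)) ∧
      (∀ r ∈ ({5, 7} : Set ℕ), l6 (10 * n + r) = l6' (10 * n + r - 2)) ∧
      (∀ r ∈ ({1, 9} : Set ℕ), l7 (10 * n + r) = -l7' (10 * n + r)) ∧
      (∀ r ∈ ({5, 9} : Set ℕ), l8 (10 * n + r) = -l8' (10 * n + r - 4)) ∧
      (∀ r ∈ ({7, 9} : Set ℕ), l9 (10 * n + r) = l9' (10 * n + r - 6)) ∧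
      (∀ r ∈ ({0, 1} : Set ℕ), l10 (2 * n + r) = (-1) ^ r * l10' (2 * n + r)) ∧
      (∀ r ∈ ({2, 3} : Set ℕ), l10 (5 * n + r) = l10' (5 * n + r)) := by
  intro n
  refine ⟨?_, ?_, ?_, ?_, ?_, ?_, ?_, ?_, ?_, ?_, ?_⟩
  · rintro r (rfl | rfl) <;>
      exact eq_neg_of_suppIn h1 h1' (by simp) (by simp) suppIn_lambda_one (by omega)
        (natCast_mul_add_notMem n (by decide))
  · exact eq_of_suppIn h2 h2' (by simp) (by simp) suppIn_lambda_two (Nat.zero_le _)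
      (natCast_mul_add_notMem (r := 0) n (by decide))
  · rintro r (rfl | rfl) <;>
      exact eq_neg_of_suppIn h3 h3' (by simp) (by simp) suppIn_lambda_three (by omega)
        (natCast_mul_add_notMem n (by decide))
  · rintro r (rfl | rfl) <;>
      exact eq_neg_of_suppIn h4 h4' (by simp) (by simp) suppIn_lambda_four (by omega)
        (natCast_mul_add_notMem n (by decide))
  · rintro r (rfl | rfl) <;>
      exact eq_of_suppIn h5 h5' (by simp) (by simp) suppIn_lambda_five (by omega)
        (natCast_mul_add_notMem n (by decide))
  · rintro r (rfl | rfl) <;>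
      exact eq_of_suppIn h6 h6' (by simp) (by simp) suppIn_lambda_six (by omega)
        (natCast_mul_add_notMem n (by decide))
  · rintro r (rfl | rfl) <;>
      exact eq_neg_of_suppIn h7 h7' (by simp) (by simp) suppIn_lambda_seven (by omega)
        (natCast_mul_add_notMem n (by decide))
  · rintro r (rfl | rfl) <;>
      exact eq_neg_of_suppIn h8 h8' (by simp) (by simp) suppIn_lambda_eight (by omega)
        (natCast_mul_add_notMem n (by decide))
  · rintro r (rfl | rfl) <;>
      exact eq_of_suppIn h9 h9' (by simp) (by simp) suppIn_lambda_nine (by omega)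
        (natCast_mul_add_notMem n (by decide))
  · rintro r (rfl | rfl)
    · rw [pow_zero, one_mul]
      exact eq_of_suppIn h10 h10' (by simp) (by simp) suppIn_lambda_ten_odd (Nat.zero_le _)
        (natCast_mul_add_notMem n (by decide))
    · rw [pow_one, neg_one_mul]
      exact eq_neg_of_suppIn h10 h10' (by simp) (by simp) suppIn_lambda_ten_even (Nat.zero_le _)
        (natCast_mul_add_notMem n (by decide))
  · rintro r (rfl | rfl) <;>
      exact eq_of_suppIn h10 h10' (by simp) (by simp) suppIn_lambda_ten_mod_five (Nat.zero_le _)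
        (natCast_mul_add_notMem n (by decide))
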